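/- All vector spaces are over $\mathbb{C}$ and Sweedler notation is used. A *normal integral* on a Hopf algebra $H$ is a linear $\varphi:H\to\mathbb{C}$ with $\sum\varphi(x_1)x_2=\varphi(x)1=\sum x_1\varphi(x_2)$ for all $x$ and $\varphi(1)=1$. A *$*$-Hopf algebra* is a Hopf algebra with a conjugate linear, antimultiplicative and comultiplicative involution $*$. A *compact quantum group (CQG)* is a $*$-Hopf algebra $H$ with antipode $\mathcal S$ such that every right $H$-comodule $V$ admits an inner product (linear in the first variable) with $\sum\langle u_0,v\rangle\,\mathcal S(u_1)=\sum\langle u,v_0\rangle\,v_1^*$ for all $u,v\in V$. A *cocycle linked pair* $(A,H,\blacktriangleright,\rho,\chi,\psi)$ of Hopf algebras consists of Hopf algebras $A,H$ and linear maps $\blacktriangleright:H\otimes A\to A$, $\rho:H\to H\otimes A$, $\rho(x)=\sum x_H\otimes x_A$, $\chi:H\otimes H\to A$, and $\psi:H\to A\otimes A$, $\psi(x)=\sum x_I\otimes x_{II}$, such that for all $x,y,z\in H$, $a,b\in A$: 1. $x\blacktriangleright 1=\varepsilon(x)1$; $x\blacktriangleright ab=\sum(x_1\blacktriangleright a)(x_2\blacktriangleright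 b)$; $1\blacktriangleright a=a$; $\sum(x_1\blacktriangleright(y_1\blacktriangleright a))\chi(x_2,y_2)=\sum\chi(x_1,y_1)(x_2y_2\blacktriangleright a)$; $\sum(x_1\blacktriangleright\chi(y_1,z_1))\chi(x_2,y_2z_2)=\sum\chi(x_1,y_1)\chi(x_2y_2,z)$; $\chi(x,1)=\chi(1,x)=\varepsilon(x)1$. 2. $\sum\varepsilon(x_H)x_A=\varepsilon(x)1$; $\sum x_{H1}\otimes x_{H2}\otimes x_A=\sum x_{1H}\otimes x_{2H}\otimes x_{1A}x_{2A}$; $\sum x_H\varepsilon(x_A)=x$; $\sum x_{2HH}\otimes x_{1I}x_{2HA}\otimes x_{1II}x_{2A}=\sum x_{1H}\otimes x_{1A1}x_{2I}\otimes x_{1A2}x_{2II}$; $\sum x_{1I1}x_{2HI}\otimes x_{1I2}x_{2HII}\otimes x_{1II}x_{2A}=\sum x_{1I}\otimes x_{1II1}x_{2I}\otimes x_{1II2}x_{2II}$; $\sum\varepsilon(x_I)x_{II}=\sum x_I\varepsilon(x_{II})=\varepsilon(x)1$. 3. $\varepsilon(x\blacktriangleright a)=\varepsilon(x)\varepsilon(a)$;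 $\rho(1)=1\otimes1$; $\varepsilon(\chi(x,y))=\varepsilon(x)\varepsilon(y)$; $\psi(1)=1\otimes1$; $\sum(x_1\blacktriangleright a)_1x_{2I}\otimes(x_1\blacktriangleright a)_2x_{2II}=\sum x_{1I}(x_{2H}\blacktriangleright a_1)\otimes x_{1II}x_{2A}(x_3\blacktriangleright a_2)$; $\sum(x_2y_2)_H\otimes\chi(x_1,y_1)(x_2y_2)_A=\sum x_{1H}y_{1H}\otimes x_{1A}(x_2\blacktriangleright y_{1A})\chi(x_3,y_2)$; $\sum x_{2H}\otimes(x_1\blacktriangleright a)x_{2A}=\sum x_{1H}\otimes x_{1A}(x_2\blacktriangleright a)$; $\sum\chi(x_1,y_1)_1(x_2y_2)_I\otimes\chi(x_1,y_1)_2(x_2y_2)_{II}=\sum x_{1I}(x_{2H}\blacktriangleright y_{1I})\chi(x_{4H},y_{2H})\otimes x_{1II}x_{2A}(x_3\blacktriangleright y_{1II})x_{4A}(x_5\blacktriangleright y_{2A})\chi(x_6,y_3)$. The *cocycle bismash product* $A^\psi\#_\chi H$ is the space $A\otimes H$ (with $a\# x=a\otimes x$) with product $(a\#x)(b\#y)=\sum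 a(x_1\blacktriangleright b)\chi(x_2,y_1)\#x_3y_2$, unit $1\#1$, coproduct $\Delta(a\#x)=\sum a_1x_{1I}\#x_{2H}\otimes a_2x_{1II}x_{2A}\#x_3$ and counit $\varepsilon\otimes\varepsilon$. **Theorem.** Let $(A,H,\blacktriangleright,\rho,\chi,\psi)$ be a cocycle linked pair of Hopf algebras, where $A$ and $H$ are CQGs and $\chi$ and $\psi$ are convolution invertible. Let $\gamma:H\to A$, $\gamma(x)=\sum\chi^{-1}(x_2,\mathcal S^{-1}(x_1))$, where $\chi^{-1}$ is the convolution inverse of $\chi$. Let $\varphi_A,\varphi_H$ be the normal integrals of $A$ and $H$ and let $\Phi:A\otimes H\to\mathbb{C}$ be the linear map with $\Phi(a\#x)=\varphi_A(a)\varphi_H(x)$. Assume that $\Phi$ is central, i.e. $\Phi((a\#x)(b\#y))=\Phi((b\#y)(a\#x))$ for all $a,b\in A$, $x,y\in H$, and that for all $x,y\in H$, $a\in A$: $$\sum\gamma(x_2^*)\,(x_3^*\blacktriangleright\gamma(x_1)^*)=\varepsilon(x^*)1,$$ $$\sum\gamma(x_2^*)\,(x_3^*\blacktriangleright(x_1\blacktriangleright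 a)^*)=a^*\gamma(x^*),$$ $$\sum\gamma(y_1^*)\,(y_2^*\blacktriangleright\gamma(x_1^*))\,\chi(y_3^*,x_2^*)=\sum\gamma(y_2^*x_2^*)\,\big((y_3^*x_3^*)\blacktriangleright\chi(x_1,y_1)^*\big),$$ $$\sum(x_2^*)_H\otimes\gamma(x_1^*)(x_2^*)_A=\sum(x_{1H})^*\otimes\gamma(x_2^*)\,\big(x_3^*\blacktriangleright(x_{1A})^*\big),$$ $$\sum\gamma(x_1^*)_1(x_2^*)_I\otimes\gamma(x_1^*)_2(x_2^*)_{II}=\sum\gamma\big((x_{2H})^*\big)\big((x_{3H})^*\blacktriangleright(x_{1I})^*\big)\otimes\gamma(x_4^*)\big(x_5^*\blacktriangleright(x_{1II}x_{2A}x_{3A})^*\big).$$ Then $A^\psi\#_\chi H$ is a Hopf algebra and, with the involution $(a\#x)^*=\sum\gamma(x_1^*)(x_2^*\blacktriangleright a^*)\#x_3^*$, it is a CQG. -/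

import Mathlib

open scoped TensorProduct
open TensorProduct Coalgebra WithConv

universe u

noncomputable section

/-! ### Sweedler notation -/

section Sweedler

variable {M N P : Type*} [AddCommGroup M] [Module ℂ M] [AddCommGroup N] [Module ℂ N]
  [AddCommGroup P]

/-- `sw t f` is the Sweedler sum `∑ f mᵢ nᵢ`, where `t = ∑ mᵢ ⊗ nᵢ` is some way of writing the
tensor `t` as a finite sum of elementary tensors. By `sw_eq_sum` its value does not depend on the
way in which `t` is written as soon as `f` is additive in both variables and balanced over `ℂ`
(for instance bilinear, or conjugate linear in both variables); it is only used for such `f`. -/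
def sw (t : M ⊗[ℂ] N) (f : M → N → P) : P :=
  ∑ i ∈ (TensorProduct.exists_finset t).choose, f i.1 i.2

theorem sw_eq_sum {f : M → N → P}
    (h₁ : ∀ m m' n, f (m + m') n = f m n + f m' n)
    (h₂ : ∀ m n n', f m (n + n') = f m n + f m n')
    (h₃ : ∀ (c : ℂ) m n, f (c • m) n = f m (c • n))
    {ι : Type*} (s : Finset ι) (m : ι → M) (n : ι → N) :
    sw (∑ i ∈ s, m i ⊗ₜ[ℂ] n i) f = ∑ i ∈ s, f (m i) (n i) := by
  let g : M →+ N →+ P := AddMonoidHom.mk' (fun m => AddMonoidHom.mk' (f m) (h₂ m))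
    (fun m m' => by ext n; exact h₁ m m' n)
  let F : M ⊗[ℂ] N →+ P := TensorProduct.liftAddHom g h₃
  have key : ∀ t : M ⊗[ℂ] N, sw t f = F t := by
    intro t
    conv_rhs => rw [(TensorProduct.exists_finset t).choose_spec]
    rw [map_sum]
    rfl
  rw [key, map_sum]
  rfl

end Sweedler

section IteratedSweedler

variable {C P : Type*} [AddCommGroup C] [Module ℂ C] [Coalgebra ℂ C] [AddCommGroup P]

/-- `∑ f x₁ x₂`, where `Δ x = ∑ x₁ ⊗ x₂`. -/
def sw2 (x : C) (f : C → C → P) : P := sw (comul (R := ℂ) x) f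

/-- `∑ f x₁ x₂ x₃`. -/
def sw3 (x : C) (f : C → C → C → P) : P := sw2 x fun x₁ r => sw2 r (f x₁)

/-- `∑ f x₁ x₂ x₃ x₄`. -/
def sw4 (x : C) (f : C → C → C → C → P) : P := sw2 x fun x₁ r => sw3 r (f x₁)

/-- `∑ f x₁ x₂ x₃ x₄ x₅`. -/
def sw5 (x : C) (f : C → C → C → C → C → P) : P := sw2 x fun x₁ r => sw4 r (f x₁)

/-- `∑ f x₁ x₂ x₃ x₄ x₅ x₆`. -/
def sw6 (x : C) (f : C → C → C → C → C → C → P) : P := sw2 x fun x₁ r => sw5 r (f x₁)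

end IteratedSweedler

/-! ### Integrals, compact quantum groups -/

/-- A normal integral: a left and right integral `φ ∈ H^∨` with `φ 1 = 1`. -/
structure IsNormalIntegral {H : Type*} [Ring H] [HopfAlgebra ℂ H] (φ : H →ₗ[ℂ] ℂ) : Prop where
  right : ∀ x, sw2 x (fun x₁ x₂ => φ x₁ • x₂) = φ x • (1 : H)
  left : ∀ x, sw2 x (fun x₁ x₂ => φ x₂ • x₁) = φ x • (1 : H)
  normal : φ 1 = 1

/-- `δ : V → V ⊗ C` is a right `C`-comodule structure on `V`. -/
structure IsRightComodule {C V : Type*} [AddCommGroup C] [Module ℂ C] [Coalgebra ℂ C]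
    [AddCommGroup V] [Module ℂ V] (δ : V →ₗ[ℂ] V ⊗[ℂ] C) : Prop where
  coassoc : ∀ v, TensorProduct.assoc ℂ V C C (δ.rTensor C (δ v)) =
    (comul (R := ℂ) (A := C)).lTensor V (δ v)
  counit : ∀ v, TensorProduct.rid ℂ V ((counit (R := ℂ) (A := C)).lTensor V (δ v)) = v

/-- An inner product on a complex vector space, linear in the first variable and conjugate linear
in the second one. -/
structure IsInnerProduct {V : Type*} [AddCommGroup V] [Module ℂ V]
    (B : V →ₗ[ℂ] V →ₗ⋆[ℂ] ℂ) : Prop where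
  hermitian : ∀ u v, B v u = star (B u v)
  pos : ∀ v, v ≠ 0 → 0 < (B v v).re

/-- A compact quantum group: a `*`-Hopf algebra (a Hopf algebra with a conjugate linear,
antimultiplicative and comultiplicative involution) such that every right comodule `(V, δ)` admits
an invariant inner product, that is one with `∑ ⟨u₀, v⟩ S(u₁) = ∑ ⟨u, v₀⟩ v₁^*`. -/
structure IsCQG (H : Type u) [Ring H] [HopfAlgebra ℂ H] [StarRing H] [StarModule ℂ H] : Prop where
  comul_star : ∀ x : H, comul (R := ℂ) (star x) = star (comul (R := ℂ) x)
  exists_inner : ∀ (V : Type u) [AddCommGroup V] [Module ℂ V] (δ : V →ₗ[ℂ] V ⊗[ℂ] H),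
    IsRightComodule δ → ∃ B : V →ₗ[ℂ] V →ₗ⋆[ℂ] ℂ, IsInnerProduct B ∧
      ∀ u v, sw (δ u) (fun u₀ u₁ => B u₀ v • HopfAlgebra.antipode ℂ u₁) =
        sw (δ v) (fun v₀ v₁ => B u v₀ • star v₁)

/-! ### Cocycle linked pairs -/

/-- A cocycle linked pair `(A, H, ▸, ρ, χ, ψ)`. We write `χ (x ⊗ₜ y)` for `χ(x, y)`,
`ρ x = ∑ x_H ⊗ x_A` and `ψ x = ∑ x_I ⊗ x_II`. -/
structure CocycleLinkedPair (A H : Type*) [Ring A] [Bialgebra ℂ A] [Ring H] [Bialgebra ℂ H] where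
  act : H →ₗ[ℂ] A →ₗ[ℂ] A
  ρ : H →ₗ[ℂ] H ⊗[ℂ] A
  χ : H ⊗[ℂ] H →ₗ[ℂ] A
  ψ : H →ₗ[ℂ] A ⊗[ℂ] A
  -- `(A, ▸, χ)` is a cocycle left `H`-module algebra
  act_one : ∀ x, act x 1 = counit (R := ℂ) x • (1 : A)
  act_mul : ∀ x a b, act x (a * b) = sw2 x fun x₁ x₂ => act x₁ a * act x₂ b
  one_act : ∀ a, act 1 a = a
  act_act : ∀ x y a,
    (sw2 x fun x₁ x₂ => sw2 y fun y₁ y₂ => act x₁ (act y₁ a) * χ (x₂ ⊗ₜ y₂)) =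
      sw2 x fun x₁ x₂ => sw2 y fun y₁ y₂ => χ (x₁ ⊗ₜ y₁) * act (x₂ * y₂) a
  cocycle : ∀ x y z,
    (sw2 x fun x₁ x₂ => sw2 y fun y₁ y₂ => sw2 z fun z₁ z₂ =>
      act x₁ (χ (y₁ ⊗ₜ z₁)) * χ (x₂ ⊗ₜ (y₂ * z₂))) =
      sw2 x fun x₁ x₂ => sw2 y fun y₁ y₂ => χ (x₁ ⊗ₜ y₁) * χ ((x₂ * y₂) ⊗ₜ z)
  χ_one_right : ∀ x, χ (x ⊗ₜ 1) = counit (R := ℂ) x • (1 : A)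
  χ_one_left : ∀ x, χ (1 ⊗ₜ x) = counit (R := ℂ) x • (1 : A)
  -- `(H, ρ, ψ)` is a cocycle right `A`-comodule coalgebra
  counit_ρ : ∀ x, (sw (ρ x) fun xH xA => counit (R := ℂ) xH • xA) =
    counit (R := ℂ) x • (1 : A)
  comul_ρ : ∀ x,
    (sw (ρ x) fun xH xA => sw2 xH fun xH₁ xH₂ => xH₁ ⊗ₜ[ℂ] (xH₂ ⊗ₜ[ℂ] xA)) =
      sw2 x fun x₁ x₂ => sw (ρ x₁) fun x₁H x₁A => sw (ρ x₂) fun x₂H x₂A =>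
        x₁H ⊗ₜ[ℂ] (x₂H ⊗ₜ[ℂ] (x₁A * x₂A))
  ρ_counit : ∀ x, (sw (ρ x) fun xH xA => counit (R := ℂ) xA • xH) = x
  ρ_ρ : ∀ x,
    (sw2 x fun x₁ x₂ => sw (ψ x₁) fun x₁I x₁II => sw (ρ x₂) fun x₂H x₂A =>
      sw (ρ x₂H) fun x₂HH x₂HA => x₂HH ⊗ₜ[ℂ] ((x₁I * x₂HA) ⊗ₜ[ℂ] (x₁II * x₂A))) =
      sw2 x fun x₁ x₂ => sw (ρ x₁) fun x₁H x₁A => sw2 x₁A fun x₁A₁ x₁A₂ =>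
        sw (ψ x₂) fun x₂I x₂II => x₁H ⊗ₜ[ℂ] ((x₁A₁ * x₂I) ⊗ₜ[ℂ] (x₁A₂ * x₂II))
  cococycle : ∀ x,
    (sw2 x fun x₁ x₂ => sw (ψ x₁) fun x₁I x₁II => sw2 x₁I fun x₁I₁ x₁I₂ =>
      sw (ρ x₂) fun x₂H x₂A => sw (ψ x₂H) fun x₂HI x₂HII =>
        (x₁I₁ * x₂HI) ⊗ₜ[ℂ] ((x₁I₂ * x₂HII) ⊗ₜ[ℂ] (x₁II * x₂A))) =
      sw2 x fun x₁ x₂ => sw (ψ x₁) fun x₁I x₁II => sw2 x₁II fun x₁II₁ x₁II₂ =>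
        sw (ψ x₂) fun x₂I x₂II => x₁I ⊗ₜ[ℂ] ((x₁II₁ * x₂I) ⊗ₜ[ℂ] (x₁II₂ * x₂II))
  counit_ψ_left : ∀ x, (sw (ψ x) fun xI xII => counit (R := ℂ) xI • xII) =
    counit (R := ℂ) x • (1 : A)
  counit_ψ_right : ∀ x, (sw (ψ x) fun xI xII => counit (R := ℂ) xII • xI) =
    counit (R := ℂ) x • (1 : A)
  -- compatibility relations
  counit_act : ∀ x a, counit (R := ℂ) (act x a) = counit (R := ℂ) x * counit (R := ℂ) a
  ρ_one : ρ 1 = 1 ⊗ₜ 1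
  counit_χ : ∀ x y, counit (R := ℂ) (χ (x ⊗ₜ y)) = counit (R := ℂ) x * counit (R := ℂ) y
  ψ_one : ψ 1 = 1 ⊗ₜ 1
  comul_act : ∀ x a,
    (sw2 x fun x₁ x₂ => sw2 (act x₁ a) fun b₁ b₂ => sw (ψ x₂) fun x₂I x₂II =>
      (b₁ * x₂I) ⊗ₜ[ℂ] (b₂ * x₂II)) =
      sw3 x fun x₁ x₂ x₃ => sw2 a fun a₁ a₂ => sw (ψ x₁) fun x₁I x₁II =>
        sw (ρ x₂) fun x₂H x₂A =>
          (x₁I * act x₂H a₁) ⊗ₜ[ℂ] (x₁II * x₂A * act x₃ a₂)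
  ρ_mul : ∀ x y,
    (sw2 x fun x₁ x₂ => sw2 y fun y₁ y₂ => sw (ρ (x₂ * y₂)) fun h a =>
      h ⊗ₜ[ℂ] (χ (x₁ ⊗ₜ y₁) * a)) =
      sw3 x fun x₁ x₂ x₃ => sw2 y fun y₁ y₂ => sw (ρ x₁) fun x₁H x₁A =>
        sw (ρ y₁) fun y₁H y₁A =>
          (x₁H * y₁H) ⊗ₜ[ℂ] (x₁A * act x₂ y₁A * χ (x₃ ⊗ₜ y₂))
  ρ_act : ∀ x a,
    (sw2 x fun x₁ x₂ => sw (ρ x₂) fun x₂H x₂A => x₂H ⊗ₜ[ℂ] (act x₁ a * x₂A)) =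
      sw2 x fun x₁ x₂ => sw (ρ x₁) fun x₁H x₁A => x₁H ⊗ₜ[ℂ] (x₁A * act x₂ a)
  comul_χ : ∀ x y,
    (sw2 x fun x₁ x₂ => sw2 y fun y₁ y₂ => sw2 (χ (x₁ ⊗ₜ y₁)) fun c₁ c₂ =>
      sw (ψ (x₂ * y₂)) fun pI pII => (c₁ * pI) ⊗ₜ[ℂ] (c₂ * pII)) =
      sw6 x fun x₁ x₂ x₃ x₄ x₅ x₆ => sw3 y fun y₁ y₂ y₃ =>
        sw (ψ x₁) fun x₁I x₁II => sw (ρ x₂) fun x₂H x₂A => sw (ρ x₄) fun x₄H x₄A =>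
          sw (ψ y₁) fun y₁I y₁II => sw (ρ y₂) fun y₂H y₂A =>
            (x₁I * act x₂H y₁I * χ (x₄H ⊗ₜ y₂H)) ⊗ₜ[ℂ]
              (x₁II * x₂A * act x₃ y₁II * x₄A * act x₅ y₂A * χ (x₆ ⊗ₜ y₃))

/-! ### The cocycle bismash product -/

namespace CocycleLinkedPair

variable {A H : Type*} [Ring A] [Ring H]

section Bismash

variable [Bialgebra ℂ A] [Bialgebra ℂ H] (L : CocycleLinkedPair A H)

/-- The product `(a # x)(b # y)` in `A^ψ #_χ H`. -/
def bismashMul (a : A) (x : H) (b : A) (y : H) : A ⊗[ℂ] H :=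
  sw3 x fun x₁ x₂ x₃ => sw2 y fun y₁ y₂ =>
    (a * L.act x₁ b * L.χ (x₂ ⊗ₜ y₁)) ⊗ₜ[ℂ] (x₃ * y₂)

/-- The coproduct `Δ(a # x)` of `A^ψ #_χ H`. -/
def bismashComul (a : A) (x : H) : (A ⊗[ℂ] H) ⊗[ℂ] (A ⊗[ℂ] H) :=
  sw2 a fun a₁ a₂ => sw3 x fun x₁ x₂ x₃ => sw (L.ψ x₁) fun x₁I x₁II =>
    sw (L.ρ x₂) fun x₂H x₂A =>
      ((a₁ * x₁I) ⊗ₜ[ℂ] x₂H) ⊗ₜ[ℂ] ((a₂ * x₁II * x₂A) ⊗ₜ[ℂ] x₃)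

/-- The element `(a # x)^* = ∑ γ(x₁^*) (x₂^* ▸ a^*) # x₃^*`. -/
def bismashStar [StarRing A] [StarRing H] (γ : H → A) (a : A) (x : H) : A ⊗[ℂ] H :=
  sw3 x fun x₁ x₂ x₃ => (γ (star x₁) * L.act (star x₂) (star a)) ⊗ₜ[ℂ] star x₃

/-- The bialgebra `M` is the cocycle bismash product `A^ψ #_χ H`: its underlying vector space is
`A ⊗ H` (through the linear isomorphism `e`), and its product, unit, coproduct and counit are
those of `A^ψ #_χ H`. -/
structure IsBismashProduct {M : Type*} [Ring M] [Bialgebra ℂ M] (e : A ⊗[ℂ] H ≃ₗ[ℂ] M) :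
    Prop where
  mul : ∀ a x b y, e (a ⊗ₜ x) * e (b ⊗ₜ y) = e (L.bismashMul a x b y)
  one : (1 : M) = e (1 ⊗ₜ 1)
  comul : ∀ a x, comul (R := ℂ) (e (a ⊗ₜ x)) =
    TensorProduct.map e.toLinearMap e.toLinearMap (L.bismashComul a x)
  counit : ∀ a x, counit (R := ℂ) (e (a ⊗ₜ x)) = counit (R := ℂ) a * counit (R := ℂ) x

end Bismash

section Star

variable [Bialgebra ℂ A] [Bialgebra ℂ H] [StarRing A] [StarRing H]

/-- The conditions under which `γ` defines a `*`-structure on `A^ψ #_χ H` by the formula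
`(a # x)^* = ∑ γ(x₁^*) (x₂^* ▸ a^*) # x₃^*`. -/
structure StarConditions (L : CocycleLinkedPair A H) (γ : H → A) : Prop where
  cond₀ : ∀ x, (sw3 x fun x₁ x₂ x₃ => γ (star x₂) * L.act (star x₃) (star (γ x₁))) =
    counit (R := ℂ) (star x) • (1 : A)
  cond₁ : ∀ x a, (sw3 x fun x₁ x₂ x₃ => γ (star x₂) * L.act (star x₃) (star (L.act x₁ a))) =
    star a * γ (star x)
  cond₂ : ∀ x y,
    (sw2 x fun x₁ x₂ => sw3 y fun y₁ y₂ y₃ =>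
      γ (star y₁) * L.act (star y₂) (γ (star x₁)) * L.χ (star y₃ ⊗ₜ star x₂)) =
      sw3 x fun x₁ x₂ x₃ => sw3 y fun y₁ y₂ y₃ =>
        γ (star y₂ * star x₂) * L.act (star y₃ * star x₃) (star (L.χ (x₁ ⊗ₜ y₁)))
  cond₃ : ∀ x,
    (sw2 x fun x₁ x₂ => sw (L.ρ (star x₂)) fun h a => h ⊗ₜ[ℂ] (γ (star x₁) * a)) =
      sw3 x fun x₁ x₂ x₃ => sw (L.ρ x₁) fun x₁H x₁A =>
        star x₁H ⊗ₜ[ℂ] (γ (star x₂) * L.act (star x₃) (star x₁A))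
  cond₄ : ∀ x,
    (sw2 x fun x₁ x₂ => sw2 (γ (star x₁)) fun g₁ g₂ => sw (L.ψ (star x₂)) fun pI pII =>
      (g₁ * pI) ⊗ₜ[ℂ] (g₂ * pII)) =
      sw5 x fun x₁ x₂ x₃ x₄ x₅ => sw (L.ψ x₁) fun x₁I x₁II =>
        sw (L.ρ x₂) fun x₂H x₂A => sw (L.ρ x₃) fun x₃H x₃A =>
          (γ (star x₂H) * L.act (star x₃H) (star x₁I)) ⊗ₜ[ℂ]
            (γ (star x₄) * L.act (star x₅) (star (x₁II * x₂A * x₃A)))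

end Star

end CocycleLinkedPair

/-- The counit of a `*`-bialgebra commutes with the conjugations. -/
theorem counit_star_of_comul_star {H : Type*} [Ring H] [HopfAlgebra ℂ H] [StarRing H]
    [StarModule ℂ H]
    (h : ∀ x : H, comul (R := ℂ) (star x) = star (comul (R := ℂ) x)) (x : H) :
    counit (R := ℂ) (star x) = star (counit (R := ℂ) x) := by
  have hx := (ℛ ℂ x).eq
  have hs : comul (R := ℂ) (star x) =
      ∑ i ∈ (ℛ ℂ x).index, star ((ℛ ℂ x).left i) ⊗ₜ[ℂ] star ((ℛ ℂ x).right i) := by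
    rw [h, ← hx, star_sum]; rfl
  have h1 : ∑ i ∈ (ℛ ℂ x).index,
      counit (R := ℂ) (star ((ℛ ℂ x).right i)) • star ((ℛ ℂ x).left i) = star x := by
    have := Coalgebra.lTensor_counit_comul (R := ℂ) (star x)
    rw [hs, map_sum] at this
    simpa using congrArg (TensorProduct.rid ℂ H) this
  have h2 : ∑ i ∈ (ℛ ℂ x).index,
      counit (R := ℂ) ((ℛ ℂ x).left i) • (ℛ ℂ x).right i = x :=
    Coalgebra.sum_counit_smul (ℛ ℂ x)
  have h1' := congrArg (fun y => counit (R := ℂ) (star y)) h1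
  have h2' := congrArg (fun y => star (counit (R := ℂ) (star y))) h2
  simp only [star_sum, star_smul, star_star, map_sum, map_smul, smul_eq_mul] at h1' h2'
  have : star (counit (R := ℂ) x) = counit (R := ℂ) (star x) := by
    rw [← h1', ← star_inj, ← h2', star_star]
    refine Finset.sum_congr rfl fun i _ => ?_
    simp [mul_comm]
  exact this.symm

/-- The antipode of a `*`-Hopf algebra is bijective. -/
theorem antipode_bijective {H : Type*} [Ring H] [HopfAlgebra ℂ H] [StarRing H]
    [StarModule ℂ H]
    (h : ∀ x : H, comul (R := ℂ) (star x) = star (comul (R := ℂ) x)) :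
    Function.Bijective (HopfAlgebra.antipode ℂ (A := H)) := by
  let S := HopfAlgebra.antipode ℂ (A := H)
  let T : H →ₗ[ℂ] H :=
    { toFun := fun x => S (star (S (star x)))
      map_add' := by intro x y; simp
      map_smul' := by intro c x; simp }
  have hT : toConv S * toConv T = 1 := by
    ext x
    rw [(ℛ ℂ x).convMul_apply]
    have hs : comul (R := ℂ) (star x) =
        ∑ i ∈ (ℛ ℂ x).index, star ((ℛ ℂ x).left i) ⊗ₜ[ℂ] star ((ℛ ℂ x).right i) := by
      rw [h, ← (ℛ ℂ x).eq, star_sum]; rfl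
    have h1 := HopfAlgebra.mul_antipode_lTensor_comul_apply (R := ℂ) (star x)
    rw [hs, map_sum, map_sum] at h1
    simp only [LinearMap.lTensor_tmul, LinearMap.mul'_apply] at h1
    have h2 := congrArg (fun y => S (star y)) h1
    simp only [star_sum, star_mul, star_star, map_sum] at h2
    simp only [S, HopfAlgebra.antipode_mul_antidistrib] at h2
    rw [counit_star_of_comul_star h, Algebra.algebraMap_eq_smul_one, star_smul, star_star,
      star_one, map_smul, HopfAlgebra.antipode_one] at h2
    simpa [Algebra.algebraMap_eq_smul_one, T, S] using h2
  have hid : toConv T = toConv LinearMap.id := by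
    have := LinearMap.id_mul_antipode (R := ℂ) (C := H)
    calc toConv T = (toConv LinearMap.id * toConv S) * toConv T := by
          rw [this, one_mul]
      _ = toConv LinearMap.id := by rw [mul_assoc, hT, mul_one]
  have key : ∀ x, S (star (S (star x))) = x := fun x =>
    congrArg (fun f : WithConv (H →ₗ[ℂ] H) => f.ofConv x) hid
  refine ⟨fun x y hxy => ?_, fun x => ⟨_, key x⟩⟩
  have hinv : ∀ x, star (S (star (S x))) = x := fun x => by
    have := congrArg star (key (star x))
    simpa using this
  have hxy' : S x = S y := hxy
  rw [← hinv x, ← hinv y, hxy']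

/-- The inverse `S⁻¹` of the antipode `S` of `H` (which is bijective if `H` carries a
`*`-Hopf algebra structure, see `antipode_bijective`). -/
def antipodeInv (H : Type*) [Ring H] [HopfAlgebra ℂ H] : H → H :=
  Function.invFun (HopfAlgebra.antipode ℂ (A := H))

/-- The map `γ(x) = ∑ χ⁻¹(x₂, S⁻¹ x₁)`, where `χinv` is the convolution inverse of `χ`. -/
def gammaOf {A H : Type*} [Ring A] [Algebra ℂ A] [Ring H] [HopfAlgebra ℂ H]
    (χinv : H ⊗[ℂ] H →ₗ[ℂ] A) (x : H) : A :=
  sw2 x fun x₁ x₂ => χinv (x₂ ⊗ₜ antipodeInv H x₁)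

end

/-! Write `K` for the bismash product, `i(a) = a # 1` and `j(x) = 1 # x`. Linear maps from a
coalgebra to an algebra form an algebra under convolution. In Hom(H, B), Hom(H, Hom(H, B)) and so
on, the axioms of a linked pair become short product identities: `act_act_conv`, `cocycle_conv`,
`comul_act_conv`, `ρ_mul_conv`, `ρ_ρ_conv`, `cococycle_conv`, `comul_χ_conv`. This replaces most of
the manipulation of Sweedler indices by associativity of a product.

Hopf structure. The algebra `K` is generated by `A` and `j` subject to `j_mul_i` and `j_mul_j`, so
homomorphisms out of `K` are given by their values on these generators (`lift`, `algHom_ext`). The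
coproduct and the counit arise in this way, and coassociativity and the counit laws need only be
checked on `i` and `j`. In the convolution algebra of endomorphisms of `K` the identity factors as
`(i ∘ toA) * (j ∘ toH)`, where `toH` is a coalgebra map (`toA_mul_toH`). Invertibility of `χ` makes
`j` convolution invertible, invertibility of `ψ` does the same for `toA`, and the antipode is the
product of the two inverses in the opposite order.

Involution. It is determined by `i(a)^* = i(a^*)` and `j(x)^* = jh(x^*)`, where `jh(z) = ∑ γ(z₁) #
z₂`. The first three conditions on `γ` say that this is antimultiplicative and involutive, the last
two that it respects the coproduct.

Compactness. A `*`-Hopf algebra is a CQG if it has a normal integral `φ` for which `φ(y^* x)` is an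
inner product: averaging any inner product of a comodule with `φ` makes it invariant
(`isCQG_of_isInnerProduct`). Conversely, on a CQG the form `φ(y^* x)` is an inner product
(`IsCQG.isInnerProduct_starForm`). This is applied to `Φ`. The choice of `γ` gives `jh(S x) =
jinv(x)`, the convolution inverse of `j`. With strong invariance of `φ_H` this yields `Φ(i(c) j(y)
jh(z)) = φ_A(c) φ_H(yz)`, and centrality then gives `Φ((b # y)^* (a # x)) = φ_A(b^* a) φ_H(x y^*)`.
So the form of `Φ` is a tensor product of two inner products, hence positive definite. -/

noncomputable section

/-! ### Convolution algebras -/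

/-- The convolution algebra of linear maps from a coalgebra to an algebra. -/
abbrev Cv (C B : Type*) [AddCommGroup C] [Module ℂ C] [Ring B] [Algebra ℂ B] :=
  WithConv (C →ₗ[ℂ] B)

/-! ### Chosen representatives of tensors -/

section Rep

variable {M N P : Type*} [AddCommGroup M] [Module ℂ M] [AddCommGroup N] [Module ℂ N]
  [AddCommGroup P] [Module ℂ P]

/-- The finite set of elementary tensors used by `sw`. -/
def rep (t : M ⊗[ℂ] N) : Finset (M × N) := (TensorProduct.exists_finset t).choose

theorem eq_sum_rep (t : M ⊗[ℂ] N) : t = ∑ i ∈ rep t, i.1 ⊗ₜ[ℂ] i.2 :=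
  (TensorProduct.exists_finset t).choose_spec

/-- Turns the Sweedler sums of the hypotheses into finite sums, which can be reordered freely even
before any bilinearity is known. -/
theorem sw_eq_sum_rep {P : Type*} [AddCommGroup P] (t : M ⊗[ℂ] N) (f : M → N → P) :
    sw t f = ∑ i ∈ rep t, f i.1 i.2 := rfl

theorem apply_eq_sum_rep (F : M ⊗[ℂ] N →ₗ[ℂ] P) (t : M ⊗[ℂ] N) :
    F t = ∑ i ∈ rep t, F (i.1 ⊗ₜ i.2) := by
  conv_lhs => rw [eq_sum_rep t, map_sum]

theorem apply_eq_sum_rep' {F : Type*} {P : Type*} [AddCommGroup P] [FunLike F (M ⊗[ℂ] N) P]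
    [AddMonoidHomClass F (M ⊗[ℂ] N) P] (g : F) (t : M ⊗[ℂ] N) :
    g t = ∑ i ∈ rep t, g (i.1 ⊗ₜ i.2) := by
  conv_lhs => rw [eq_sum_rep t, map_sum]

end Rep

section Cv

namespace Cv

section Apply

variable {C B : Type*} [AddCommGroup C] [Module ℂ C] [Ring B] [Algebra ℂ B]

theorem ext_fn {f g : Cv C B} (h : ∀ x, f x = g x) : f = g :=
  WithConv.ext (LinearMap.ext h)

theorem add_apply (f g : Cv C B) (x : C) : (f + g) x = f x + g x := rfl

theorem smul_apply (c : ℂ) (f : Cv C B) (x : C) : (c • f) x = c • f x := rfl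

theorem sum_apply {ι : Type*} (s : Finset ι) (f : ι → Cv C B) (x : C) :
    (∑ i ∈ s, f i) x = ∑ i ∈ s, f i x := by
  rw [WithConv.ofConv_sum, LinearMap.sum_apply]

theorem toConv_apply (f : C →ₗ[ℂ] B) (x : C) : (toConv f : Cv C B) x = f x := rfl

end Apply

variable {C D B B' B'' E : Type*} [AddCommGroup C] [Module ℂ C] [Coalgebra ℂ C]
  [AddCommGroup D] [Module ℂ D] [Coalgebra ℂ D] [AddCommGroup E] [Module ℂ E] [Coalgebra ℂ E]
  [Ring B] [Algebra ℂ B] [Ring B'] [Algebra ℂ B'] [Ring B''] [Algebra ℂ B'']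

theorem mul_apply (f g : Cv C B) (x : C) :
    (f * g) x = ∑ i ∈ rep (comul (R := ℂ) x), f i.1 * g i.2 := by
  rw [LinearMap.convMul_apply]
  exact apply_eq_sum_rep (LinearMap.mul' ℂ B ∘ₗ map f.ofConv g.ofConv) _

theorem one_apply (x : C) : (1 : Cv C B) x = counit (R := ℂ) x • (1 : B) := by
  rw [LinearMap.convOne_apply, Algebra.algebraMap_eq_smul_one]

variable (C) in
/-- Composition with an algebra homomorphism. -/
def push (q : B →ₐ[ℂ] B') : Cv C B →ₐ[ℂ] Cv C B' :=
  AlgHom.ofLinearMap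
    { toFun := fun f => toConv (q.toLinearMap ∘ₗ f.ofConv)
      map_add' := fun f g => ext_fn fun x => by simp
      map_smul' := fun c f => ext_fn fun x => by simp }
    (ext_fn fun x => by simp)
    (fun f g => ext_fn fun x => by
      change q ((f * g) x) = _
      rw [mul_apply, mul_apply, map_sum]
      simp)

@[simp] theorem push_apply (q : B →ₐ[ℂ] B') (f : Cv C B) (x : C) : push C q f x = q (f x) := rfl

theorem push_push (q : B →ₐ[ℂ] B') (r : B' →ₐ[ℂ] B'') (f : Cv C B) :
    push C r (push C q f) = push C (r.comp q) f := rfl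

variable (B) in
/-- Composition with a coalgebra homomorphism. -/
def pull (p : C →ₗc[ℂ] D) : Cv D B →ₐ[ℂ] Cv C B :=
  AlgHom.ofLinearMap
    { toFun := fun f => toConv (f.ofConv ∘ₗ p.toLinearMap)
      map_add' := fun f g => ext_fn fun x => by simp
      map_smul' := fun c f => ext_fn fun x => by simp }
    (ext_fn fun x => by
      change (1 : Cv D B) (p x) = _
      simp)
    (fun f g => by
      apply WithConv.ext
      exact LinearMap.convMul_comp_coalgHom_distrib f g p)

@[simp] theorem pull_apply (p : C →ₗc[ℂ] D) (f : Cv D B) (x : C) : pull B p f x = f (p x) := rfl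

theorem sum_rep_counit_smul (x : C) :
    ∑ i ∈ rep (comul (R := ℂ) x), counit (R := ℂ) i.1 • i.2 = x := by
  have h := congrArg (TensorProduct.lid ℂ C) (Coalgebra.rTensor_counit_comul (R := ℂ) x)
  rw [apply_eq_sum_rep (LinearMap.rTensor C (counit (R := ℂ) (A := C))), map_sum] at h
  simpa using h

theorem sum_rep_counit_smul' (x : C) :
    ∑ i ∈ rep (comul (R := ℂ) x), counit (R := ℂ) i.2 • i.1 = x := by
  have h := congrArg (TensorProduct.rid ℂ C) (Coalgebra.lTensor_counit_comul (R := ℂ) x)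
  rw [apply_eq_sum_rep (LinearMap.lTensor C (counit (R := ℂ) (A := C))), map_sum] at h
  simpa using h

variable (C B) in
/-- Constants as a linear map. -/
def constₗ : B →ₗ[ℂ] Cv C B where
  toFun b := toConv ((counit (R := ℂ) (A := C)).smulRight b)
  map_add' f g := ext_fn fun x => by simp
  map_smul' c f := ext_fn fun x => smul_comm _ _ _

theorem constₗ_apply (b : B) (x : C) : constₗ C B b x = counit (R := ℂ) x • b := rfl

theorem mul_constₗ_apply (f : Cv C B) (b : B) (x : C) : (f * constₗ C B b) x = f x * b := by
  conv_rhs => rw [← sum_rep_counit_smul' x, map_sum, Finset.sum_mul]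
  rw [mul_apply]
  simp [constₗ_apply]

variable (C B) in
/-- Constants: `x ↦ ε(x) b`. -/
def const : B →ₐ[ℂ] Cv C B :=
  AlgHom.ofLinearMap (constₗ C B) (ext_fn fun x => by rw [one_apply, constₗ_apply])
    (fun f g => ext_fn fun x => by
      rw [mul_constₗ_apply, constₗ_apply, constₗ_apply, smul_mul_assoc])

@[simp] theorem const_apply (b : B) (x : C) : const C B b x = counit (R := ℂ) x • b := rfl

theorem mul_const_apply (f : Cv C B) (b : B) (x : C) : (f * const C B b) x = f x * b := by
  conv_rhs => rw [← sum_rep_counit_smul' x, map_sum, Finset.sum_mul]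
  rw [mul_apply]
  simp

theorem const_mul_apply (f : Cv C B) (b : B) (x : C) : (const C B b * f) x = b * f x := by
  conv_rhs => rw [← sum_rep_counit_smul x, map_sum, Finset.mul_sum]
  rw [mul_apply]
  simp

theorem push_const (q : B →ₐ[ℂ] B') (b : B) : push C q (const C B b) = const C B' (q b) :=
  ext_fn fun x => by simp

/-- Currying as a linear map. -/
def curryₗ : Cv (C ⊗[ℂ] D) B →ₗ[ℂ] Cv D (Cv C B) where
  toFun f := toConv ((WithConv.linearEquiv ℂ (C →ₗ[ℂ] B)).symm.toLinearMap ∘ₗ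
    (TensorProduct.curry f.ofConv).flip)
  map_add' _ _ := rfl
  map_smul' _ _ := rfl

theorem curryₗ_apply (f : Cv (C ⊗[ℂ] D) B) (x : C) (y : D) :
    curryₗ f y x = f (x ⊗ₜ y) := rfl

/-- Currying, with the second variable outside. -/
def curry : Cv (C ⊗[ℂ] D) B →ₐ[ℂ] Cv D (Cv C B) :=
  AlgHom.ofLinearMap curryₗ
    (ext_fn fun y => ext_fn fun x => by
      rw [curryₗ_apply, one_apply, one_apply, smul_apply, one_apply, smul_smul,
        TensorProduct.counit_tmul, smul_eq_mul])
    (fun f g => ext_fn fun y => ext_fn fun x => by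
      rw [curryₗ_apply, mul_apply (curryₗ f), sum_apply, LinearMap.convMul_apply,
        TensorProduct.comul_tmul]
      simp only [mul_apply, curryₗ_apply]
      conv_lhs => rw [eq_sum_rep (comul (R := ℂ) x), eq_sum_rep (comul (R := ℂ) y)]
      simp only [tmul_sum, sum_tmul, map_sum, LinearMap.mul'_apply, map_tmul,
        AlgebraTensorModule.tensorTensorTensorComm_tmul])

end Cv

end Cv

/-! ### Functions of two variables on a bialgebra -/

section Bialg

variable {H B B' : Type*} [Ring H] [Bialgebra ℂ H] [Ring B] [Algebra ℂ B] [Ring B'] [Algebra ℂ B']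

namespace Cv

variable (H B) in
/-- Precomposition with the product: `f ↦ (y ↦ x ↦ f (x y))`. -/
def mm : Cv H B →ₐ[ℂ] Cv H (Cv H B) := curry.comp (pull B (Bialgebra.mulCoalgHom ℂ H))

@[simp] theorem mm_apply (f : Cv H B) (x y : H) : mm H B f y x = f (x * y) := rfl

variable (H B) in
/-- The first variable: `f ↦ (y ↦ x ↦ ε(y) f(x))`. -/
abbrev fx : Cv H B →ₐ[ℂ] Cv H (Cv H B) := const H (Cv H B)

variable (H B) in
/-- The second variable: `f ↦ (y ↦ x ↦ ε(x) f(y))`. -/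
abbrev fy : Cv H B →ₐ[ℂ] Cv H (Cv H B) := push H (const H B)

theorem mm_mm (f : Cv H B) : mm H (Cv H B) (mm H B f) = push H (mm H B) (mm H B f) :=
  ext_fn fun z => ext_fn fun y => ext_fn fun x => by simp [mul_assoc]

end Cv

end Bialg

namespace CocycleLinkedPair

open Cv

set_option linter.unusedSectionVars false

variable {A H : Type*} [Ring A] [Ring H] [Bialgebra ℂ A] [Bialgebra ℂ H]
  (L : CocycleLinkedPair A H)

/-! ### The linked pair in terms of convolution algebras -/

/-- `a ↦ (x ↦ x ▸ a)`. -/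
def N : A →ₐ[ℂ] Cv H A :=
  AlgHom.ofLinearMap ((WithConv.linearEquiv ℂ (H →ₗ[ℂ] A)).symm.toLinearMap ∘ₗ L.act.flip)
    (ext_fn fun x => (L.act_one x).trans (one_apply x).symm)
    (fun a b => ext_fn fun x => by
      rw [mul_apply]
      exact L.act_mul x a b)

@[simp] theorem N_apply (a : A) (x : H) : L.N a x = L.act x a := rfl

/-- `χ` as an element of `Hom(H, Hom(H, A))`, with the second variable outside. -/
def X : Cv H (Cv H A) := Cv.curry (toConv L.χ)

@[simp] theorem X_apply (x y : H) : L.X y x = L.χ (x ⊗ₜ y) := rfl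

/-- The second variable is the outer one in `X`, so the two Sweedler sums of the axiom have to be
exchanged. -/
theorem act_act_conv (a : A) : push H L.N (L.N a) * L.X = L.X * mm H A (L.N a) :=
  ext_fn fun y => ext_fn fun x => by
    have h := L.act_act x y a
    simp only [sw2, sw_eq_sum_rep] at h
    simp only [mul_apply, Cv.sum_apply, push_apply, N_apply, X_apply, mm_apply]
    rw [Finset.sum_comm, h, Finset.sum_comm]

/-- The variables are nested as `z`, `y`, `x` from the outside in. The variable `z` is not split on
the right of the axiom, and `x` is not split against the constant factor in `z`. -/
theorem cocycle_conv : push H (push H L.N) L.X * mm H (Cv H A) L.X =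
    const H _ L.X * push H (mm H A) L.X :=
  ext_fn fun z => ext_fn fun y => ext_fn fun x => by
    rw [const_mul_apply]
    have h := L.cocycle x y z
    simp only [sw2, sw_eq_sum_rep] at h
    simp only [mul_apply, Cv.sum_apply, push_apply, N_apply, X_apply, mm_apply]
    rw [Finset.sum_comm (s := rep (comul (R := ℂ) z)) (t := rep (comul (R := ℂ) y))]
    simp only [Finset.sum_comm (s := rep (comul (R := ℂ) z)) (t := rep (comul (R := ℂ) x))]
    rw [Finset.sum_comm, h, Finset.sum_comm]

/-! ### The algebra -/

section Operators

/-- The inclusion of `A` in the tensor product algebra `A ⊗ H`. -/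
abbrev inl : A →ₐ[ℂ] A ⊗[ℂ] H := Algebra.TensorProduct.includeLeft

/-- The inclusion of `H` in `A ⊗ H`. -/
abbrev inr : Cv H (A ⊗[ℂ] H) := toConv (TensorProduct.mk ℂ A H 1)

/-- The function `(z, x) ↦ ∑ χ(x₁, z₁) ⊗ x₂ z₂`. -/
def G : Cv H (Cv H (A ⊗[ℂ] H)) := push H (push H inl) L.X * mm H _ inr

/-- The map `t ↦ (x ↦ (1 # x) t)`. -/
def J : A ⊗[ℂ] H →ₗ[ℂ] Cv H (A ⊗[ℂ] H) :=
  TensorProduct.lift ((LinearMap.mul ℂ (Cv H (A ⊗[ℂ] H))).compl₁₂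
    ((push H inl).comp L.N).toLinearMap L.G.ofConv)

theorem J_tmul (b : A) (z : H) : L.J (b ⊗ₜ z) = push H inl (L.N b) * L.G z := rfl

theorem N_one : L.N 1 = 1 := map_one _

theorem J_inl_mul (b : A) (t : A ⊗[ℂ] H) :
    L.J (inl b * t) = push H inl (L.N b) * L.J t := by
  induction t with
  | zero => simp
  | add s t hs ht => rw [mul_add, map_add, map_add, hs, ht, mul_add]
  | tmul c z =>
    rw [J_tmul, ← mul_assoc, ← map_mul, ← map_mul, ← J_tmul]
    simp [inl]

theorem J_inr (z : H) : L.J (inr (A := A) z) = L.G z := by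
  change L.J (1 ⊗ₜ z) = _
  rw [J_tmul, N_one, map_one, one_mul]

/-- Composition of a function with `J`. -/
def compJ (D : Type*) [AddCommGroup D] [Module ℂ D] :
    Cv D (A ⊗[ℂ] H) →ₗ[ℂ] Cv D (Cv H (A ⊗[ℂ] H)) where
  toFun f := toConv (L.J ∘ₗ f.ofConv)
  map_add' _ _ := ext_fn fun _ => map_add L.J _ _
  map_smul' _ _ := ext_fn fun _ => map_smul L.J _ _

theorem compJ_apply {D : Type*} [AddCommGroup D] [Module ℂ D] (f : Cv D (A ⊗[ℂ] H)) (x : D) :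
    L.compJ D f x = L.J (f x) := rfl

theorem compJ_push_inl_mul {D : Type*} [AddCommGroup D] [Module ℂ D] [Coalgebra ℂ D]
    (f : Cv D A) (g : Cv D (A ⊗[ℂ] H)) :
    L.compJ D (push D inl f * g) = push D ((push H inl).comp L.N) f * L.compJ D g :=
  ext_fn fun x => by
    rw [compJ_apply, mul_apply, mul_apply, map_sum]
    refine Finset.sum_congr rfl fun i _ => ?_
    rw [push_apply, J_inl_mul]
    rfl

/-- Left multiplication by `1 # x` passes an element of `A` at the cost of the action; this is the
version with two further variables. -/
theorem compJ_compJ_push_inl_mul (f : Cv H (Cv H A)) (g : Cv H (Cv H (A ⊗[ℂ] H))) :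
    (toConv (L.compJ H ∘ₗ (push H (push H inl) f * g).ofConv) : Cv H (Cv H (Cv H (A ⊗[ℂ] H)))) =
      push H (push H ((push H inl).comp L.N)) f * toConv (L.compJ H ∘ₗ g.ofConv) :=
  ext_fn fun x => by
    rw [toConv_apply, LinearMap.comp_apply, mul_apply, mul_apply, map_sum]
    refine Finset.sum_congr rfl fun i _ => ?_
    rw [push_apply, compJ_push_inl_mul]
    rfl

/-- `z ↦ x ↦ (1 # x) (b # z)`. -/
def Jb (b : A) : Cv H (Cv H (A ⊗[ℂ] H)) := toConv (L.J ∘ₗ TensorProduct.mk ℂ A H b)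

theorem Jb_eq (b : A) :
    L.Jb b = push H (push H inl) (const H _ (L.N b) * L.X) * mm H _ inr := by
  rw [map_mul, mul_assoc, push_const]
  exact ext_fn fun z => (const_mul_apply _ _ _).symm

/-- Associativity on generators: `(1 # x)((1 # y)(b # z)) = ∑ χ(x₁, y₁) · (1 # x₂y₂)(b # z)`. All of
associativity is reduced to this case. -/
theorem compJ_Jb (b : A) :
    (toConv (L.compJ H ∘ₗ (L.Jb b).ofConv) : Cv H (Cv H (Cv H (A ⊗[ℂ] H)))) =
      const H (Cv H (Cv H (A ⊗[ℂ] H))) (push H (push H inl) L.X) *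
        push H (mm H _) (L.Jb b) := by
  have hG : (toConv (L.compJ H ∘ₗ (mm H _ inr).ofConv) : Cv H (Cv H (Cv H (A ⊗[ℂ] H)))) =
      mm H _ L.G := ext_fn fun z => ext_fn fun y => L.J_inr _
  -- The part with values in `A`; it is the cocycle identity multiplied by the twisted module
  -- identity.
  have key : push H (push H L.N) (const H _ (L.N b) * L.X) * mm H _ L.X =
      const H _ L.X * push H (mm H _) (const H _ (L.N b) * L.X) := by
    rw [map_mul, mul_assoc, cocycle_conv, push_const, ← mul_assoc, ← map_mul, act_act_conv,
      map_mul, map_mul, push_const, mul_assoc]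
  have key' := congrArg (push H (push H (push H (inl (A := A) (H := H))))) key
  rw [map_mul, map_mul (push H (push H (push H inl))), push_const] at key'
  rw [Jb_eq, compJ_compJ_push_inl_mul, hG, G, map_mul (mm H _), ← mul_assoc,
    map_mul (push H (mm H _)), ← mul_assoc, mm_mm]
  exact congrArg (· * push H (mm H _) (mm H _ inr)) key'

/-- The product of the smash product `A #_χ H`, as a function of its left factor. -/
def mulₗ : A ⊗[ℂ] H →ₗ[ℂ] A ⊗[ℂ] H →ₗ[ℂ] A ⊗[ℂ] H :=
  TensorProduct.lift (LinearMap.mk₂ ℂ (fun a x =>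
      LinearMap.mulLeft ℂ (inl a) ∘ₗ LinearMap.applyₗ x ∘ₗ
        (WithConv.linearEquiv ℂ (H →ₗ[ℂ] A ⊗[ℂ] H)).toLinearMap ∘ₗ L.J)
    (fun a a' x => by ext; simp [add_mul, add_tmul]) (fun c a x => by ext; simp)
    (fun a x x' => by ext; simp [mul_add]) (fun c a x => by ext; simp))

theorem mulₗ_tmul (a : A) (x : H) (t : A ⊗[ℂ] H) :
    L.mulₗ (a ⊗ₜ x) t = inl a * L.J t x := rfl

theorem mulₗ_inl_mul (a : A) (s t : A ⊗[ℂ] H) :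
    L.mulₗ (inl a * s) t = inl a * L.mulₗ s t := by
  induction s with
  | zero => simp
  | add s s' hs hs' => simp only [mul_add, map_add, LinearMap.add_apply, hs, hs']
  | tmul b y =>
    rw [mulₗ_tmul, ← mul_assoc, ← map_mul, ← mulₗ_tmul]
    simp [inl]

theorem J_J (t : A ⊗[ℂ] H) (y : H) :
    L.J (L.J t y) =
    (push H (push H inl) L.X * mm H _ (L.J t) : Cv H (Cv H (A ⊗[ℂ] H))) y := by
  induction t with
  | zero => simp
  | add s t hs ht =>
    rw [map_add, Cv.add_apply, map_add, hs, ht, map_add, mul_add, Cv.add_apply]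
  | tmul b z =>
    have h := congrArg (fun f : Cv H (Cv H (Cv H (A ⊗[ℂ] H))) => f z y) (L.compJ_Jb b)
    dsimp only at h
    rw [const_mul_apply] at h
    exact h

/-- Associativity with first factor `1 # x`. Both sides are computed from `J_J`; the general case
follows since multiplication is left `A`-linear. -/
theorem mulₗ_J (t r : A ⊗[ℂ] H) (x : H) : L.mulₗ (L.J t x) r = L.J (L.mulₗ t r) x := by
  induction t with
  | zero => simp
  | add s t hs ht => simp only [map_add, LinearMap.add_apply, Cv.add_apply, hs, ht]
  | tmul b y =>
    have aux (f : Cv H A) (g : Cv H (A ⊗[ℂ] H)) :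
        (toConv ((L.mulₗ.flip r) ∘ₗ (push H inl f * g).ofConv) : Cv H (A ⊗[ℂ] H)) =
          push H inl f * toConv ((L.mulₗ.flip r) ∘ₗ g.ofConv) := ext_fn fun x => by
      rw [toConv_apply, LinearMap.comp_apply, mul_apply, mul_apply, map_sum]
      exact Finset.sum_congr rfl fun i _ => L.mulₗ_inl_mul _ _ _
    have hG : (toConv ((L.mulₗ.flip r) ∘ₗ (L.G y).ofConv) : Cv H (A ⊗[ℂ] H)) =
        (push H (push H inl) L.X * mm H _ (L.J r) : Cv H (Cv H (A ⊗[ℂ] H))) y := ext_fn fun x => by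
      rw [toConv_apply, LinearMap.comp_apply, G, mul_apply, mul_apply, Cv.sum_apply,
        Cv.sum_apply, map_sum]
      refine Finset.sum_congr rfl fun i _ => ?_
      refine (congrArg (fun f : Cv H (A ⊗[ℂ] H) => f x) (aux (L.X i.1) (mm H _ inr i.2))).trans ?_
      refine congrArg (fun f : Cv H (A ⊗[ℂ] H) => (push H inl (L.X i.1) * f : Cv H (A ⊗[ℂ] H)) x) ?_
      refine ext_fn fun x => ?_
      change L.mulₗ (1 ⊗ₜ (x * i.2)) r = _
      rw [mulₗ_tmul, map_one, one_mul]
      rfl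
    rw [mulₗ_tmul, J_inl_mul, J_J, ← hG, ← aux]
    rfl

theorem mulₗ_assoc (s t r : A ⊗[ℂ] H) : L.mulₗ (L.mulₗ s t) r = L.mulₗ s (L.mulₗ t r) := by
  induction s with
  | zero => simp
  | add s s' hs hs' => simp only [map_add, LinearMap.add_apply, hs, hs']
  | tmul a x => rw [mulₗ_tmul, mulₗ_inl_mul, mulₗ_J, mulₗ_tmul]

theorem X_one : L.X 1 = 1 := ext_fn fun x => by
  rw [X_apply, χ_one_right, one_apply]

theorem X_apply_one (y : H) : L.X y 1 = counit (R := ℂ) y • (1 : A) := by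
  rw [X_apply, χ_one_left]

theorem mul_apply_one {B : Type*} [Ring B] [Algebra ℂ B] (f g : Cv H B) : (f * g) 1 = f 1 * g 1 := by
  rw [LinearMap.convMul_apply, Bialgebra.comul_one]
  simp [Algebra.TensorProduct.one_def]

theorem J_apply_one (t : A ⊗[ℂ] H) : L.J t 1 = t := by
  induction t with
  | zero => simp
  | add s t hs ht => rw [map_add, Cv.add_apply, hs, ht]
  | tmul b z =>
    rw [J_tmul, mul_apply_one, push_apply, N_apply, one_act, G, mul_apply, Cv.sum_apply]
    simp only [mul_apply_one, push_apply, X_apply_one, mm_apply, one_mul, map_smul, map_one,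
      smul_mul_assoc]
    conv_rhs => rw [← sum_rep_counit_smul z]
    simp [tmul_sum, inl, Finset.mul_sum]

theorem J_one : L.J (1 ⊗ₜ 1) = inr := by
  rw [J_tmul, N_one, map_one, one_mul, G, mul_apply_one, push_apply, X_one, map_one, one_mul]
  exact ext_fn fun x => by rw [mm_apply, mul_one]

theorem one_mulₗ (s : A ⊗[ℂ] H) : L.mulₗ (1 ⊗ₜ 1) s = s := by
  rw [mulₗ_tmul, map_one, one_mul, J_apply_one]

theorem mulₗ_one (s : A ⊗[ℂ] H) : L.mulₗ s (1 ⊗ₜ 1) = s := by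
  induction s with
  | zero => simp
  | add s s' hs hs' => rw [map_add, LinearMap.add_apply, hs, hs']
  | tmul a x => rw [mulₗ_tmul, J_one]; simp [inl]

end Operators

/-- The underlying space of the cocycle bismash product `A^ψ #_χ H`. -/
@[nolint unusedArguments]
def Bismash (_ : CocycleLinkedPair A H) : Type _ := A ⊗[ℂ] H

namespace Bismash

instance : AddCommGroup L.Bismash := inferInstanceAs (AddCommGroup (A ⊗[ℂ] H))

instance : Module ℂ L.Bismash := inferInstanceAs (Module ℂ (A ⊗[ℂ] H))

/-- The identification of `A ⊗ H` and `A^ψ #_χ H`. -/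
def equiv : A ⊗[ℂ] H ≃ₗ[ℂ] L.Bismash := LinearEquiv.refl ℂ _

instance : Ring L.Bismash :=
  { (inferInstance : AddCommGroup L.Bismash) with
    mul := fun s t => L.mulₗ s t
    one := equiv L (1 ⊗ₜ 1)
    left_distrib := fun s t r => map_add (L.mulₗ s) t r
    right_distrib := fun s t r => LinearMap.map_add₂ L.mulₗ s t r
    zero_mul := fun s => LinearMap.map_zero₂ L.mulₗ s
    mul_zero := fun s => map_zero (L.mulₗ s)
    mul_assoc := L.mulₗ_assoc
    one_mul := L.one_mulₗ
    mul_one := L.mulₗ_one }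

theorem mul_def (s t : A ⊗[ℂ] H) : equiv L s * equiv L t = equiv L (L.mulₗ s t) := rfl

instance : Algebra ℂ L.Bismash :=
  Algebra.ofModule
    (fun c s t => LinearMap.map_smul₂ L.mulₗ c s t) (fun c s t => map_smul (L.mulₗ s) c t)

/-- The inclusion `a ↦ a # 1`. -/
def i : A →ₐ[ℂ] L.Bismash :=
  AlgHom.ofLinearMap ((equiv L).toLinearMap ∘ₗ (TensorProduct.mk ℂ A H).flip 1) rfl
    (fun a b => by
      change equiv L ((a * b) ⊗ₜ 1) = equiv L (L.mulₗ (a ⊗ₜ 1) (b ⊗ₜ 1))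
      rw [mulₗ_tmul, J_apply_one]
      simp [inl])

/-- The map `x ↦ 1 # x`. -/
def j : Cv H L.Bismash := toConv ((equiv L).toLinearMap ∘ₗ TensorProduct.mk ℂ A H 1)

theorem i_apply (a : A) : i L a = equiv L (a ⊗ₜ 1) := rfl

theorem j_apply (x : H) : j L x = equiv L (1 ⊗ₜ x) := rfl

theorem j_one : j L 1 = 1 := rfl

theorem i_mul (a : A) (t : A ⊗[ℂ] H) : i L a * equiv L t = equiv L (inl a * t) := by
  change equiv L (L.mulₗ (a ⊗ₜ 1) t) = _
  rw [mulₗ_tmul, J_apply_one]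

theorem i_mul_j (a : A) (x : H) : i L a * j L x = equiv L (a ⊗ₜ x) := by
  rw [j_apply, i_mul]
  simp [inl]

theorem j_mul (x : H) (t : A ⊗[ℂ] H) : j L x * equiv L t = equiv L (L.J t x) := by
  change equiv L (L.mulₗ (1 ⊗ₜ x) t) = _
  rw [mulₗ_tmul, map_one, one_mul]

theorem equiv_push_inl_mul_apply (f : Cv H A) (g : Cv H (A ⊗[ℂ] H)) (x : H) :
    equiv L ((push H inl f * g : Cv H (A ⊗[ℂ] H)) x) =
      (push H (i L) f * toConv ((equiv L).toLinearMap ∘ₗ g.ofConv) : Cv H L.Bismash) x := by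
  rw [mul_apply, mul_apply, map_sum]
  exact Finset.sum_congr rfl fun k _ => (i_mul L _ _).symm

/-- With `j_mul_j`, one of the two relations that present the algebra: `j(x) i(a) = ∑ i(x₁ ▸ a)
j(x₂)`. -/
theorem j_mul_i (a : A) : j L * const H _ (i L a) = push H (i L) (L.N a) * j L :=
  ext_fn fun x => by
    rw [mul_const_apply, i_apply, j_mul, J_tmul, G, mul_apply_one, push_apply, X_one, map_one,
      one_mul, equiv_push_inl_mul_apply]
    refine congrArg (fun f : Cv H L.Bismash => (push H (i L) (L.N a) * f : Cv H L.Bismash) x) ?_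
    exact ext_fn fun x => by rw [toConv_apply, LinearMap.comp_apply, mm_apply, mul_one]; rfl

/-- In elements, `j(x) j(y) = ∑ i(χ(x₁, y₁)) j(x₂ y₂)`. -/
theorem j_mul_j : fx H _ (j L) * fy H _ (j L) = push H (push H (i L)) L.X * mm H _ (j L) :=
  ext_fn fun y => ext_fn fun x => by
    rw [const_mul_apply, push_apply, mul_const_apply, j_apply L y, j_mul, J_tmul, N_one, map_one,
      one_mul, G, mul_apply, mul_apply, Cv.sum_apply, Cv.sum_apply, map_sum]
    exact Finset.sum_congr rfl fun k _ => equiv_push_inl_mul_apply L _ _ _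

@[elab_as_elim]
theorem induction_on {p : L.Bismash → Prop} (k : L.Bismash) (zero : p 0)
    (mul : ∀ a x, p (i L a * j L x)) (add : ∀ k l, p k → p l → p (k + l)) : p k :=
  TensorProduct.induction_on (motive := p) k zero
    (fun a x => by have := mul a x; rwa [i_mul_j] at this) add

end Bismash

end CocycleLinkedPair

theorem tmul_mul_eq_sum_rep {A B : Type*} [Ring A] [Algebra ℂ A] [Ring B] [Algebra ℂ B]
    (t s : A ⊗[ℂ] B) :
    t * s = ∑ k ∈ rep t, ∑ l ∈ rep s, (k.1 * l.1) ⊗ₜ[ℂ] (k.2 * l.2) := by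
  conv_lhs => rw [eq_sum_rep t, eq_sum_rep s]
  simp [Finset.sum_mul_sum]

namespace CocycleLinkedPair

open Cv

set_option linter.unusedSectionVars false

variable {A H : Type*} [Ring A] [Ring H] [Bialgebra ℂ A] [Bialgebra ℂ H]
  (L : CocycleLinkedPair A H)

/-! ### The coaction and the cococycle in convolution algebras -/

section Comodule

variable (B : Type*) {B' : Type*} [Ring B] [Algebra ℂ B] [Ring B'] [Algebra ℂ B']

/-- The linear map underlying `R`. -/
def Rₗ : Cv H B →ₗ[ℂ] Cv H (B ⊗[ℂ] A) where
  toFun f := toConv (f.ofConv.rTensor A ∘ₗ L.ρ)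
  map_add' f g := ext_fn fun x => by
    change (f.ofConv + g.ofConv).rTensor A (L.ρ x) = _
    rw [LinearMap.rTensor_add]; rfl
  map_smul' c f := ext_fn fun x => by
    change (c • f.ofConv).rTensor A (L.ρ x) = _
    rw [LinearMap.rTensor_smul]; rfl

variable {B} in
theorem Rₗ_apply (f : Cv H B) (x : H) :
    L.Rₗ B f x = ∑ k ∈ rep (L.ρ x), f k.1 ⊗ₜ[ℂ] k.2 :=
  apply_eq_sum_rep (f.ofConv.rTensor A) (L.ρ x)

/-- `f ↦ (x ↦ f(x_H) ⊗ x_A)`. -/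
def R : Cv H B →ₐ[ℂ] Cv H (B ⊗[ℂ] A) :=
  AlgHom.ofLinearMap (L.Rₗ B)
    (ext_fn fun x => by
      have h := congrArg (TensorProduct.mk ℂ B A 1) (L.counit_ρ x)
      rw [sw_eq_sum_rep, map_sum] at h
      rw [Rₗ_apply, one_apply, Algebra.TensorProduct.one_def]
      simp only [one_apply, smul_tmul]
      simpa using h)
    (fun f g => ext_fn fun x => by
      have h := congrArg ((LinearMap.mul' ℂ B).rTensor A ∘ₗ
        (TensorProduct.assoc ℂ B B A).symm.toLinearMap ∘ₗ
          map f.ofConv (map g.ofConv LinearMap.id)) (L.comul_ρ x)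
      simp only [sw2, sw_eq_sum_rep, map_sum, LinearMap.comp_apply, map_tmul,
        LinearEquiv.coe_coe, assoc_symm_tmul, LinearMap.rTensor_tmul, LinearMap.mul'_apply,
        LinearMap.id_apply] at h
      simp only [Rₗ_apply, mul_apply, sum_tmul, h, Finset.sum_mul_sum,
        Algebra.TensorProduct.tmul_mul_tmul])

variable {B} in
theorem R_apply (f : Cv H B) (x : H) :
    L.R B f x = ∑ k ∈ rep (L.ρ x), f k.1 ⊗ₜ[ℂ] k.2 := L.Rₗ_apply f x

theorem R_const (b : B) : L.R B (const H B b) = const H _ (b ⊗ₜ 1) := ext_fn fun x => by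
  have h := congrArg (TensorProduct.mk ℂ B A b) (L.counit_ρ x)
  rw [sw_eq_sum_rep, map_sum] at h
  rw [R_apply, const_apply]
  simp only [const_apply, smul_tmul]
  simpa using h

theorem R_push (q : B →ₐ[ℂ] B') (f : Cv H B) :
    L.R B' (push H q f) = push H (Algebra.TensorProduct.map q (AlgHom.id ℂ A)) (L.R B f) :=
  ext_fn fun x => by
    rw [push_apply, R_apply, R_apply, map_sum]
    rfl

/-- `a ↦ (x ↦ 1 ⊗ (x ▸ a))`. -/
abbrev N₂ : A →ₐ[ℂ] Cv H (B ⊗[ℂ] A) := (push H Algebra.TensorProduct.includeRight).comp L.N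

variable {B} in
-- This is the axiom `ρ_act`. It makes `V`, and with it `U` and `Q`, algebra homomorphisms.
theorem commute_R_N₂ (f : Cv H B) (a : A) : Commute (L.R B f) (L.N₂ B a) := ext_fn fun x => by
  have h := congrArg (map f.ofConv LinearMap.id) (L.ρ_act x a)
  simp only [sw2, sw_eq_sum_rep, map_sum, map_tmul, LinearMap.id_apply] at h
  rw [mul_apply, mul_apply]
  simp only [R_apply, Finset.sum_mul, Finset.mul_sum, AlgHom.comp_apply, push_apply, N_apply,
    Algebra.TensorProduct.includeRight_apply, Algebra.TensorProduct.tmul_mul_tmul, one_mul,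
    mul_one]
  exact h.symm

/-- `f ⊗ a ↦ (x ↦ f(x₁_H) ⊗ x₁_A (x₂ ▸ a))`. -/
def V : Cv H B ⊗[ℂ] A →ₐ[ℂ] Cv H (B ⊗[ℂ] A) :=
  Algebra.TensorProduct.lift (L.R B) (L.N₂ B) (L.commute_R_N₂)

variable {B} in
@[simp] theorem V_tmul (f : Cv H B) (a : A) : L.V B (f ⊗ₜ a) = L.R B f * L.N₂ B a :=
  Algebra.TensorProduct.lift_tmul _ _ _ _ _

theorem V_push (q : B →ₐ[ℂ] B') (t : Cv H B ⊗[ℂ] A) :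
    L.V B' (Algebra.TensorProduct.map (push H q) (AlgHom.id ℂ A) t) =
      push H (Algebra.TensorProduct.map q (AlgHom.id ℂ A)) (L.V B t) := by
  induction t with
  | zero => simp
  | add s t hs ht => simp only [map_add, hs, ht]
  | tmul f a =>
    rw [Algebra.TensorProduct.map_tmul, V_tmul, V_tmul, R_push, map_mul]
    refine congrArg (_ * ·) (ext_fn fun x => ?_)
    simp [N₂]

/-- `f ↦ ((x, y) ↦ f(x₁_H, y_H) ⊗ x₁_A (x₂ ▸ y_A))`. -/
def U : Cv H (Cv H B) →ₐ[ℂ] Cv H (Cv H (B ⊗[ℂ] A)) := (push H (L.V B)).comp (L.R (Cv H B))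

theorem U_push (q : B →ₐ[ℂ] B') (f : Cv H (Cv H B)) :
    L.U B' (push H (push H q) f) =
      push H (push H (Algebra.TensorProduct.map q (AlgHom.id ℂ A))) (L.U B f) := by
  rw [U, AlgHom.comp_apply, R_push]
  exact ext_fn fun y => L.V_push B q _

/-- `a ⊗ b ↦ (x ↦ (x₁_H ▸ a) ⊗ x₁_A (x₂ ▸ b))`. -/
def Q : A ⊗[ℂ] A →ₐ[ℂ] Cv H (A ⊗[ℂ] A) :=
  (L.V A).comp (Algebra.TensorProduct.map L.N (AlgHom.id ℂ A))

theorem Q_tmul (a b : A) : L.Q (a ⊗ₜ b) = L.R A (L.N a) * L.N₂ A b := by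
  rw [Q, AlgHom.comp_apply, Algebra.TensorProduct.map_tmul, V_tmul]; rfl

/-- `ψ` as an element of the convolution algebra. -/
def Ψ : Cv H (A ⊗[ℂ] A) := toConv L.ψ

theorem Ψ_apply (x : H) : L.Ψ x = L.ψ x := rfl

/-- The axiom `comul_act`: `ψ` intertwines the twisted diagonal action `Q ∘ Δ` with `Δ` of the
action. -/
theorem comul_act_conv (a : A) : L.Ψ * L.Q (comul (R := ℂ) a) =
    push H (Bialgebra.comulAlgHom ℂ A) (L.N a) * L.Ψ := ext_fn fun x => by
  have h := L.comul_act x a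
  simp only [sw2, sw3, sw_eq_sum_rep] at h
  rw [mul_apply, mul_apply]
  simp only [push_apply, N_apply, Ψ_apply, tmul_mul_eq_sum_rep (comul _),
    Bialgebra.comulAlgHom_apply]
  rw [h, apply_eq_sum_rep' L.Q]
  simp only [Cv.sum_apply, Q_tmul, mul_apply, R_apply, AlgHom.comp_apply, push_apply, N_apply,
    Algebra.TensorProduct.includeRight_apply, Finset.sum_mul, Finset.mul_sum,
    Algebra.TensorProduct.tmul_mul_tmul, mul_one]
  refine Finset.sum_congr rfl fun k _ => ?_
  rw [Finset.sum_comm]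
  refine Finset.sum_congr rfl fun l _ => Finset.sum_congr rfl fun m _ => ?_
  rw [Finset.sum_comm]
  refine Finset.sum_congr rfl fun n _ => ?_
  conv_lhs => rw [eq_sum_rep (L.ψ _), Finset.sum_mul]
  simp [mul_assoc]


end Comodule
end CocycleLinkedPair

namespace CocycleLinkedPair

open Cv

set_option linter.unusedSectionVars false

variable {A H : Type*} [Ring A] [Ring H] [Bialgebra ℂ A] [Bialgebra ℂ H]
  (L : CocycleLinkedPair A H)

theorem mul_eq_sum_rep {A B : Type*} [Ring A] [Algebra ℂ A] [Ring B] [Algebra ℂ B]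
    (t s : A ⊗[ℂ] B) : t * s = ∑ k ∈ rep t, (k.1 ⊗ₜ[ℂ] k.2) * s := by
  conv_lhs => rw [eq_sum_rep t, Finset.sum_mul]

theorem Q_Ψ_apply (y : H) :
    L.Q (L.Ψ y) = ∑ k ∈ rep (L.ψ y), L.R A (L.N k.1) * L.N₂ A k.2 := by
  rw [Ψ_apply, apply_eq_sum_rep' L.Q]
  simp only [Q_tmul]

theorem U_apply {B : Type*} [Ring B] [Algebra ℂ B] (f : Cv H (Cv H B)) (y : H) :
    L.U B f y = ∑ k ∈ rep (L.ρ y), L.R B (f k.1) * L.N₂ B k.2 := by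
  simp only [U, AlgHom.comp_apply, push_apply, R_apply, map_sum, V_tmul]

/-- The axiom `ρ_mul` with an arbitrary function `g` applied to the leg in `H`. Keeping `g` free
allows it to be used for `g = j`, with values in the bismash product. -/
theorem ρ_mul_conv {B : Type*} [Ring B] [Algebra ℂ B] (g : Cv H B) :
    push H (push H Algebra.TensorProduct.includeRight) L.X * mm H _ (L.R B g) =
      L.U B (mm H B g) * push H (push H Algebra.TensorProduct.includeRight) L.X :=
  ext_fn fun y => ext_fn fun x => by
    have h := congrArg (map g.ofConv LinearMap.id) (L.ρ_mul x y)
    simp only [sw2, sw3, sw_eq_sum_rep, map_sum, map_tmul, LinearMap.id_apply] at h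
    refine (Eq.trans ?_ h).trans ?_
    · rw [Finset.sum_comm]
      simp only [mul_apply, Cv.sum_apply, push_apply, X_apply, mm_apply, R_apply,
        Finset.mul_sum, Algebra.TensorProduct.includeRight_apply,
        Algebra.TensorProduct.tmul_mul_tmul, one_mul]
    rw [mul_apply]
    simp only [U_apply, Finset.sum_mul, Cv.sum_apply, mul_assoc]
    simp only [mul_apply, push_apply, R_apply, Finset.mul_sum, Finset.sum_mul, AlgHom.comp_apply,
      N_apply, X_apply, mm_apply, Algebra.TensorProduct.includeRight_apply,
      Algebra.TensorProduct.tmul_mul_tmul, mul_one]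
    simp only [Finset.sum_comm (t := rep (comul (R := ℂ) x))]
    refine Finset.sum_congr rfl fun k _ => ?_
    simp only [Finset.sum_comm (t := rep (comul (R := ℂ) k.2))]
    refine Finset.sum_congr rfl fun l _ => ?_
    refine Finset.sum_congr rfl fun m _ => ?_
    rw [Finset.sum_comm]

variable (A) in
/-- The coproduct of `A` as an algebra homomorphism. -/
abbrev ΔA : A →ₐ[ℂ] A ⊗[ℂ] A := Bialgebra.comulAlgHom ℂ A

/-- `(B ⊗ A) ⊗ A ≃ B ⊗ (A ⊗ A)`. -/
abbrev assocHom (B B' B'' : Type*) [Ring B] [Algebra ℂ B] [Ring B'] [Algebra ℂ B']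
    [Ring B''] [Algebra ℂ B''] : (B ⊗[ℂ] B') ⊗[ℂ] B'' →ₐ[ℂ] B ⊗[ℂ] (B' ⊗[ℂ] B'') :=
  (Algebra.TensorProduct.assoc ℂ ℂ ℂ B B' B'').toAlgHom

theorem assocHom_tmul {B B' B'' : Type*} [Ring B] [Algebra ℂ B] [Ring B'] [Algebra ℂ B']
    [Ring B''] [Algebra ℂ B''] (a : B) (b : B') (c : B'') :
    assocHom B B' B'' ((a ⊗ₜ b) ⊗ₜ c) = a ⊗ₜ (b ⊗ₜ c) := rfl

theorem assocHom_tmul' {B B' B'' : Type*} [Ring B] [Algebra ℂ B] [Ring B'] [Algebra ℂ B']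
    [Ring B''] [Algebra ℂ B''] (t : B ⊗[ℂ] B') (c : B'') :
    assocHom B B' B'' (t ⊗ₜ c) = ∑ k ∈ rep t, k.1 ⊗ₜ (k.2 ⊗ₜ c) := by
  conv_lhs => rw [eq_sum_rep t, sum_tmul, map_sum]
  rfl

/-- The coaction is coassociative up to conjugation by `ψ`. -/
theorem ρ_ρ_conv {B : Type*} [Ring B] [Algebra ℂ B] (g : Cv H B) :
    push H Algebra.TensorProduct.includeRight L.Ψ * push H (assocHom B A A) (L.R _ (L.R B g)) =
      push H (Algebra.TensorProduct.map (AlgHom.id ℂ B) (ΔA A)) (L.R B g) *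
        push H Algebra.TensorProduct.includeRight L.Ψ :=
  ext_fn fun x => by
    have h := congrArg (map g.ofConv LinearMap.id) (L.ρ_ρ x)
    simp only [sw2, sw_eq_sum_rep, map_sum, map_tmul, LinearMap.id_apply] at h
    rw [mul_apply, mul_apply]
    refine (Eq.trans ?_ h).trans ?_
    · refine Finset.sum_congr rfl fun k _ => ?_
      rw [push_apply, Ψ_apply, apply_eq_sum_rep' Algebra.TensorProduct.includeRight, Finset.sum_mul]
      refine Finset.sum_congr rfl fun l _ => ?_
      simp only [push_apply, R_apply, sum_tmul, map_sum, Finset.mul_sum, assocHom_tmul,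
        Algebra.TensorProduct.includeRight_apply, Algebra.TensorProduct.tmul_mul_tmul, one_mul]
    · refine Finset.sum_congr rfl fun k _ => ?_
      rw [push_apply, R_apply, map_sum, Finset.sum_mul]
      refine Finset.sum_congr rfl fun l _ => ?_
      rw [push_apply, Ψ_apply, Algebra.TensorProduct.map_tmul,
        Algebra.TensorProduct.includeRight_apply, Algebra.TensorProduct.tmul_mul_tmul, mul_one,
        Bialgebra.comulAlgHom_apply, tmul_mul_eq_sum_rep, tmul_sum]
      simp only [tmul_sum]
      rfl

theorem cococycle_conv :
    push H ((assocHom A A A).comp (Algebra.TensorProduct.map (ΔA A) (AlgHom.id ℂ A))) L.Ψ *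
        push H (assocHom A A A) (L.R _ L.Ψ) =
      push H (Algebra.TensorProduct.map (AlgHom.id ℂ A) (ΔA A)) L.Ψ *
        push H Algebra.TensorProduct.includeRight L.Ψ :=
  ext_fn fun x => by
    have h := L.cococycle x
    simp only [sw2, sw_eq_sum_rep] at h
    rw [mul_apply, mul_apply]
    refine (Eq.trans ?_ h).trans ?_
    · refine Finset.sum_congr rfl fun k _ => ?_
      rw [push_apply, Ψ_apply,
        apply_eq_sum_rep' ((assocHom A A A).comp (Algebra.TensorProduct.map (ΔA A) (AlgHom.id ℂ A))),
        Finset.sum_mul]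
      refine Finset.sum_congr rfl fun l _ => ?_
      rw [AlgHom.comp_apply, Algebra.TensorProduct.map_tmul, Bialgebra.comulAlgHom_apply,
        assocHom_tmul', Finset.sum_mul]
      refine Finset.sum_congr rfl fun m _ => ?_
      rw [push_apply, R_apply, map_sum, Finset.mul_sum]
      refine Finset.sum_congr rfl fun n _ => ?_
      rw [Ψ_apply, assocHom_tmul', Finset.mul_sum]
      refine Finset.sum_congr rfl fun o _ => ?_
      simp only [Algebra.TensorProduct.tmul_mul_tmul, AlgHom.id_apply]
    · refine Finset.sum_congr rfl fun k _ => ?_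
      rw [push_apply, Ψ_apply,
        apply_eq_sum_rep' (Algebra.TensorProduct.map (AlgHom.id ℂ A) (ΔA A)), Finset.sum_mul]
      refine Finset.sum_congr rfl fun l _ => ?_
      rw [push_apply, Ψ_apply, Algebra.TensorProduct.map_tmul,
        Algebra.TensorProduct.includeRight_apply, Algebra.TensorProduct.tmul_mul_tmul, mul_one,
        Bialgebra.comulAlgHom_apply, tmul_mul_eq_sum_rep, tmul_sum]
      simp only [tmul_sum]
      rfl

set_option maxHeartbeats 2000000 in
-- The right side of `comul_χ` has six legs of `x` and three of `y`; here it is a product of four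
-- factors, and the proof unfolds them one sum at a time.
theorem comul_χ_conv :
    push H (push H (Bialgebra.comulAlgHom ℂ A)) L.X * mm H _ L.Ψ =
      const H _ L.Ψ * push H L.Q L.Ψ * L.U A L.X *
        push H (push H Algebra.TensorProduct.includeRight) L.X :=
  ext_fn fun y => ext_fn fun x => by
    have h := L.comul_χ x y
    dsimp only [sw2, sw3, sw4, sw5, sw6, sw_eq_sum_rep] at h
    refine (Eq.trans ?_ h).trans ?_
    · rw [Finset.sum_comm]
      simp only [mul_apply, Cv.sum_apply, push_apply, X_apply, mm_apply, Ψ_apply,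
        tmul_mul_eq_sum_rep (comul _), Bialgebra.comulAlgHom_apply]
    rw [mul_assoc, mul_assoc, const_mul_apply, mul_apply]
    refine Finset.sum_congr rfl fun k _ => ?_
    rw [mul_apply (push H L.Q L.Ψ), Cv.sum_apply, Finset.mul_sum]
    simp only [Finset.sum_comm (t := rep (comul (R := ℂ) y))]
    refine Finset.sum_congr rfl fun m _ => ?_
    rw [push_apply, Q_Ψ_apply, Finset.sum_mul, Cv.sum_apply, Finset.mul_sum]
    simp only [Finset.sum_comm (t := rep (L.ψ m.1))]
    refine Finset.sum_congr rfl fun n _ => ?_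
    rw [mul_apply (L.U A L.X), Finset.mul_sum, Cv.sum_apply, Finset.mul_sum]
    simp only [Finset.sum_comm (t := rep (comul (R := ℂ) m.2))]
    refine Finset.sum_congr rfl fun o _ => ?_
    rw [U_apply, Finset.sum_mul, Finset.mul_sum, Cv.sum_apply, Finset.mul_sum]
    simp only [Finset.sum_comm (t := rep (L.ρ o.1))]
    refine Finset.sum_congr rfl fun p _ => ?_
    rw [mul_assoc, mul_assoc]
    simp only [Finset.sum_comm (t := rep (L.ψ k.1))]
    rw [Ψ_apply, mul_eq_sum_rep]
    refine Finset.sum_congr rfl fun q _ => ?_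
    clear h
    rw [mul_apply, Finset.mul_sum]
    refine Finset.sum_congr rfl fun r _ => ?_
    rw [R_apply, Finset.sum_mul, Finset.mul_sum]
    simp only [Finset.sum_comm (t := rep (L.ρ r.1))]
    refine Finset.sum_congr rfl fun s _ => ?_
    rw [mul_apply, Finset.mul_sum, Finset.mul_sum]
    refine Finset.sum_congr rfl fun t _ => ?_
    rw [mul_apply, Finset.mul_sum, Finset.mul_sum, Finset.mul_sum]
    refine Finset.sum_congr rfl fun v _ => ?_
    rw [R_apply, Finset.sum_mul, Finset.mul_sum, Finset.mul_sum, Finset.mul_sum, Finset.sum_comm]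
    refine Finset.sum_congr rfl fun w _ => ?_
    rw [mul_apply, Finset.mul_sum, Finset.mul_sum, Finset.mul_sum, Finset.mul_sum]
    refine Finset.sum_congr rfl fun z _ => ?_
    simp only [AlgHom.comp_apply, N_apply, X_apply, push_apply,
      Algebra.TensorProduct.includeRight_apply, Algebra.TensorProduct.tmul_mul_tmul, one_mul,
      mul_one, mul_assoc]
end CocycleLinkedPair

namespace CocycleLinkedPair

open Cv

set_option linter.unusedSectionVars false

variable {A H : Type*} [Ring A] [Ring H] [Bialgebra ℂ A] [Bialgebra ℂ H]
  (L : CocycleLinkedPair A H)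

namespace Bismash

/-- The bookkeeping behind `Δj(x) Δj(y) = ∑ Δ(χ(x₁, y₁)) Δj(x₂ y₂)`, where each `Δj` is a product of
three factors `P`, `R`, `J`, with subscripts for their values at `x`, `y` and `xy`. The exchange
rules are relations in one convolution algebra. -/
theorem mul_mul_eq_of_exchange {S : Type*} [Monoid S] {Px Py Pm Rx Ry Rm Jx Jy Jm Q Ux Um X XΔ : S}
    (e₁ : Rx * Jx * Py = Q * (Rx * Jx)) (e₂ : Rx * Jx * Ry = Ux * Um * Jx) (e₃ : Jx * Jy = X * Jm)
    (e₄ : X * Rm = Um * X) (e₅ : XΔ * Pm = Px * Q * Ux * X) :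
    Px * (Rx * Jx) * (Py * (Ry * Jy)) = XΔ * (Pm * (Rm * Jm)) :=
  calc Px * (Rx * Jx) * (Py * (Ry * Jy)) = Px * (Rx * Jx * Py) * Ry * Jy := by
        simp only [mul_assoc]
    _ = Px * Q * (Rx * Jx * Ry) * Jy := by rw [e₁]; simp only [mul_assoc]
    _ = Px * Q * Ux * Um * (Jx * Jy) := by rw [e₂]; simp only [mul_assoc]
    _ = Px * Q * Ux * (Um * X) * Jm := by rw [e₃]; simp only [mul_assoc]
    _ = Px * Q * Ux * X * Rm * Jm := by rw [← e₄]; simp only [mul_assoc]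
    _ = XΔ * (Pm * (Rm * Jm)) := by rw [← e₅]; simp only [mul_assoc]

/-! ### Homomorphisms out of the bismash product algebra -/

section Lift

variable {B : Type*} [Ring B] [Algebra ℂ B]

/-- The linear map `a # x ↦ f(a) g(x)`. -/
def liftₗ (f : A →ₐ[ℂ] B) (g : Cv H B) : L.Bismash →ₗ[ℂ] B :=
  TensorProduct.lift ((LinearMap.mul ℂ B).compl₁₂ f.toLinearMap g.ofConv)

theorem liftₗ_mul (f : A →ₐ[ℂ] B) (g : Cv H B) (a : A) (x : H) :
    liftₗ L f g (i L a * j L x) = f a * g x := by rw [i_mul_j]; rfl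

theorem liftₗ_i_mul (f : A →ₐ[ℂ] B) (g : Cv H B) (a : A) (k : L.Bismash) :
    liftₗ L f g (i L a * k) = f a * liftₗ L f g k := by
  induction k using induction_on with
  | zero => simp
  | mul b x => rw [← mul_assoc, ← map_mul, liftₗ_mul, liftₗ_mul, map_mul, mul_assoc]
  | add k l hk hl => rw [mul_add, map_add, map_add, hk, hl, mul_add]

theorem liftₗ_j (f : A →ₐ[ℂ] B) (g : Cv H B) (x : H) : liftₗ L f g (j L x) = g x := by
  have := liftₗ_mul L f g 1 x
  rwa [map_one, map_one, one_mul, one_mul] at this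

theorem liftₗ_push_i_mul (f : A →ₐ[ℂ] B) (g : Cv H B) (u : Cv H A) (v : Cv H L.Bismash) (x : H) :
    liftₗ L f g ((push H (i L) u * v : Cv H L.Bismash) x) =
      (push H f u * toConv (liftₗ L f g ∘ₗ v.ofConv) : Cv H B) x := by
  rw [mul_apply, mul_apply, map_sum]
  exact Finset.sum_congr rfl fun k _ => liftₗ_i_mul L f g _ _

/-- The algebra homomorphism `a # x ↦ f(a) g(x)`. -/
def lift (f : A →ₐ[ℂ] B) (g : Cv H B) (h₁ : g 1 = 1)
    (h₂ : ∀ a, g * const H B (f a) = push H f (L.N a) * g)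
    (h₃ : fx H B g * fy H B g = push H (push H f) L.X * mm H B g) : L.Bismash →ₐ[ℂ] B :=
  AlgHom.ofLinearMap (liftₗ L f g)
    (by
      have := liftₗ_mul L f g 1 1
      rwa [map_one, j_one, map_one, one_mul, one_mul, h₁] at this)
    (fun k l => by
      induction k using induction_on with
      | zero => simp
      | add k k' hk hk' => rw [add_mul, map_add, map_add, add_mul, hk, hk']
      | mul a x =>
        rw [mul_assoc, liftₗ_i_mul, liftₗ_mul, mul_assoc]
        -- Left multiplication by `A` is respected, so only products `j(x) i(b) j(y)` remain. The
        -- hypothesis `h₂` moves `b` to the left, then `h₃` multiplies out the two values of `g`.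
        refine congrArg (f a * ·) ?_
        induction l using induction_on with
        | zero => simp
        | add l l' hl hl' => rw [mul_add, map_add, map_add, mul_add, hl, hl']
        | mul b y =>
          have e₁ (x : H) : liftₗ L f g (j L x * j L y) = g x * g y := by
            have e := congrArg (fun u : Cv H (Cv H L.Bismash) => u y x) (j_mul_j L)
            have e' := congrArg (fun u : Cv H (Cv H B) => u y x) h₃
            rw [const_mul_apply, push_apply, mul_const_apply] at e e'
            rw [e, e', mul_apply, mul_apply, Cv.sum_apply, Cv.sum_apply, map_sum]
            refine Finset.sum_congr rfl fun k _ => ?_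
            rw [push_apply, liftₗ_push_i_mul]
            refine congrArg (fun u : Cv H B => (push H f (L.X k.1) * u : Cv H B) x) ?_
            exact ext_fn fun x => liftₗ_j L f g _
          have e₂ := congrArg (fun u : Cv H L.Bismash => u x) (j_mul_i L b)
          have e₃ := congrArg (fun u : Cv H B => u x * g y) (h₂ b)
          rw [mul_const_apply] at e₂ e₃
          rw [← mul_assoc, e₂, ← mul_const_apply, mul_assoc (push H (i L) (L.N b)),
            liftₗ_push_i_mul, liftₗ_mul, ← mul_assoc, e₃, ← mul_const_apply, mul_assoc]
          refine congrArg (fun u : Cv H B => (push H f (L.N b) * u : Cv H B) x) ?_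
          refine ext_fn fun x => ?_
          rw [toConv_apply, LinearMap.comp_apply, mul_const_apply, mul_const_apply, e₁])

variable (f : A →ₐ[ℂ] B) (g : Cv H B) (h₁ : g 1 = 1)
    (h₂ : ∀ a, g * const H B (f a) = push H f (L.N a) * g)
    (h₃ : fx H B g * fy H B g = push H (push H f) L.X * mm H B g)

theorem lift_i_mul_j (a : A) (x : H) : lift L f g h₁ h₂ h₃ (i L a * j L x) = f a * g x :=
  liftₗ_mul L f g a x

theorem lift_i (a : A) : lift L f g h₁ h₂ h₃ (i L a) = f a := by
  have := lift_i_mul_j L f g h₁ h₂ h₃ a 1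
  rwa [j_one, mul_one, h₁, mul_one] at this

theorem lift_j (x : H) : lift L f g h₁ h₂ h₃ (j L x) = g x := by
  have := lift_i_mul_j L f g h₁ h₂ h₃ 1 x
  rwa [map_one, one_mul, map_one, one_mul] at this

theorem push_lift_j : push H (lift L f g h₁ h₂ h₃) (j L) = g := ext_fn fun x => lift_j L f g h₁ h₂ h₃ x

variable {L} in
theorem algHom_ext {p q : L.Bismash →ₐ[ℂ] B} (hi : p.comp (i L) = q.comp (i L))
    (hj : push H p (j L) = push H q (j L)) : p = q :=
  AlgHom.ext fun k => by
    induction k using induction_on with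
    | zero => simp
    | add k l hk hl => rw [map_add, map_add, hk, hl]
    | mul a x =>
      rw [map_mul, map_mul]
      exact congrArg₂ (· * ·) (DFunLike.congr_fun hi a)
        (congrArg (fun u : Cv H B => u x) hj)

end Lift

/-! ### The coproduct -/

section Comul

/-- The map `A ⊗ A → K ⊗ K`. -/
abbrev ii : A ⊗[ℂ] A →ₐ[ℂ] L.Bismash ⊗[ℂ] L.Bismash := Algebra.TensorProduct.map (i L) (i L)

/-- The map `K ⊗ A → K ⊗ K`. -/
abbrev idi : L.Bismash ⊗[ℂ] A →ₐ[ℂ] L.Bismash ⊗[ℂ] L.Bismash :=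
  Algebra.TensorProduct.map (AlgHom.id ℂ _) (i L)

/-- The inclusion of the second factor. -/
abbrev r₂ (B B' : Type*) [Ring B] [Algebra ℂ B] [Ring B'] [Algebra ℂ B'] : B' →ₐ[ℂ] B ⊗[ℂ] B' :=
  Algebra.TensorProduct.includeRight

/-- `x ↦ ∑ 1 # x_H ⊗ x_A # 1`. -/
def ρ' : Cv H (L.Bismash ⊗[ℂ] L.Bismash) := push H (idi L) (L.R _ (j L))

/-- `x ↦ 1 ⊗ (1 # x)`. -/
def j₂ : Cv H (L.Bismash ⊗[ℂ] L.Bismash) := push H (r₂ _ _) (j L)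

/-- The coproduct of `1 # x`. -/
def Δj : Cv H (L.Bismash ⊗[ℂ] L.Bismash) := push H (ii L) L.Ψ * (ρ' L * j₂ L)

/-- Write `k ⊗ i(b)` as `(k ⊗ 1)(1 ⊗ i(b))`. The first factor commutes with `1 ⊗ j` and is absorbed
in the coaction; the second passes `1 ⊗ j` by `j_mul_i`. -/
theorem ρ'_mul_j₂_mul_const (k : L.Bismash) (b : A) :
    ρ' L * j₂ L * const H _ (k ⊗ₜ i L b) =
      push H (idi L) (L.R _ (j L * const H _ k) * L.N₂ _ b) * j₂ L := by
  have e₁ : (k ⊗ₜ[ℂ] i L b : L.Bismash ⊗[ℂ] L.Bismash) = (k ⊗ₜ 1) * r₂ _ _ (i L b) := by simp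
  have e₂ : j₂ L * const H _ (k ⊗ₜ 1) = const H _ (k ⊗ₜ 1) * j₂ L := ext_fn fun x => by
    rw [mul_const_apply, const_mul_apply]; simp [j₂]
  have e₃ : j₂ L * const H _ (r₂ _ _ (i L b)) = push H (idi L) (L.N₂ _ b) * j₂ L := by
    rw [← push_const, j₂, ← map_mul, j_mul_i, map_mul]
    refine congrArg (· * _) (ext_fn fun x => ?_)
    simp
  rw [e₁, map_mul, ← mul_assoc, mul_assoc (ρ' L), e₂, ← mul_assoc, mul_assoc _ (j₂ L), e₃,
    ← mul_assoc, ρ', map_mul (L.R _), R_const, map_mul, map_mul, push_const]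
  simp

/-- After `j` has passed both legs, `commute_R_N₂` brings the two actions together, and they form
`Q`. -/
theorem ρ'_mul_j₂_mul_const_ii (t : A ⊗[ℂ] A) :
    ρ' L * j₂ L * const H _ (ii L t) = push H (ii L) (L.Q t) * (ρ' L * j₂ L) := by
  induction t with
  | zero => simp
  | add s t hs ht => simp only [map_add, mul_add, add_mul, hs, ht]
  | tmul a b =>
    have e : push H (ii L) (L.Q (a ⊗ₜ b)) =
        push H (idi L) (L.R _ (push H (i L) (L.N a)) * L.N₂ _ b) := by
      rw [Q_tmul, map_mul, map_mul, R_push]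
      refine congrArg₂ (· * ·) (ext_fn fun x => ?_) (ext_fn fun x => ?_)
      · simp only [push_apply, R_apply, map_sum, Algebra.TensorProduct.map_tmul]; rfl
      · simp
    rw [Algebra.TensorProduct.map_tmul, ρ'_mul_j₂_mul_const, j_mul_i, e, map_mul (L.R _),
      mul_assoc (L.R _ _), (L.commute_R_N₂ _ _).eq, ← mul_assoc, map_mul _ _ (L.R _ (j L)), ρ',
      mul_assoc]

/-- The image under `Δ` of the relation `j_mul_i`. -/
theorem Δj_mul_const (a : A) : Δj L * const H _ ((ii L).comp (ΔA A) a) =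
    push H ((ii L).comp (ΔA A)) (L.N a) * Δj L := by
  have h := congrArg (push H (ii L)) (L.comul_act_conv a)
  rw [map_mul, map_mul] at h
  rw [Δj, mul_assoc, AlgHom.comp_apply, ρ'_mul_j₂_mul_const_ii, ← mul_assoc]
  erw [h]
  rw [mul_assoc]
  rfl

theorem Δj_one : Δj L 1 = 1 := by
  rw [Δj, mul_apply_one, mul_apply_one, push_apply, ρ', j₂, push_apply, push_apply, Ψ_apply, ψ_one,
    j_one]
  have : L.R _ (j L) 1 = 1 := by
    change (j L).ofConv.rTensor A (L.ρ 1) = _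
    rw [ρ_one]; rfl
  rw [this]
  simp [Algebra.TensorProduct.one_def]

theorem fx_mul_fy_Ψ : fx H _ (ρ' L * j₂ L) * fy H _ (push H (ii L) L.Ψ) =
    push H (push H (ii L)) (push H L.Q L.Ψ) * fx H _ (ρ' L * j₂ L) := ext_fn fun y => by
  rw [const_mul_apply, mul_const_apply]
  exact ρ'_mul_j₂_mul_const_ii L _

theorem push_ii_U_X : push H (push H (idi L)) (L.U _ (push H (push H (i L)) L.X)) =
    push H (push H (ii L)) (L.U _ L.X) := by
  have e : (idi L).comp (Algebra.TensorProduct.map (i L) (AlgHom.id ℂ A)) = ii L := by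
    ext <;> simp
  rw [U_push, ← e]
  rfl

/-- The first legs multiply to `j(x) j(y)`, which `j_mul_j` rewrites. Since `U` is multiplicative,
the factor with `χ` splits off on the left. -/
theorem fx_mul_fy_ρ' : fx H _ (ρ' L * j₂ L) * fy H _ (ρ' L) =
    push H (push H (ii L)) (L.U _ L.X) *
      push H (push H (idi L)) (L.U _ (mm H _ (j L))) * fx H _ (j₂ L) := by
  rw [← push_ii_U_X, ← map_mul, ← map_mul, ← j_mul_j]
  refine ext_fn fun y => ?_
  rw [const_mul_apply, mul_const_apply, push_apply, push_apply, U_apply, ρ', push_apply,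
    R_apply, map_sum, map_sum, map_sum, Finset.sum_mul, Finset.mul_sum]
  refine Finset.sum_congr rfl fun k _ => ?_
  rw [const_mul_apply, ← ρ', Algebra.TensorProduct.map_tmul]
  exact ρ'_mul_j₂_mul_const L _ _

/-- The function `(y, x) ↦ 1 ⊗ χ(x, y)`. -/
abbrev X₂ : Cv H (Cv H (L.Bismash ⊗[ℂ] L.Bismash)) :=
  push H (push H ((r₂ _ _).comp (i L))) L.X

theorem fx_mul_fy_j₂ : fx H _ (j₂ L) * fy H _ (j₂ L) = X₂ L * mm H _ (j₂ L) := by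
  have h := congrArg (push H (push H (r₂ L.Bismash L.Bismash))) (j_mul_j L)
  rw [map_mul, map_mul, push_const] at h
  refine Eq.trans (congrArg (fx H _ (j₂ L) * ·) (ext_fn fun y => ?_)) h
  exact (push_const (r₂ L.Bismash L.Bismash) _).symm

theorem X₂_mul_mm_ρ' : X₂ L * mm H _ (ρ' L) =
    push H (push H (idi L)) (L.U _ (mm H _ (j L))) * X₂ L := by
  have h := congrArg (push H (push H (idi L))) (L.ρ_mul_conv (j L))
  rw [map_mul, map_mul] at h
  have hX : push H (push H (idi L)) (push H (push H (r₂ L.Bismash A)) L.X) = X₂ L :=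
    ext_fn fun y => ext_fn fun x => by simp
  rw [hX] at h
  exact h

theorem comul_X₂ : push H (push H ((ii L).comp (ΔA A))) L.X * mm H _ (push H (ii L) L.Ψ) =
    fx H _ (push H (ii L) L.Ψ) * push H (push H (ii L)) (push H L.Q L.Ψ) *
      push H (push H (ii L)) (L.U _ L.X) * X₂ L := by
  have h := congrArg (push H (push H (ii L))) L.comul_χ_conv
  rw [map_mul, map_mul _ (_ * _) (push H (push H _) _), map_mul, map_mul, push_const] at h
  have hX : push H (push H (ii L)) (push H (push H (r₂ A A)) L.X) = X₂ L :=
    ext_fn fun y => ext_fn fun x => by simp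
  rw [hX] at h
  exact h

/-- The image under `Δ` of the relation `j_mul_j`, obtained by feeding the five exchange rules above
into `mul_mul_eq_of_exchange`. -/
theorem fx_mul_fy_Δj : fx H _ (Δj L) * fy H _ (Δj L) =
    push H (push H ((ii L).comp (ΔA A))) L.X * mm H _ (Δj L) := by
  have e : mm H _ (Δj L) = mm H _ (push H (ii L) L.Ψ) * (mm H _ (ρ' L) * mm H _ (j₂ L)) := by
    rw [Δj, map_mul, map_mul]
  have e' : fx H _ (Δj L) = fx H _ (push H (ii L) L.Ψ) * (fx H _ (ρ' L) * fx H _ (j₂ L)) := by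
    rw [Δj, map_mul, map_mul]
  have e'' : fy H _ (Δj L) = fy H _ (push H (ii L) L.Ψ) * (fy H _ (ρ' L) * fy H _ (j₂ L)) := by
    rw [Δj, map_mul, map_mul]
  rw [e, e', e'']
  have h₁ := fx_mul_fy_Ψ L
  have h₂ := fx_mul_fy_ρ' L
  rw [map_mul] at h₁ h₂
  exact mul_mul_eq_of_exchange h₁ h₂ (fx_mul_fy_j₂ L) (X₂_mul_mm_ρ' L) (comul_X₂ L)

/-- The coproduct of `A^ψ #_χ H`. -/
def Δ : L.Bismash →ₐ[ℂ] L.Bismash ⊗[ℂ] L.Bismash :=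
  lift L ((ii L).comp (ΔA A)) (Δj L) (Δj_one L) (Δj_mul_const L) (fx_mul_fy_Δj L)

/-- The counit of `A^ψ #_χ H`. -/
def ε : L.Bismash →ₐ[ℂ] ℂ :=
  lift L (Bialgebra.counitAlgHom ℂ A) 1 (by rw [one_apply]; simp)
    (fun a => by
      rw [one_mul, mul_one]
      exact ext_fn fun x => by simp [counit_act])
    (by
      rw [map_one, map_one, map_one]
      refine congrArg (· * 1) (ext_fn fun y => ext_fn fun x => ?_)
      simp [counit_χ, mul_comm, one_apply])

theorem Δ_i (a : A) : Δ L (i L a) = ii L (comul (R := ℂ) a) := lift_i L _ _ _ _ _ a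

theorem Δ_j (x : H) : Δ L (j L x) = Δj L x := lift_j L _ _ _ _ _ x

theorem push_Δ_j : push H (Δ L) (j L) = Δj L := push_lift_j L _ _ _ _ _

theorem ε_i (a : A) : ε L (i L a) = counit (R := ℂ) a := lift_i L _ _ _ _ _ a

theorem push_ε_j : push H (ε L) (j L) = 1 := push_lift_j L _ _ _ _ _

end Comul

end Bismash

end CocycleLinkedPair

/-! ### Coassociativity and the counit laws -/

namespace CocycleLinkedPair

open Cv

set_option linter.unusedSectionVars false

variable {A H : Type*} [Ring A] [Ring H] [Bialgebra ℂ A] [Bialgebra ℂ H]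
  (L : CocycleLinkedPair A H)

theorem push_counit_left_Ψ : push H ((Algebra.TensorProduct.lid ℂ A).toAlgHom.comp
    (Algebra.TensorProduct.map (Bialgebra.counitAlgHom ℂ A) (AlgHom.id ℂ A))) L.Ψ = 1 :=
  ext_fn fun x => by
    rw [push_apply, one_apply, ← L.counit_ψ_left, Ψ_apply, apply_eq_sum_rep']
    rfl

theorem push_counit_right_Ψ : push H ((Algebra.TensorProduct.rid ℂ ℂ A).toAlgHom.comp
    (Algebra.TensorProduct.map (AlgHom.id ℂ A) (Bialgebra.counitAlgHom ℂ A))) L.Ψ = 1 :=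
  ext_fn fun x => by
    rw [push_apply, one_apply, ← L.counit_ψ_right, Ψ_apply, apply_eq_sum_rep']
    rfl

theorem push_counit_R {B : Type*} [Ring B] [Algebra ℂ B] (g : Cv H B) :
    push H ((Algebra.TensorProduct.rid ℂ ℂ B).toAlgHom.comp
      (Algebra.TensorProduct.map (AlgHom.id ℂ B) (Bialgebra.counitAlgHom ℂ A))) (L.R B g) = g :=
  ext_fn fun x => by
    have h := congrArg g.ofConv (L.ρ_counit x)
    rw [sw_eq_sum_rep, map_sum] at h
    rw [push_apply, R_apply, map_sum, ← h]
    refine Finset.sum_congr rfl fun k _ => ?_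
    simp

namespace Bismash

/-- Coassociativity on `j` needs just two relations: `h₁` is the cococycle identity and `h₂` is
coassociativity of the coaction up to `ψ`. -/
theorem mul_mul_eq_of_exchange₂ {S : Type*} [Monoid S] {a b c d e f p q : S}
    (h₁ : a * b = c * d) (h₂ : d * e = f * d) :
    a * (b * (e * p) * q) = c * (f * (d * (p * q))) :=
  calc a * (b * (e * p) * q) = a * b * e * p * q := by simp only [mul_assoc]
    _ = c * (d * e) * p * q := by rw [h₁]; simp only [mul_assoc]
    _ = c * (f * (d * (p * q))) := by rw [h₂]; simp only [mul_assoc]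

/-- The map `A ⊗ (A ⊗ A) → K ⊗ (K ⊗ K)`. -/
abbrev iii : A ⊗[ℂ] (A ⊗[ℂ] A) →ₐ[ℂ] L.Bismash ⊗[ℂ] (L.Bismash ⊗[ℂ] L.Bismash) :=
  Algebra.TensorProduct.map (i L) (ii L)

theorem algHom_comp_tmul {B B' : Type*} [Ring B] [Algebra ℂ B] [Ring B'] [Algebra ℂ B']
    {S : Type*} [Semiring S] [Algebra ℂ S] {p q : B ⊗[ℂ] B' →ₐ[ℂ] S}
    (h : ∀ b b', p (b ⊗ₜ b') = q (b ⊗ₜ b')) : p = q :=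
  AlgHom.toLinearMap_injective (TensorProduct.ext' h)

theorem Δ_comp_i : (Δ L).comp (i L) = (ii L).comp (ΔA A) := AlgHom.ext (Δ_i L)

/-- `(Δ ⊗ id)` followed by reassociation. -/
abbrev Δid : L.Bismash ⊗[ℂ] L.Bismash →ₐ[ℂ] L.Bismash ⊗[ℂ] (L.Bismash ⊗[ℂ] L.Bismash) :=
  (assocHom _ _ _).comp (Algebra.TensorProduct.map (Δ L) (AlgHom.id ℂ _))

/-- `(id ⊗ Δ)`. -/
abbrev idΔ : L.Bismash ⊗[ℂ] L.Bismash →ₐ[ℂ] L.Bismash ⊗[ℂ] (L.Bismash ⊗[ℂ] L.Bismash) :=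
  Algebra.TensorProduct.map (AlgHom.id ℂ _) (Δ L)

theorem Δid_comp_ii : (Δid L).comp (ii L) = (iii L).comp ((assocHom A A A).comp
    (Algebra.TensorProduct.map (ΔA A) (AlgHom.id ℂ A))) :=
  algHom_comp_tmul fun a b => by
    simp only [AlgHom.comp_apply, Algebra.TensorProduct.map_tmul, Δ_i, AlgHom.id_apply,
      Bialgebra.comulAlgHom_apply]
    generalize comul (R := ℂ) a = t
    induction t with
    | zero => simp
    | add s t hs ht => simp only [map_add, add_tmul, hs, ht]
    | tmul c d => rfl

theorem idΔ_comp_ii : (idΔ L).comp (ii L) =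
    (iii L).comp (Algebra.TensorProduct.map (AlgHom.id ℂ A) (ΔA A)) :=
  algHom_comp_tmul fun a b => by
    simp only [AlgHom.comp_apply, Algebra.TensorProduct.map_tmul, Δ_i, AlgHom.id_apply,
      Bialgebra.comulAlgHom_apply]

/-- The map `K ⊗ (A ⊗ A) → K ⊗ (K ⊗ K)`. -/
abbrev idii : L.Bismash ⊗[ℂ] (A ⊗[ℂ] A) →ₐ[ℂ] L.Bismash ⊗[ℂ] (L.Bismash ⊗[ℂ] L.Bismash) :=
  Algebra.TensorProduct.map (AlgHom.id ℂ _) (ii L)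

/-- The first leg of `ρ'` is `j`, so `Δ ⊗ id` replaces it by `Δj`; as `R` is multiplicative and
natural, the three factors of `Δj` are coacted on separately. -/
theorem push_Δid_ρ' : push H (Δid L) (ρ' L) =
    push H (iii L) (push H (assocHom A A A) (L.R _ L.Ψ)) *
      (push H (idii L) (push H (assocHom _ A A) (L.R _ (L.R _ (j L)))) *
        push H (r₂ _ _) (ρ' L)) := by
  have e : (Δid L).comp (idi L) = ((assocHom _ _ _).comp (Algebra.TensorProduct.map
      (AlgHom.id ℂ _) (i L))).comp (Algebra.TensorProduct.map (Δ L) (AlgHom.id ℂ A)) :=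
    algHom_comp_tmul fun a b => rfl
  have e₁ : ((assocHom _ _ _).comp (Algebra.TensorProduct.map (AlgHom.id ℂ _) (i L))).comp
      (Algebra.TensorProduct.map (ii L) (AlgHom.id ℂ A)) = (iii L).comp (assocHom A A A) :=
    algHom_comp_tmul fun t b => by
      induction t with
      | zero => simp
      | add s t hs ht => simp only [add_tmul, map_add, hs, ht]
      | tmul c d => rfl
  have e₂ : ((assocHom _ _ _).comp (Algebra.TensorProduct.map (AlgHom.id ℂ _) (i L))).comp
      (Algebra.TensorProduct.map (idi L) (AlgHom.id ℂ A)) = (idii L).comp (assocHom _ A A) :=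
    algHom_comp_tmul fun t b => by
      induction t with
      | zero => simp
      | add s t hs ht => simp only [add_tmul, map_add, hs, ht]
      | tmul c d => rfl
  have e₃ : ((assocHom _ _ _).comp (Algebra.TensorProduct.map (AlgHom.id ℂ _) (i L))).comp
      (Algebra.TensorProduct.map (r₂ L.Bismash L.Bismash) (AlgHom.id ℂ A)) =
        (r₂ _ _).comp (idi L) :=
    algHom_comp_tmul fun t b => rfl
  rw [ρ', push_push, e, ← push_push, ← R_push, push_Δ_j, Δj, map_mul, map_mul, map_mul, map_mul,
    R_push, push_push, e₁, ρ', R_push, push_push, e₂, j₂, R_push, push_push, e₃]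
  rfl

theorem push_Δid_j₂ : push H (Δid L) (j₂ L) = push H (r₂ L.Bismash _) (j₂ L) :=
  ext_fn fun x => by simp [j₂, Algebra.TensorProduct.one_def]

theorem push_idΔ_j₂ : push H (idΔ L) (j₂ L) = push H (r₂ L.Bismash _) (Δj L) :=
  ext_fn fun x => by simp [j₂, Δ_j]

theorem push_idΔ_ρ' : push H (idΔ L) (ρ' L) =
    push H (B' := L.Bismash ⊗[ℂ] (L.Bismash ⊗[ℂ] L.Bismash)) (idii L)
      (push H (Algebra.TensorProduct.map (AlgHom.id ℂ _) (ΔA A)) (L.R _ (j L))) := by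
  rw [ρ', push_push, push_push]
  refine congrArg (fun q => push H q _) (algHom_comp_tmul fun a b => ?_)
  simp [Δ_i]

theorem push_comp_Δ_j {B : Type*} [Ring B] [Algebra ℂ B]
    (q : L.Bismash ⊗[ℂ] L.Bismash →ₐ[ℂ] B) : push H (q.comp (Δ L)) (j L) =
      push H q (push H (ii L) L.Ψ) * (push H q (ρ' L) * push H q (j₂ L)) := by
  rw [← push_push, push_Δ_j, Δj, map_mul, map_mul]

/-- Both sides are algebra homomorphisms, so it suffices to compare them on the generators. -/
theorem coassoc : (Δid L).comp (Δ L) = (idΔ L).comp (Δ L) := by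
  refine algHom_ext (B := L.Bismash ⊗[ℂ] (L.Bismash ⊗[ℂ] L.Bismash)) ?_ ?_
  · have e₁ : ((Δid L).comp (Δ L)).comp (i L) = ((Δid L).comp (ii L)).comp (ΔA A) := 
      (AlgHom.comp_assoc _ _ _).trans ((congrArg (Δid L).comp (Δ_comp_i L)).trans
        (AlgHom.comp_assoc _ _ _).symm)
    have e₂ : ((idΔ L).comp (Δ L)).comp (i L) = ((idΔ L).comp (ii L)).comp (ΔA A) := by
      rw [AlgHom.comp_assoc, Δ_comp_i, AlgHom.comp_assoc]
    rw [e₁, e₂, Δid_comp_ii, idΔ_comp_ii]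
    refine AlgHom.ext fun a => congrArg (iii L) ?_
    exact Coalgebra.coassoc_apply a
  -- On `j`: the cococycle identity and `ρ_ρ_conv` are transported to the triple tensor product and
  -- combined by `mul_mul_eq_of_exchange₂`.
  · have h₁ := congrArg (push H (B' := L.Bismash ⊗[ℂ] (L.Bismash ⊗[ℂ] L.Bismash)) (iii L)) L.cococycle_conv
    have h₂ := congrArg (push H (B' := L.Bismash ⊗[ℂ] (L.Bismash ⊗[ℂ] L.Bismash)) (idii L)) (L.ρ_ρ_conv (j L))
    rw [map_mul, map_mul] at h₁ h₂
    have hΨ : push H (B' := L.Bismash ⊗[ℂ] (L.Bismash ⊗[ℂ] L.Bismash)) (iii L) (push H (r₂ A (A ⊗[ℂ] A)) L.Ψ) =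
        push H (r₂ L.Bismash _) (push H (ii L) L.Ψ) := ext_fn fun x => by simp
    have hΨ' : push H (B' := L.Bismash ⊗[ℂ] (L.Bismash ⊗[ℂ] L.Bismash)) (idii L) (push H (r₂ L.Bismash (A ⊗[ℂ] A)) L.Ψ) =
        push H (r₂ L.Bismash _) (push H (ii L) L.Ψ) := ext_fn fun x => by simp
    rw [hΨ] at h₁
    rw [hΨ'] at h₂
    have eL := push_comp_Δ_j (B := L.Bismash ⊗[ℂ] (L.Bismash ⊗[ℂ] L.Bismash)) L (Δid L)
    have eR := push_comp_Δ_j (B := L.Bismash ⊗[ℂ] (L.Bismash ⊗[ℂ] L.Bismash)) L (idΔ L)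
    have eΨ : push H (Δid L) (push H (ii L) L.Ψ) = push H (B' := L.Bismash ⊗[ℂ] (L.Bismash ⊗[ℂ]
        L.Bismash)) (iii L) (push H ((assocHom A A A).comp
          (Algebra.TensorProduct.map (ΔA A) (AlgHom.id ℂ A))) L.Ψ) :=
      ext_fn fun x => DFunLike.congr_fun (Δid_comp_ii L) (L.ψ x)
    have eΨ' : push H (idΔ L) (push H (ii L) L.Ψ) = push H (B' := L.Bismash ⊗[ℂ] (L.Bismash ⊗[ℂ]
        L.Bismash)) (iii L) (push H (Algebra.TensorProduct.map (AlgHom.id ℂ A) (ΔA A)) L.Ψ) :=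
      ext_fn fun x => DFunLike.congr_fun (idΔ_comp_ii L) (L.ψ x)
    rw [eL, eR, eΨ, eΨ', push_Δid_j₂, push_idΔ_j₂, push_idΔ_ρ', push_Δid_ρ', Δj, map_mul, map_mul]
    exact mul_mul_eq_of_exchange₂ h₁ h₂

/-- Of the three factors of `Δj`, the counit on the first leg sends `Ψ` and `ρ'` to the unit and
leaves `j`. On the second leg it is `ρ'` that survives. -/
theorem counit_left : (Algebra.TensorProduct.lid ℂ L.Bismash).toAlgHom.comp
    ((Algebra.TensorProduct.map (ε L) (AlgHom.id ℂ _)).comp (Δ L)) = AlgHom.id ℂ _ := by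
  refine algHom_ext (AlgHom.ext fun a => ?_) ?_
  · have h := congrArg (fun t => i L (TensorProduct.lid ℂ A t)) (rTensor_counit_comul (R := ℂ) a)
    simp only [lid_tmul, one_smul] at h
    refine Eq.trans ?_ h
    simp only [AlgHom.comp_apply, Δ_i]
    generalize comul (R := ℂ) a = t
    induction t with
    | zero => simp
    | add s t hs ht => simp only [map_add, hs, ht]
    | tmul b c => simp [ε_i]
  · have hΨ : push H ((Algebra.TensorProduct.lid ℂ L.Bismash).toAlgHom.comp
        (Algebra.TensorProduct.map (ε L) (AlgHom.id ℂ _))) (push H (ii L) L.Ψ) = 1 := by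
      rw [← map_one (push H (i L)), ← push_counit_left_Ψ L, push_push, push_push]
      refine congrArg (fun q => push H q _) (algHom_comp_tmul fun a b => ?_)
      simp [ε_i]
    have hρ : push H ((Algebra.TensorProduct.lid ℂ L.Bismash).toAlgHom.comp
        (Algebra.TensorProduct.map (ε L) (AlgHom.id ℂ _))) (ρ' L) = 1 := ext_fn fun x => by
      have h := congrArg (i L) (L.counit_ρ x)
      rw [sw_eq_sum_rep, map_sum] at h
      rw [ρ', push_push, push_apply, R_apply, map_sum, one_apply]
      simp only [map_smul, map_one] at h
      rw [← h]
      refine Finset.sum_congr rfl fun k _ => ?_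
      have e := congrArg (fun f : Cv H ℂ => f k.1) (push_ε_j L)
      rw [push_apply, one_apply, smul_eq_mul, mul_one] at e
      simp [e]
    have hj : push H ((Algebra.TensorProduct.lid ℂ L.Bismash).toAlgHom.comp
        (Algebra.TensorProduct.map (ε L) (AlgHom.id ℂ _))) (j₂ L) = j L :=
      ext_fn fun x => by simp [j₂]
    rw [← AlgHom.comp_assoc, ← push_push, push_Δ_j, Δj, map_mul, map_mul, hΨ, hρ, hj, one_mul,
      one_mul]
    rfl

theorem counit_right : (Algebra.TensorProduct.rid ℂ ℂ L.Bismash).toAlgHom.comp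
    ((Algebra.TensorProduct.map (AlgHom.id ℂ _) (ε L)).comp (Δ L)) = AlgHom.id ℂ _ := by
  refine algHom_ext (AlgHom.ext fun a => ?_) ?_
  · have h := congrArg (fun t => i L (TensorProduct.rid ℂ A t)) (lTensor_counit_comul (R := ℂ) a)
    simp only [rid_tmul, one_smul] at h
    refine Eq.trans ?_ h
    simp only [AlgHom.comp_apply, Δ_i]
    generalize comul (R := ℂ) a = t
    induction t with
    | zero => simp
    | add s t hs ht => simp only [map_add, hs, ht]
    | tmul b c => simp [ε_i]
  · have hΨ : push H ((Algebra.TensorProduct.rid ℂ ℂ L.Bismash).toAlgHom.comp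
        (Algebra.TensorProduct.map (AlgHom.id ℂ _) (ε L))) (push H (ii L) L.Ψ) = 1 := by
      rw [← map_one (push H (i L)), ← push_counit_right_Ψ L, push_push, push_push]
      refine congrArg (fun q => push H q _) (algHom_comp_tmul fun a b => ?_)
      simp [ε_i]
    have hρ : push H ((Algebra.TensorProduct.rid ℂ ℂ L.Bismash).toAlgHom.comp
        (Algebra.TensorProduct.map (AlgHom.id ℂ _) (ε L))) (ρ' L) = j L := by
      conv_rhs => rw [← push_counit_R L (j L)]
      rw [ρ', push_push]
      refine congrArg (fun q => push H q _) (algHom_comp_tmul fun a b => ?_)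
      simp [ε_i]
    have hj : push H ((Algebra.TensorProduct.rid ℂ ℂ L.Bismash).toAlgHom.comp
        (Algebra.TensorProduct.map (AlgHom.id ℂ _) (ε L))) (j₂ L) = 1 := ext_fn fun x => by
      have e := congrArg (fun f : Cv H ℂ => f x) (push_ε_j L)
      rw [push_apply, one_apply, smul_eq_mul, mul_one] at e
      rw [one_apply]
      simp [j₂, e]
    rw [← AlgHom.comp_assoc, ← push_push, push_Δ_j, Δj, map_mul, map_mul, hΨ, hρ, hj, one_mul,
      mul_one]
    rfl

instance : Bialgebra ℂ L.Bismash :=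
  Bialgebra.ofAlgHom (Δ L) (ε L) (coassoc L)
    (AlgHom.ext fun k => (Algebra.TensorProduct.lid ℂ L.Bismash).injective
      ((DFunLike.congr_fun (counit_left L) k).trans (by simp)))
    (AlgHom.ext fun k => (Algebra.TensorProduct.rid ℂ ℂ L.Bismash).injective
      ((DFunLike.congr_fun (counit_right L) k).trans (by simp)))

theorem comul_def (k : L.Bismash) : comul (R := ℂ) k = Δ L k := rfl

theorem counit_def (k : L.Bismash) : counit (R := ℂ) k = ε L k := rfl

theorem isBismashProduct : L.IsBismashProduct (equiv L) where
  mul a x b y := by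
    rw [mul_def, mulₗ_tmul, J_tmul, mul_apply, bismashMul, Finset.mul_sum]
    simp only [sw3, sw2, sw_eq_sum_rep, G, mul_apply, Cv.sum_apply, Finset.mul_sum]
    refine congrArg (equiv L) (Finset.sum_congr rfl fun k _ => ?_)
    rw [Finset.sum_comm]
    simp [inl, inr, mul_assoc]
  one := rfl
  comul a x := by
    rw [comul_def, ← i_mul_j, map_mul, Δ_i, Δ_j, Δj, mul_apply, bismashComul,
      apply_eq_sum_rep' (ii L), Finset.sum_mul]
    simp only [sw3, sw2, sw_eq_sum_rep, map_sum]
    refine Finset.sum_congr rfl fun k _ => ?_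
    rw [Finset.mul_sum]
    refine Finset.sum_congr rfl fun l _ => ?_
    rw [mul_apply, Finset.mul_sum, Finset.mul_sum]
    refine Finset.sum_congr rfl fun m _ => ?_
    rw [push_apply, Ψ_apply, apply_eq_sum_rep' (ii L) (L.ψ l.1), Finset.sum_mul, Finset.mul_sum]
    refine Finset.sum_congr rfl fun n _ => ?_
    rw [ρ', push_apply, R_apply, map_sum, Finset.sum_mul, Finset.mul_sum, Finset.mul_sum]
    refine Finset.sum_congr rfl fun o _ => ?_
    rw [j₂, push_apply]
    simp only [map_tmul, LinearEquiv.coe_coe, ← i_mul_j, Algebra.TensorProduct.map_tmul,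
      Algebra.TensorProduct.tmul_mul_tmul, Algebra.TensorProduct.includeRight_apply, map_mul,
      mul_assoc, mul_one, AlgHom.id_apply]
  counit a x := by
    have e := congrArg (fun f : Cv H ℂ => f x) (push_ε_j L)
    rw [push_apply, one_apply, smul_eq_mul, mul_one] at e
    rw [counit_def, ← i_mul_j, map_mul, ε_i, e]

end Bismash

end CocycleLinkedPair

/-! ### Sweedler coassociativity and the antipode -/

section Coassoc

variable {C P : Type*} [AddCommGroup C] [Module ℂ C] [Coalgebra ℂ C] [AddCommGroup P] [Module ℂ P]

theorem sum_rep_coassoc (F : C → C → C → P) (h₁ : ∀ v w, IsLinearMap ℂ fun u => F u v w)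
    (h₂ : ∀ u w, IsLinearMap ℂ fun v => F u v w) (h₃ : ∀ u v, IsLinearMap ℂ fun w => F u v w)
    (x : C) :
    ∑ k ∈ rep (comul (R := ℂ) x), ∑ l ∈ rep (comul (R := ℂ) k.1), F l.1 l.2 k.2 =
      ∑ k ∈ rep (comul (R := ℂ) x), ∑ l ∈ rep (comul (R := ℂ) k.2), F k.1 l.1 l.2 := by
  let T : C →ₗ[ℂ] C →ₗ[ℂ] C →ₗ[ℂ] P := LinearMap.mk₂ ℂ (fun u v => (h₃ u v).mk' _)
    (fun u u' v => LinearMap.ext fun w => (h₁ v w).map_add u u')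
    (fun c u v => LinearMap.ext fun w => (h₁ v w).map_smul c u)
    (fun u v v' => LinearMap.ext fun w => (h₂ u w).map_add v v')
    (fun c u v => LinearMap.ext fun w => (h₂ u w).map_smul c v)
  have h := congrArg (TensorProduct.lift ((TensorProduct.lift.equiv (.id ℂ) C C P).toLinearMap ∘ₗ T))
    (coassoc_apply (R := ℂ) x)
  rw [apply_eq_sum_rep (LinearMap.rTensor C (comul (R := ℂ) (A := C))),
    apply_eq_sum_rep (LinearMap.lTensor C (comul (R := ℂ) (A := C)))] at h
  simp only [map_sum, LinearMap.rTensor_tmul, LinearMap.lTensor_tmul] at h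
  refine Eq.trans (Finset.sum_congr rfl fun k _ => ?_) (h.trans (Finset.sum_congr rfl fun k _ => ?_))
  · conv_rhs => rw [eq_sum_rep (comul (R := ℂ) k.1)]
    simp only [sum_tmul, map_sum]
    rfl
  · conv_lhs => rw [eq_sum_rep (comul (R := ℂ) k.2)]
    simp only [tmul_sum, map_sum]
    rfl

end Coassoc

section Antipode

open HopfAlgebra

namespace Cv

variable {H B : Type*} [Ring H] [HopfAlgebra ℂ H] [Ring B] [Algebra ℂ B]

/-- The antipode as an element of the convolution algebra. -/
abbrev Sc (H : Type*) [Ring H] [HopfAlgebra ℂ H] : Cv H H := toConv (antipode ℂ)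

/-- The identity as an element of the convolution algebra. -/
abbrev idc (H : Type*) [Ring H] [HopfAlgebra ℂ H] : Cv H H := toConv LinearMap.id

theorem Sc_mul_idc : Sc H * idc H = 1 := LinearMap.antipode_mul_id

theorem idc_mul_Sc : idc H * Sc H = 1 := LinearMap.id_mul_antipode

/-- Both sides are convolution inverse to the coproduct in Hom(H, H ⊗ H). -/
theorem comul_antipode (x : H) : comul (R := ℂ) (antipode ℂ x) =
    ∑ k ∈ rep (comul (R := ℂ) x), antipode ℂ k.2 ⊗ₜ[ℂ] antipode ℂ k.1 := by
  let l : H →ₐ[ℂ] H ⊗[ℂ] H := Algebra.TensorProduct.includeLeft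
  let r : H →ₐ[ℂ] H ⊗[ℂ] H := Algebra.TensorProduct.includeRight
  have e₁ : (toConv (comul (R := ℂ)) : Cv H (H ⊗[ℂ] H)) = push H l (idc H) * push H r (idc H) :=
    ext_fn fun x => by
      rw [mul_apply, toConv_apply]
      conv_lhs => rw [eq_sum_rep (comul (R := ℂ) x)]
      simp [l, r]
  have e₂ : push H r (Sc H) * push H l (Sc H) * toConv (comul (R := ℂ)) = 1 := by
    rw [e₁, mul_assoc, ← mul_assoc (push H l _), ← map_mul, Sc_mul_idc, map_one, one_mul, ← map_mul,
      Sc_mul_idc, map_one]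
  have e₃ := left_inv_eq_right_inv e₂ (LinearMap.comul_right_inv (R := ℂ) (C := H))
  have := congrArg (fun f : Cv H (H ⊗[ℂ] H) => f x) e₃
  rw [mul_apply] at this
  refine this.symm.trans ?_
  simp [l, r]

theorem sum_rep_antipode_mul (x : H) :
    ∑ k ∈ rep (comul (R := ℂ) x), antipode ℂ k.1 * k.2 = counit (R := ℂ) x • (1 : H) := by
  have := congrArg (fun f : Cv H H => f x) (Sc_mul_idc (H := H))
  rwa [mul_apply, one_apply] at this

theorem sum_rep_mul_antipode (x : H) :
    ∑ k ∈ rep (comul (R := ℂ) x), k.1 * antipode ℂ k.2 = counit (R := ℂ) x • (1 : H) := by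
  have := congrArg (fun f : Cv H H => f x) (idc_mul_Sc (H := H))
  rwa [mul_apply, one_apply] at this

/-- A function of two variables as a bilinear map. -/
def toBilin (F : Cv H (Cv H B)) : H →ₗ[ℂ] H →ₗ[ℂ] B :=
  (WithConv.linearEquiv ℂ (H →ₗ[ℂ] B)).toLinearMap ∘ₗ F.ofConv

/-- The function `x ↦ F(S x₁, x₂)`. -/
def evS (F : Cv H (Cv H B)) : Cv H B :=
  toConv (TensorProduct.lift ((toBilin F).flip ∘ₗ antipode ℂ) ∘ₗ comul)

theorem evS_apply (F : Cv H (Cv H B)) (x : H) :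
    evS F x = ∑ k ∈ rep (comul (R := ℂ) x), F k.2 (antipode ℂ k.1) :=
  apply_eq_sum_rep (TensorProduct.lift ((toBilin F).flip ∘ₗ antipode ℂ)) _

/-- The function `x ↦ F(x₁, S x₂)`. -/
def evS' (F : Cv H (Cv H B)) : Cv H B :=
  toConv (TensorProduct.lift (toBilin F ∘ₗ antipode ℂ).flip ∘ₗ comul)

theorem evS'_apply (F : Cv H (Cv H B)) (x : H) :
    evS' F x = ∑ k ∈ rep (comul (R := ℂ) x), F (antipode ℂ k.2) k.1 :=
  apply_eq_sum_rep (TensorProduct.lift (toBilin F ∘ₗ antipode ℂ).flip) _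

/-- A factor depending only on the second variable can be pulled out, because the antipode sits on
the other variable. -/
theorem evS_mul_fy (F : Cv H (Cv H B)) (g : Cv H B) : evS (F * fy H B g) = evS F * g :=
  ext_fn fun x => by
    have h := sum_rep_coassoc (fun u v w => F v (antipode ℂ u) * g w)
      (fun v w => ⟨fun _ _ => by simp [add_mul], fun _ _ => by simp⟩)
      (fun v w => ⟨fun _ _ => by simp [add_mul], fun _ _ => by simp⟩)
      (fun v w => ⟨fun _ _ => by simp [mul_add], fun _ _ => by simp⟩) x
    rw [evS_apply, mul_apply]
    simp only [evS_apply, Finset.sum_mul]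
    rw [h]
    refine Finset.sum_congr rfl fun k _ => ?_
    rw [mul_apply, Cv.sum_apply]
    simp only [push_apply, mul_const_apply]

theorem evS_mm (g : Cv H B) : evS (mm H B g) = const H B (g 1) := ext_fn fun x => by
  have h := congrArg g.ofConv (sum_rep_antipode_mul x)
  rw [map_sum, map_smul] at h
  rw [evS_apply, const_apply, ← h]
  rfl

/-- The antipode reverses the coproduct, so in `∑ F(x₁, S x₄) g(x₂ S x₃)` the inner legs are
adjacent and collapse. -/
theorem evS'_mul_mm (F : Cv H (Cv H B)) (g : Cv H B) (x : H) :
    evS' (F * mm H B g) x = evS' F x * g 1 := by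
  let f (u : H) : Cv H B := toConv ((toBilin F).flip u)
  let g' (u : H) : Cv H B := toConv (g.ofConv ∘ₗ LinearMap.mulLeft ℂ u)
  have hf (u y) : f u y = F y u := rfl
  have hg (u y) : g' u y = g (u * y) := rfl
  have fadd (u v) : f (u + v) = f u + f v := ext_fn fun y => by simp [hf]
  have fsmul (c : ℂ) (v) : f (c • v) = c • f v := ext_fn fun y => by simp [hf]
  have gadd (u v) : g' (u + v) = g' u + g' v := ext_fn fun y => by simp [hg, add_mul]
  have gsmul (c : ℂ) (v) : g' (c • v) = c • g' v := ext_fn fun y => by simp [hg]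
  have h := sum_rep_coassoc (fun u v w => (f u * g' v) (antipode ℂ w))
      (fun v w => ⟨fun _ _ => by simp [fadd, add_mul], fun _ _ => by simp [fsmul]⟩)
      (fun v w => ⟨fun _ _ => by simp [gadd, mul_add], fun _ _ => by simp [gsmul]⟩)
      (fun v w => ⟨fun _ _ => by simp, fun _ _ => by simp⟩) x
  rw [evS'_apply, evS'_apply, Finset.sum_mul]
  refine Eq.trans (Finset.sum_congr rfl fun k _ => ?_) (h.trans (Finset.sum_congr rfl fun k _ => ?_))
  · rw [mul_apply, Cv.sum_apply]
    simp only [mul_apply, mm_apply, hf, hg]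
    rw [Finset.sum_comm]
  · have e (w : H) (v : H) : (f k.1 * g' v) (antipode ℂ w) = ∑ n ∈ rep (comul (R := ℂ) w),
        F (antipode ℂ n.2) k.1 * g (v * antipode ℂ n.1) := by
      rw [LinearMap.convMul_apply, comul_antipode]
      simp [hf, hg]
    simp only [e]
    have h' := sum_rep_coassoc (fun u v w => F (antipode ℂ w) k.1 * g (u * antipode ℂ v))
      (fun v w => ⟨fun _ _ => by simp [add_mul, mul_add], fun _ _ => by simp⟩)
      (fun v w => ⟨fun _ _ => by simp [mul_add], fun _ _ => by simp⟩)
      (fun v w => ⟨fun _ _ => by simp [add_mul], fun _ _ => by simp⟩) k.2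
    rw [← h']
    have e' (w : H) := congrArg g.ofConv (sum_rep_mul_antipode w)
    simp only [map_sum, map_smul] at e'
    simp only [← Finset.mul_sum, e']
    have e₃ := congrArg (fun w => F (antipode ℂ w) k.1 * g 1) (sum_rep_counit_smul k.2)
    rw [← e₃]
    simp [Finset.sum_mul]

end Cv

end Antipode

namespace CocycleLinkedPair

open Cv HopfAlgebra

set_option linter.unusedSectionVars false

namespace Bismash

theorem fx_j_mul_fy_push_i {A H : Type*} [Ring A] [Ring H] [Bialgebra ℂ A] [Bialgebra ℂ H]
    (L : CocycleLinkedPair A H) (f : Cv H A) : fx H _ (j L) * fy H _ (push H (i L) f) =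
      push H (push H (i L)) (push H L.N f) * fx H _ (j L) := ext_fn fun y => by
  rw [const_mul_apply, push_apply, push_apply, j_mul_i, mul_const_apply]
  rfl

/-! ### The convolution inverse of `j` -/

section InverseJ

variable {A H : Type*} [Ring A] [Ring H] [Bialgebra ℂ A] [HopfAlgebra ℂ H]
  (L : CocycleLinkedPair A H) (χinv : H ⊗[ℂ] H →ₗ[ℂ] A)

/-- `χ⁻¹` with the second variable outside. -/
def Xinv : Cv H (Cv H A) := Cv.curry (toConv χinv)

theorem Xinv_apply (x y : H) : Xinv χinv y x = χinv (x ⊗ₜ y) := rfl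

/-- `(x, y) ↦ χ⁻¹(x₁, y) # x₂`. -/
def XinvJ : Cv H (Cv H L.Bismash) := push H (push H (i L)) (Xinv χinv) * fx H _ (j L)

/-- The convolution inverse of `j`. -/
def jinv : Cv H L.Bismash := evS (XinvJ L χinv)

variable {χinv} (hχ : toConv L.χ * toConv χinv = 1) (hχ' : toConv χinv * toConv L.χ = 1)

include hχ in
theorem X_mul_Xinv : L.X * Xinv χinv = 1 := by
  rw [X, Xinv, ← map_mul, hχ, map_one]

include hχ' in
theorem Xinv_mul_X : Xinv χinv * L.X = 1 := by
  rw [X, Xinv, ← map_mul, hχ', map_one]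

include hχ' in
-- By `j_mul_j` the factor `χ` cancels `χ⁻¹`, and what is left is `j(S(x₁) x₂)`.
theorem jinv_mul_j : jinv L χinv * j L = 1 := by
  rw [jinv, ← evS_mul_fy, XinvJ, mul_assoc, j_mul_j, ← mul_assoc, ← map_mul, Xinv_mul_X L hχ',
    map_one, one_mul, evS_mm, j_one, map_one]

include hχ in
theorem Xinv_apply_one (z : H) : Xinv χinv z 1 = counit (R := ℂ) z • (1 : A) := by
  have h := congrArg (fun u : Cv H (Cv H A) => u z 1) (X_mul_Xinv L hχ)
  rw [mul_apply, Cv.sum_apply, one_apply, Cv.smul_apply, one_apply, Bialgebra.counit_one,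
    one_smul] at h
  simp only [mul_apply_one, X_apply_one, smul_mul_assoc, one_mul] at h
  have e := congrArg (fun z => Xinv χinv z 1) (sum_rep_counit_smul z)
  rw [← h, ← e]
  simp

include hχ in
theorem XinvJ_apply_one (z : H) : XinvJ L χinv z 1 = counit (R := ℂ) z • (1 : L.Bismash) := by
  rw [XinvJ, mul_const_apply, mul_apply_one, push_apply, push_apply, Xinv_apply_one L hχ, j_one]
  simp

include hχ hχ' in
-- The cocycle identity with the factors `χ(y, z)` and `χ(xy, z)` moved to the opposite sides.
theorem cocycle_conv_inv : push H (push H L.N) (Xinv χinv) * const H _ L.X =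
    mm H (Cv H A) L.X * push H (mm H A) (Xinv χinv) := by
  have h := L.cocycle_conv
  have e₁ : push H (push H L.N) (Xinv χinv) * push H (push H L.N) L.X = 1 := by
    rw [← map_mul, Xinv_mul_X L hχ', map_one]
  have e₂ : push H (mm H A) L.X * push H (mm H A) (Xinv χinv) = 1 := by
    rw [← map_mul, X_mul_Xinv L hχ, map_one]
  calc _ = push H (push H L.N) (Xinv χinv) * (const H _ L.X * push H (mm H A) L.X) *
        push H (mm H A) (Xinv χinv) := by rw [mul_assoc, mul_assoc, e₂, mul_one]
    _ = _ := by rw [← h, ← mul_assoc, e₁, one_mul]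

include hχ hχ' in
theorem fx_j_mul_fy_XinvJ : const H (Cv H (Cv H L.Bismash)) (fx H _ (j L)) *
      push H (fy H _) (XinvJ L χinv) =
    push H (push H (push H (i L))) (mm H (Cv H A) L.X) * push H (mm H _) (XinvJ L χinv) := by
  have e₁ : const H (Cv H (Cv H L.Bismash)) (fx H _ (j L)) *
      push H (fy H _) (push H (push H (i L)) (Xinv χinv)) =
      push H (push H (push H (i L))) (push H (push H L.N) (Xinv χinv)) *
        const H _ (fx H _ (j L)) := ext_fn fun z => by
    rw [const_mul_apply, mul_const_apply]
    exact fx_j_mul_fy_push_i L (Xinv χinv z)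
  have e₂ := congrArg (push H (push H (push H (i L)))) (cocycle_conv_inv L hχ hχ')
  rw [map_mul, map_mul, push_const] at e₂
  rw [XinvJ, map_mul, ← mul_assoc, e₁, push_const, mul_assoc, ← map_mul, j_mul_j, map_mul,
    ← mul_assoc, e₂, map_mul, push_const, mul_assoc]
  rfl

include hχ hχ' in
-- In `fx_j_mul_fy_XinvJ` put `y = S` of the second leg of `x`. The factor depending on `xy` is then
-- evaluated at `1`, where `XinvJ` is the counit, and only `χ(x₁, S(x₂) z)` survives.
theorem evS'_fx_j_mul_fy_XinvJ (z : H) : evS' (fx H _ (j L) * fy H _ (XinvJ L χinv z)) =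
    evS' (push H (push H (push H (i L))) (mm H (Cv H A) L.X) z) := ext_fn fun x => by
  have h := congrArg (fun u : Cv H (Cv H (Cv H L.Bismash)) => u z) (fx_j_mul_fy_XinvJ L hχ hχ')
  rw [const_mul_apply, push_apply, mul_apply] at h
  rw [h, evS'_apply]
  simp only [Cv.sum_apply]
  rw [Finset.sum_comm]
  have e (k : H × H) := evS'_mul_mm
    (push H (push H (push H (i L))) (mm H (Cv H A) L.X) k.1) (XinvJ L χinv k.2) x
  simp only [evS'_apply] at e
  refine (Finset.sum_congr rfl fun k _ => e k).trans ?_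
  have e' := congrArg (fun z => evS' (push H (push H (push H (i L))) (mm H (Cv H A) L.X) z) x)
    (sum_rep_counit_smul' z)
  rw [← e', evS'_apply]
  simp only [XinvJ_apply_one L hχ, map_sum, map_smul, Cv.sum_apply, Cv.smul_apply]
  rw [Finset.sum_comm]
  simp [Finset.smul_sum]

include hχ hχ' in
-- The harder side, since the inner `χ⁻¹` is acted upon. After `evS'_fx_j_mul_fy_XinvJ` the product
-- is `∑ χ(x₁, S(x₂) x₃)`, which collapses by the antipode axiom and `χ(x, 1) = ε(x)`.
theorem j_mul_jinv : j L * jinv L χinv = 1 := ext_fn fun x => by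
  have h := sum_rep_coassoc (fun u v w => j L u * XinvJ L χinv w (antipode ℂ v))
      (fun v w => ⟨fun _ _ => by simp [add_mul], fun _ _ => by simp⟩)
      (fun v w => ⟨fun _ _ => by simp [mul_add], fun _ _ => by simp⟩)
      (fun v w => ⟨fun _ _ => by simp [mul_add], fun _ _ => by simp⟩) x
  have h' := sum_rep_coassoc (fun u v w => i L (L.X (antipode ℂ v * w) u))
      (fun v w => ⟨fun _ _ => by simp [-X_apply], fun _ _ => by simp [-X_apply]⟩)
      (fun v w => ⟨fun _ _ => by simp [add_mul, -X_apply], fun _ _ => by simp [-X_apply]⟩)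
      (fun v w => ⟨fun _ _ => by simp [mul_add, -X_apply], fun _ _ => by simp [-X_apply]⟩) x
  have e (z x : H) := congrArg (fun u : Cv H L.Bismash => u x) (evS'_fx_j_mul_fy_XinvJ L hχ hχ' z)
  simp only [evS'_apply, const_mul_apply, push_apply, mul_const_apply, mm_apply] at e
  rw [jinv, mul_apply]
  simp only [evS_apply, Finset.mul_sum]
  rw [← h]
  simp only [e]
  rw [h', one_apply]
  have e₂ (u w : H) := congrArg (fun y => i L (L.X y u)) (sum_rep_antipode_mul w)
  simp only [map_sum, Cv.sum_apply, map_smul, X_one, Cv.smul_apply, one_apply] at e₂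
  simp only [e₂, map_one, smul_smul, ← Finset.sum_smul]
  have e₃ := congrArg (counit (R := ℂ)) (sum_rep_counit_smul x)
  rw [map_sum] at e₃
  rw [← e₃]
  simp [mul_comm]

end InverseJ

end Bismash

end CocycleLinkedPair

namespace CocycleLinkedPair

open Cv HopfAlgebra

set_option linter.unusedSectionVars false

namespace Bismash

/-! ### Factorisation of the identity of the bismash product -/

section Bialg

variable {A H : Type*} [Ring A] [Ring H] [Bialgebra ℂ A] [Bialgebra ℂ H]
  (L : CocycleLinkedPair A H) {B : Type*} [Ring B] [Algebra ℂ B]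

theorem comul_i_mul_j (a : A) (x : H) : comul (R := ℂ) (i L a * j L x) =
    ∑ m ∈ rep (comul (R := ℂ) a), ∑ k ∈ rep (comul (R := ℂ) x),
      ∑ l ∈ rep (comul (R := ℂ) k.2), ∑ n ∈ rep (L.ψ k.1), ∑ o ∈ rep (L.ρ l.1),
        (i L (m.1 * n.1) * j L o.1) ⊗ₜ[ℂ] (i L (m.2 * n.2 * o.2) * j L l.2) := by
  rw [i_mul_j, (isBismashProduct L).comul, bismashComul]
  simp only [sw2, sw3, sw_eq_sum_rep, map_sum, map_tmul, LinearEquiv.coe_coe, i_mul_j]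

theorem sum_rep_comul_i_mul_j {P : Type*} [AddCommGroup P] [Module ℂ P]
    (F : L.Bismash ⊗[ℂ] L.Bismash →ₗ[ℂ] P) (a : A) (x : H) :
    F (comul (R := ℂ) (i L a * j L x)) =
    ∑ m ∈ rep (comul (R := ℂ) a), ∑ k ∈ rep (comul (R := ℂ) x),
      ∑ l ∈ rep (comul (R := ℂ) k.2), ∑ n ∈ rep (L.ψ k.1), ∑ o ∈ rep (L.ρ l.1),
        F ((i L (m.1 * n.1) * j L o.1) ⊗ₜ[ℂ] (i L (m.2 * n.2 * o.2) * j L l.2)) := by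
  rw [comul_i_mul_j]
  simp only [map_sum]

theorem conv_mul_apply (f g : Cv L.Bismash B) (a : A) (x : H) : (f * g) (i L a * j L x) =
    ∑ m ∈ rep (comul (R := ℂ) a), ∑ k ∈ rep (comul (R := ℂ) x),
      ∑ l ∈ rep (comul (R := ℂ) k.2), ∑ n ∈ rep (L.ψ k.1), ∑ o ∈ rep (L.ρ l.1),
        f (i L (m.1 * n.1) * j L o.1) * g (i L (m.2 * n.2 * o.2) * j L l.2) := by
  rw [LinearMap.convMul_apply, ← LinearMap.comp_apply, sum_rep_comul_i_mul_j]
  rfl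

theorem conv_ext {f g : Cv L.Bismash B} (h : ∀ a x, f (i L a * j L x) = g (i L a * j L x)) :
    f = g := ext_fn fun k => by
  induction k using induction_on with
  | zero => simp
  | mul a x => exact h a x
  | add k l hk hl => rw [map_add, map_add, hk, hl]

theorem counit_i_mul_j (a : A) (x : H) :
    counit (R := ℂ) (i L a * j L x) = counit (R := ℂ) a * counit (R := ℂ) x := by
  rw [i_mul_j, (isBismashProduct L).counit]

/-- The map `a # x ↦ ε(x) a`. -/
def toA : Cv L.Bismash A := toConv (liftₗ L (AlgHom.id ℂ A) 1)

theorem toA_apply (a : A) (x : H) : toA L (i L a * j L x) = counit (R := ℂ) x • a := by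
  rw [toA, toConv_apply, liftₗ_mul, one_apply]
  simp

/-- The linear map underlying `toH`. -/
def toHₗ : L.Bismash →ₗ[ℂ] H :=
  (TensorProduct.lid ℂ H).toLinearMap ∘ₗ (counit (R := ℂ) (A := A)).rTensor H ∘ₗ
    (equiv L).symm.toLinearMap

theorem toHₗ_apply (a : A) (x : H) : toHₗ L (i L a * j L x) = counit (R := ℂ) a • x := by
  rw [i_mul_j]
  simp [toHₗ]

theorem sum_rep_ρ_counit (x : H) : ∑ o ∈ rep (L.ρ x), counit (R := ℂ) o.2 • o.1 = x := L.ρ_counit x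

theorem sum_rep_counit_ρ (x : H) :
    ∑ o ∈ rep (L.ρ x), counit (R := ℂ) o.1 • o.2 = counit (R := ℂ) x • (1 : A) := L.counit_ρ x

theorem sum_rep_counit_counit_ψ (x : H) :
    ∑ n ∈ rep (L.ψ x), counit (R := ℂ) n.1 * counit (R := ℂ) n.2 = counit (R := ℂ) x := by
  have h := congrArg (counit (R := ℂ)) (L.counit_ψ_left x)
  rw [sw_eq_sum_rep, map_sum, map_smul, Bialgebra.counit_one, smul_eq_mul, mul_one] at h
  simpa using h

theorem sum_rep_counit_mul_counit {C : Type*} [AddCommGroup C] [Module ℂ C] [Coalgebra ℂ C]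
    (x : C) : ∑ n ∈ rep (comul (R := ℂ) x), counit (R := ℂ) n.1 * counit (R := ℂ) n.2 =
      counit (R := ℂ) x := by
  have h := congrArg (counit (R := ℂ)) (sum_rep_counit_smul x)
  rw [map_sum] at h
  simpa using h

/-- The map `a # x ↦ ε(a) x`. -/
def toH : L.Bismash →ₗc[ℂ] H where
  toLinearMap := toHₗ L
  counit_comp := LinearMap.ext fun k => by
    induction k using induction_on with
    | zero => simp
    | add k l hk hl => rw [map_add, map_add, hk, hl]
    | mul a x => rw [counit_i_mul_j, LinearMap.comp_apply, toHₗ_apply, map_smul, smul_eq_mul]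
  map_comp_comul := LinearMap.ext fun k => by
    induction k using induction_on with
    | zero => simp
    | add k l hk hl => rw [map_add, map_add, hk, hl]
    | mul a x =>
      rw [LinearMap.comp_apply, LinearMap.comp_apply, sum_rep_comul_i_mul_j, toHₗ_apply, map_smul]
      simp only [map_tmul, toHₗ_apply, Bialgebra.counit_mul]
      have e₁ (m : A × A) (n : A × A) (l : H × H) : ∑ o ∈ rep (L.ρ l.1),
          ((counit (R := ℂ) m.1 * counit (R := ℂ) n.1) • o.1) ⊗ₜ[ℂ]
            ((counit (R := ℂ) m.2 * counit (R := ℂ) n.2 * counit (R := ℂ) o.2) • l.2) =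
          (counit (R := ℂ) m.1 * counit (R := ℂ) m.2) •
            (counit (R := ℂ) n.1 * counit (R := ℂ) n.2) • (l.1 ⊗ₜ[ℂ] l.2) := by
        conv_rhs => rw [← sum_rep_ρ_counit L l.1, sum_tmul, Finset.smul_sum, Finset.smul_sum]
        refine Finset.sum_congr rfl fun o _ => ?_
        simp only [smul_tmul, tmul_smul, smul_smul]
        congr 1
        ring
      simp only [e₁, ← Finset.smul_sum, ← Finset.sum_smul, sum_rep_counit_counit_ψ,
        sum_rep_counit_mul_counit]
      refine congrArg (_ • ·) ?_
      simp only [← eq_sum_rep, ← map_smul, ← map_sum, sum_rep_counit_smul]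

theorem toH_apply (a : A) (x : H) : toH L (i L a * j L x) = counit (R := ℂ) a • x := toHₗ_apply L a x

/-- The key to the antipode: inverting the identity reduces to inverting `toA` and `j`. In the
coproduct, the counits applied to the inner legs remove `ψ` and `ρ`. -/
theorem toA_mul_toH : push _ (i L) (toA L) * pull _ (toH L) (j L) = toConv LinearMap.id :=
  conv_ext L fun a x => by
    rw [conv_mul_apply, toConv_apply, LinearMap.id_apply]
    simp only [push_apply, pull_apply, toA_apply, toH_apply, Bialgebra.counit_mul, map_smul]
    have e₁ (m : A × A) (l : H × H) (n : A × A) : ∑ o ∈ rep (L.ρ l.1),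
        counit (R := ℂ) o.1 • i L (m.1 * n.1) *
          (counit (R := ℂ) m.2 * counit (R := ℂ) n.2 * counit (R := ℂ) o.2) • j L l.2 =
        counit (R := ℂ) m.2 • counit (R := ℂ) n.2 • counit (R := ℂ) l.1 •
          (i L (m.1 * n.1) * j L l.2) := by
      have h := congrArg (counit (R := ℂ)) (sum_rep_counit_ρ L l.1)
      rw [map_sum, map_smul, Bialgebra.counit_one, smul_eq_mul, mul_one] at h
      conv_rhs => rw [← h, Finset.sum_smul, Finset.smul_sum, Finset.smul_sum]
      refine Finset.sum_congr rfl fun o _ => ?_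
      simp only [smul_mul_smul_comm, smul_smul, map_smul, smul_eq_mul]
      congr 1
      ring
    have e₂ (m : A × A) (l : H × H) (k : H × H) : ∑ n ∈ rep (L.ψ k.1),
        counit (R := ℂ) m.2 • counit (R := ℂ) n.2 • counit (R := ℂ) l.1 •
          (i L (m.1 * n.1) * j L l.2) =
        counit (R := ℂ) k.1 • (i L (counit (R := ℂ) m.2 • m.1) * j L (counit (R := ℂ) l.1 • l.2)) := by
      have h := L.counit_ψ_right k.1
      rw [sw_eq_sum_rep] at h
      have h' := congrArg (fun b => i L (counit (R := ℂ) m.2 • m.1 * b) *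
        j L (counit (R := ℂ) l.1 • l.2)) h
      simp only [Finset.mul_sum, map_sum, Finset.sum_mul] at h'
      refine Eq.trans (Finset.sum_congr rfl fun n _ => ?_) (h'.trans ?_)
      · simp only [mul_smul_comm, smul_mul_assoc, map_smul]
        simp only [smul_smul]
        congr 1
        ring
      · simp only [mul_smul_comm, smul_mul_assoc, map_smul, mul_one]
        simp only [smul_smul]
        congr 1
        ring
    have e₃ (k : H × H) := congrArg (j L).ofConv (sum_rep_counit_smul k.2)
    have hx := congrArg (j L).ofConv (sum_rep_counit_smul x)
    have ha := congrArg (i L) (sum_rep_counit_smul' a)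
    rw [map_sum] at ha hx
    simp only [map_sum] at e₃
    simp only [e₁, e₂, ← Finset.smul_sum, ← Finset.mul_sum, e₃]
    rw [← hx, ← ha, Finset.sum_mul_sum]
    simp only [map_smul, mul_smul_comm]

end Bialg

/-! ### The convolution inverse of `toA` -/

section InverseToA

variable {A H : Type*} [Ring A] [Ring H] [HopfAlgebra ℂ A] [Bialgebra ℂ H]
  (L : CocycleLinkedPair A H) (Ψinv : Cv H (A ⊗[ℂ] A))

/-- The convolution inverse `b # y ↦ ψ⁻¹(y)_I S(b ψ⁻¹(y)_II)` of `toA`. -/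
def toAinv : Cv L.Bismash A :=
  toConv (TensorProduct.lift (LinearMap.mk₂ ℂ (fun b y =>
    (LinearMap.mul' ℂ A) ((antipode ℂ ∘ₗ LinearMap.mul ℂ A b).lTensor A (Ψinv y)))
    (fun b b' y => by simp [LinearMap.comp_add, LinearMap.lTensor_add])
    (fun c b y => by simp [LinearMap.comp_smul, LinearMap.lTensor_smul])
    (fun b y y' => by simp) (fun c b y => by simp)) ∘ₗ (equiv L).symm.toLinearMap)

theorem toAinv_apply (b : A) (y : H) : toAinv L Ψinv (i L b * j L y) =
    ∑ s ∈ rep (Ψinv y), s.1 * antipode ℂ (b * s.2) := by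
  have : toAinv L Ψinv (i L b * j L y) =
      (LinearMap.mul' ℂ A) ((antipode ℂ ∘ₗ LinearMap.mul ℂ A b).lTensor A (Ψinv y)) := by
    rw [i_mul_j]; rfl
  rw [this, ← LinearMap.comp_apply, apply_eq_sum_rep]
  simp

variable {Ψinv} (hΨ : L.Ψ * Ψinv = 1) (hΨ' : Ψinv * L.Ψ = 1)

include hΨ in
-- Dual to `jinv_mul_j`: the legs of `ψ` and `ψ⁻¹` meet and cancel, leaving `a₁ S(a₂)`.
theorem toA_mul_toAinv : toA L * toAinv L Ψinv = 1 := conv_ext L fun a x => by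
  rw [conv_mul_apply, one_apply, counit_i_mul_j]
  have e₁ (b c : A) (l : H × H) : ∑ o ∈ rep (L.ρ l.1),
      toA L (i L b * j L o.1) * toAinv L Ψinv (i L (c * o.2) * j L l.2) =
        b * toAinv L Ψinv (i L c * j L (counit (R := ℂ) l.1 • l.2)) := by
    have h := congrArg (fun d => b * toAinv L Ψinv (i L (c * d) * j L l.2)) (sum_rep_counit_ρ L l.1)
    simp only [mul_smul_comm, smul_mul_assoc, map_smul, mul_one, Finset.mul_sum, map_sum,
      Finset.sum_mul] at h
    simpa [toA_apply] using h
  have e₂ (m : A × A) (k : H × H) :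
      (∑ l ∈ rep (comul (R := ℂ) k.2), ∑ n ∈ rep (L.ψ k.1), ∑ o ∈ rep (L.ρ l.1),
        toA L (i L (m.1 * n.1) * j L o.1) * toAinv L Ψinv (i L (m.2 * n.2 * o.2) * j L l.2)) =
      (LinearMap.mul' ℂ A ∘ₗ map (LinearMap.mulLeft ℂ m.1) (antipode ℂ ∘ₗ LinearMap.mulLeft ℂ m.2))
        (L.Ψ k.1 * Ψinv k.2) := by
    simp only [e₁]
    rw [Finset.sum_comm]
    have e₃ (c : A) := congrArg (fun y => toAinv L Ψinv (i L c * j L y)) (sum_rep_counit_smul k.2)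
    simp only [map_sum, Finset.mul_sum] at e₃
    simp only [← Finset.mul_sum, e₃]
    simp only [toAinv_apply]
    rw [tmul_mul_eq_sum_rep, map_sum, Ψ_apply]
    simp only [map_sum]
    refine Finset.sum_congr rfl fun n _ => ?_
    rw [Finset.mul_sum]
    refine Finset.sum_congr rfl fun s _ => ?_
    simp [mul_assoc]
  simp only [e₂, ← map_sum]
  have h := congrArg (fun f : Cv H (A ⊗[ℂ] A) => f x) hΨ
  rw [mul_apply, one_apply, Algebra.TensorProduct.one_def] at h
  rw [h]
  simp only [map_smul, LinearMap.comp_apply, map_tmul, LinearMap.mul'_apply,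
    LinearMap.mulLeft_apply, mul_one, ← Finset.smul_sum, sum_rep_mul_antipode]
  rw [smul_smul, mul_comm]

/-- Both middle legs cancel: with `t = p ⊗ s` and `u = q ⊗ r` the value is `∑ p q₁ S(s₁ q₂) s₂ r =
ε(s) ε(q) p r`. -/
theorem mul_antipode_mul_map_comul (t u : A ⊗[ℂ] A) :
    (LinearMap.mul' ℂ A ∘ₗ map LinearMap.id (LinearMap.mul' ℂ A ∘ₗ map (antipode ℂ) LinearMap.id))
      (Algebra.TensorProduct.map (AlgHom.id ℂ A) (ΔA A) t *
        assocHom A A A (Algebra.TensorProduct.map (ΔA A) (AlgHom.id ℂ A) u)) =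
    (Algebra.TensorProduct.rid ℂ ℂ A).toAlgHom.comp
      (Algebra.TensorProduct.map (AlgHom.id ℂ A) (Bialgebra.counitAlgHom ℂ A)) t *
    (Algebra.TensorProduct.lid ℂ A).toAlgHom.comp
      (Algebra.TensorProduct.map (Bialgebra.counitAlgHom ℂ A) (AlgHom.id ℂ A)) u := by
  induction t with
  | zero => simp
  | add t t' ht ht' => simp only [map_add, add_mul, ht, ht']
  | tmul p s =>
    induction u with
    | zero => simp
    | add t t' ht ht' => simp only [map_add, mul_add, ht, ht']
    | tmul q r =>
      have e : ∀ v : A, ∑ k ∈ rep (comul (R := ℂ) s), antipode ℂ (k.1 * v) * k.2 =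
          antipode ℂ v * counit (R := ℂ) s • (1 : A) := fun v => by
        rw [← sum_rep_antipode_mul, Finset.mul_sum]
        simp only [antipode_mul_antidistrib, mul_assoc]
      have e' := sum_rep_mul_antipode q
      simp only [Algebra.TensorProduct.map_tmul, AlgHom.id_apply, Bialgebra.comulAlgHom_apply,
        assocHom_tmul']
      rw [Finset.mul_sum, map_sum]
      simp only [Algebra.TensorProduct.tmul_mul_tmul]
      have e₃ (l : A × A) : (LinearMap.mul' ℂ A ∘ₗ map LinearMap.id (LinearMap.mul' ℂ A ∘ₗ
          map (antipode ℂ) LinearMap.id)) ((p * l.1) ⊗ₜ (comul (R := ℂ) s * (l.2 ⊗ₜ r))) =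
          counit (R := ℂ) s • (p * (l.1 * antipode ℂ l.2) * r) := by
        rw [mul_eq_sum_rep, LinearMap.comp_apply, map_tmul, map_sum]
        simp only [Algebra.TensorProduct.tmul_mul_tmul, LinearMap.comp_apply, map_tmul,
          LinearMap.mul'_apply, LinearMap.id_apply, ← mul_assoc _ _ r, ← Finset.sum_mul, e]
        simp [mul_assoc]
      simp only [e₃, ← Finset.smul_sum, ← Finset.sum_mul, ← Finset.mul_sum, e']
      simp only [smul_mul_assoc, mul_smul_comm, mul_one]
      simp
      rw [smul_comm]

include hΨ hΨ' in
theorem cococycle_conv_inv :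
    push H (r₂ A (A ⊗[ℂ] A)) L.Ψ * push H (assocHom A A A) (L.R _ Ψinv) =
      push H (Algebra.TensorProduct.map (AlgHom.id ℂ A) (ΔA A)) Ψinv *
        push H ((assocHom A A A).comp (Algebra.TensorProduct.map (ΔA A) (AlgHom.id ℂ A))) L.Ψ := by
  have h := L.cococycle_conv
  have e₁ : push H (Algebra.TensorProduct.map (AlgHom.id ℂ A) (ΔA A)) Ψinv *
      push H (Algebra.TensorProduct.map (AlgHom.id ℂ A) (ΔA A)) L.Ψ = 1 := by
    rw [← map_mul, hΨ', map_one]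
  have e₂ : push H (assocHom A A A) (L.R _ L.Ψ) * push H (assocHom A A A) (L.R _ Ψinv) = 1 := by
    rw [← map_mul, ← map_mul, hΨ, map_one, map_one]
  calc _ = (push H (Algebra.TensorProduct.map (AlgHom.id ℂ A) (ΔA A)) Ψinv *
      push H (Algebra.TensorProduct.map (AlgHom.id ℂ A) (ΔA A)) L.Ψ) *
      (push H (r₂ A (A ⊗[ℂ] A)) L.Ψ * push H (assocHom A A A) (L.R _ Ψinv)) := by rw [e₁, one_mul]
    _ = push H (Algebra.TensorProduct.map (AlgHom.id ℂ A) (ΔA A)) Ψinv *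
      ((push H (Algebra.TensorProduct.map (AlgHom.id ℂ A) (ΔA A)) L.Ψ *
      push H (r₂ A (A ⊗[ℂ] A)) L.Ψ) * push H (assocHom A A A) (L.R _ Ψinv)) := by
        simp only [mul_assoc]
    _ = _ := by rw [← h, mul_assoc, e₂, mul_one]

include hΨ' in
theorem push_counit_right_Ψinv : push H ((Algebra.TensorProduct.rid ℂ ℂ A).toAlgHom.comp
    (Algebra.TensorProduct.map (AlgHom.id ℂ A) (Bialgebra.counitAlgHom ℂ A))) Ψinv = 1 := by
  have h := congrArg (push H ((Algebra.TensorProduct.rid ℂ ℂ A).toAlgHom.comp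
    (Algebra.TensorProduct.map (AlgHom.id ℂ A) (Bialgebra.counitAlgHom ℂ A)))) hΨ'
  rwa [map_mul, push_counit_right_Ψ, mul_one, map_one] at h

include hΨ hΨ' in
-- Dual to `j_mul_jinv`. After `S(a₁) a₂` cancels, the remaining expression is the left side of
-- `cococycle_conv_inv` with `m ∘ (id ⊗ m(S ⊗ id))` applied; on its right side
-- `mul_antipode_mul_map_comul` leaves only counits.
theorem toAinv_mul_toA : toAinv L Ψinv * toA L = 1 := conv_ext L fun a x => by
  rw [conv_mul_apply, one_apply, counit_i_mul_j]
  have e₁ (b c : A) (y : H) : ∑ l ∈ rep (comul (R := ℂ) y), ∑ o ∈ rep (L.ρ l.1),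
      toAinv L Ψinv (i L b * j L o.1) * toA L (i L (c * o.2) * j L l.2) =
        ∑ o ∈ rep (L.ρ y), toAinv L Ψinv (i L b * j L o.1) * (c * o.2) := by
    let F : H ⊗[ℂ] A →ₗ[ℂ] A := LinearMap.mul' ℂ A ∘ₗ
      map ((toAinv L Ψinv).ofConv ∘ₗ LinearMap.mulLeft ℂ (i L b) ∘ₗ (j L).ofConv)
        (LinearMap.mulLeft ℂ c)
    have hF (y : H) : F (L.ρ y) =
        ∑ o ∈ rep (L.ρ y), toAinv L Ψinv (i L b * j L o.1) * (c * o.2) := by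
      rw [apply_eq_sum_rep]; rfl
    rw [← hF]
    conv_rhs => rw [← sum_rep_counit_smul' y]
    simp only [map_sum, map_smul, hF, Finset.smul_sum, toA_apply, mul_smul_comm]
  have e₂ (m : A × A) (k : H × H) :
      (∑ l ∈ rep (comul (R := ℂ) k.2), ∑ n ∈ rep (L.ψ k.1), ∑ o ∈ rep (L.ρ l.1),
        toAinv L Ψinv (i L (m.1 * n.1) * j L o.1) * toA L (i L (m.2 * n.2 * o.2) * j L l.2)) =
      ∑ n ∈ rep (L.ψ k.1), ∑ o ∈ rep (L.ρ k.2), ∑ s ∈ rep (Ψinv o.1),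
        (s.1 * antipode ℂ (n.1 * s.2)) * (antipode ℂ m.1 * m.2) * (n.2 * o.2) := by
    rw [Finset.sum_comm]
    refine Finset.sum_congr rfl fun n _ => ?_
    rw [e₁]
    refine Finset.sum_congr rfl fun o _ => ?_
    rw [toAinv_apply, Finset.sum_mul]
    refine Finset.sum_congr rfl fun s _ => ?_
    simp only [antipode_mul_antidistrib, mul_assoc]
  simp only [e₂]
  rw [Finset.sum_comm]
  simp only [Finset.sum_comm (s := rep (comul (R := ℂ) a)), ← Finset.mul_sum, ← Finset.sum_mul,
    sum_rep_antipode_mul]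
  have h := congrArg (fun f : Cv H (A ⊗[ℂ] (A ⊗[ℂ] A)) => (LinearMap.mul' ℂ A ∘ₗ map LinearMap.id
    (LinearMap.mul' ℂ A ∘ₗ map (antipode ℂ) LinearMap.id)) (f x)) (cococycle_conv_inv L hΨ hΨ')
  rw [mul_apply, mul_apply, map_sum, map_sum] at h
  have e₃ := congrArg₂ (fun f g : Cv H A => (f * g) x) (push_counit_right_Ψinv L hΨ')
    (push_counit_left_Ψ L)
  rw [mul_one, mul_apply, one_apply] at e₃
  have e₄ := h.trans ((Finset.sum_congr rfl fun k _ =>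
    mul_antipode_mul_map_comul (Ψinv k.1) (L.Ψ k.2)).trans e₃)
  rw [mul_smul, ← e₄, Finset.smul_sum]
  refine Finset.sum_congr rfl fun k _ => ?_
  rw [push_apply, push_apply, R_apply, Ψ_apply, apply_eq_sum_rep' (r₂ A (A ⊗[ℂ] A)), Finset.sum_mul,
    map_sum, Finset.smul_sum]
  refine Finset.sum_congr rfl fun n _ => ?_
  rw [map_sum, Finset.mul_sum, map_sum, Finset.smul_sum]
  refine Finset.sum_congr rfl fun o _ => ?_
  rw [assocHom_tmul', Finset.mul_sum, map_sum, Finset.smul_sum]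
  rw [Finset.sum_mul, Finset.sum_mul]
  refine Finset.sum_congr rfl fun s _ => ?_
  simp [mul_assoc]

end InverseToA

/-! ### The antipode of the bismash product -/

section Hopf

variable {A H : Type*} [Ring A] [Ring H] [HopfAlgebra ℂ A] [HopfAlgebra ℂ H]
  (L : CocycleLinkedPair A H) (χinv : H ⊗[ℂ] H →ₗ[ℂ] A) (Ψinv : Cv H (A ⊗[ℂ] A))

/-- The antipode of `A^ψ #_χ H`. -/
def S : Cv L.Bismash L.Bismash :=
  pull _ (toH L) (jinv L χinv) * push _ (i L) (toAinv L Ψinv)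

variable {χinv Ψinv} (hχ : toConv L.χ * toConv χinv = 1) (hχ' : toConv χinv * toConv L.χ = 1)
  (hΨ : L.Ψ * Ψinv = 1) (hΨ' : Ψinv * L.Ψ = 1)

include hχ hχ' hΨ in
theorem id_mul_S : toConv LinearMap.id * S L χinv Ψinv = 1 := by
  have e : pull _ (toH L) (j L) * pull _ (toH L) (jinv L χinv) = 1 := by
    rw [← map_mul, j_mul_jinv L hχ hχ', map_one]
  have e' : push _ (i L) (toA L) * push _ (i L) (toAinv L Ψinv) = 1 := by
    rw [← map_mul, toA_mul_toAinv L hΨ, map_one]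
  rw [← toA_mul_toH, S, mul_assoc, ← mul_assoc (pull _ _ _), e, one_mul, e']

include hχ' hΨ hΨ' in
theorem S_mul_id : S L χinv Ψinv * toConv LinearMap.id = 1 := by
  have e : pull _ (toH L) (jinv L χinv) * pull _ (toH L) (j L) = 1 := by
    rw [← map_mul, jinv_mul_j L hχ', map_one]
  have e' : push _ (i L) (toAinv L Ψinv) * push _ (i L) (toA L) = 1 := by
    rw [← map_mul, toAinv_mul_toA L hΨ hΨ', map_one]
  rw [← toA_mul_toH, S, mul_assoc, ← mul_assoc (push _ _ _), e', one_mul, e]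

/-- The Hopf algebra `A^ψ #_χ H`. -/
abbrev hopfAlgebra : HopfAlgebra ℂ L.Bismash where
  antipode := (S L χinv Ψinv).ofConv
  mul_antipode_rTensor_comul := congrArg ofConv (S_mul_id L hχ' hΨ hΨ')
  mul_antipode_lTensor_comul := congrArg ofConv (id_mul_S L hχ hχ' hΨ)

end Hopf

end Bismash

end CocycleLinkedPair

/-! ### Coassociativity for balanced additive functions -/

section Coassoc

variable {C P : Type*} [AddCommGroup C] [Module ℂ C] [AddCommGroup P]

theorem sum_rep_sum_tmul (F : C → C → P) (a₁ : ∀ u u' v, F (u + u') v = F u v + F u' v)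
    (a₂ : ∀ u v v', F u (v + v') = F u v + F u v')
    (b : ∀ (c : ℂ) u v, F (c • u) v = F u (c • v)) {ι : Type*} (s : Finset ι) (m n : ι → C) :
    ∑ k ∈ rep (∑ i ∈ s, m i ⊗ₜ[ℂ] n i), F k.1 k.2 = ∑ i ∈ s, F (m i) (n i) :=
  sw_eq_sum a₁ a₂ b s m n

variable [Coalgebra ℂ C]

/-- Only balanced additivity is assumed, because the sums below contain involutions and are
conjugate linear in some legs. -/
theorem IsRightComodule.sum_rep_coassoc {V : Type*} [AddCommGroup V] [Module ℂ V]
    {δ : V →ₗ[ℂ] V ⊗[ℂ] C} (hδ : IsRightComodule δ) (F : V → C → C → P)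
    (a₁ : ∀ u u' v w, F (u + u') v w = F u v w + F u' v w)
    (a₂ : ∀ u v v' w, F u (v + v') w = F u v w + F u v' w)
    (a₃ : ∀ u v w w', F u v (w + w') = F u v w + F u v w')
    (b₁ : ∀ (c : ℂ) u v w, F (c • u) v w = F u (c • v) w)
    (b₂ : ∀ (c : ℂ) u v w, F u (c • v) w = F u v (c • w)) (x : V) :
    ∑ k ∈ rep (δ x), ∑ l ∈ rep (δ k.1), F l.1 l.2 k.2 =
      ∑ k ∈ rep (δ x), ∑ l ∈ rep (comul (R := ℂ) k.2), F k.1 l.1 l.2 := by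
  let G (u : V) : C ⊗[ℂ] C →+ P := TensorProduct.liftAddHom
    (AddMonoidHom.mk' (fun v => AddMonoidHom.mk' (F u v) (a₃ u v))
      (fun v v' => AddMonoidHom.ext fun w => a₂ u v v' w)) (fun c v w => b₂ c u v w)
  have hG (u v w) : G u (v ⊗ₜ w) = F u v w := rfl
  let T : V ⊗[ℂ] (C ⊗[ℂ] C) →+ P := TensorProduct.liftAddHom
    (AddMonoidHom.mk' G fun u u' => by
      ext t
      induction t with
      | zero => simp
      | add s t hs ht => simp only [map_add, hs, ht]
      | tmul v w => exact a₁ u u' v w)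
    (fun c u t => by
      change G (c • u) t = G u (c • t)
      induction t with
      | zero => simp
      | add s t hs ht => simp only [smul_add, map_add, hs, ht]
      | tmul v w => exact b₁ c u v w)
  have hT (u v w) : T (u ⊗ₜ (v ⊗ₜ w)) = F u v w := rfl
  have h := congrArg T (hδ.coassoc x)
  rw [apply_eq_sum_rep (LinearMap.rTensor C δ),
    apply_eq_sum_rep (LinearMap.lTensor V (comul (R := ℂ) (A := C)))] at h
  simp only [map_sum, LinearMap.rTensor_tmul, LinearMap.lTensor_tmul] at h
  refine Eq.trans (Finset.sum_congr rfl fun k _ => ?_) (h.trans (Finset.sum_congr rfl fun k _ => ?_))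
  · conv_rhs => rw [eq_sum_rep (δ k.1)]
    simp only [sum_tmul, map_sum, assoc_tmul, hT]
  · conv_lhs => rw [eq_sum_rep (comul (R := ℂ) k.2)]
    simp only [tmul_sum, map_sum, hT]

theorem isRightComodule_comul : IsRightComodule (comul (R := ℂ) (A := C)) :=
  ⟨coassoc_apply, fun v => by rw [lTensor_counit_comul, rid_tmul, one_smul]⟩

theorem sum_rep_coassoc_of_balanced (F : C → C → C → P)
    (a₁ : ∀ u u' v w, F (u + u') v w = F u v w + F u' v w)
    (a₂ : ∀ u v v' w, F u (v + v') w = F u v w + F u v' w)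
    (a₃ : ∀ u v w w', F u v (w + w') = F u v w + F u v w')
    (b₁ : ∀ (c : ℂ) u v w, F (c • u) v w = F u (c • v) w)
    (b₂ : ∀ (c : ℂ) u v w, F u (c • v) w = F u v (c • w)) (x : C) :
    ∑ k ∈ rep (comul (R := ℂ) x), ∑ l ∈ rep (comul (R := ℂ) k.1), F l.1 l.2 k.2 =
      ∑ k ∈ rep (comul (R := ℂ) x), ∑ l ∈ rep (comul (R := ℂ) k.2), F k.1 l.1 l.2 :=
  isRightComodule_comul.sum_rep_coassoc F a₁ a₂ a₃ b₁ b₂ x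

theorem Cv.mul_apply_star [StarAddMonoid C] [StarModule ℂ C] {B : Type*} [Ring B]
    [Algebra ℂ B] {x : C} (hs : comul (R := ℂ) (star x) = star (comul (R := ℂ) x)) (f g : Cv C B) :
    (f * g) (star x) = ∑ k ∈ rep (comul (R := ℂ) x), f (star k.1) * g (star k.2) := by
  rw [LinearMap.convMul_apply, hs]
  conv_lhs => rw [eq_sum_rep (comul (R := ℂ) x), star_sum]
  simp only [map_sum]
  rfl

end Coassoc

namespace CocycleLinkedPair

open Cv HopfAlgebra

set_option linter.unusedSectionVars false

namespace Bismash

/-! ### The involution of the bismash product -/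

section Star

variable {A H : Type*} [Ring A] [Ring H] [Bialgebra ℂ A] [Bialgebra ℂ H]
  (L : CocycleLinkedPair A H) (γ : Cv H A)

/-- The function `z ↦ γ(z₁) # z₂`. -/
def jh : Cv H L.Bismash := push H (i L) γ * j L

theorem jh_mul_i_conv (b : A) :
    jh L γ * const H _ (i L b) = push H (i L) (γ * L.N b) * j L := by
  rw [jh, mul_assoc, j_mul_i, ← mul_assoc, ← map_mul]

theorem jh_mul_i (z : H) (b : A) :
    jh L γ z * i L b = (push H (i L) (γ * L.N b) * j L : Cv H L.Bismash) z := by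
  rw [← jh_mul_i_conv, mul_const_apply]

variable [StarRing A] [StarModule ℂ A] [StarRing H] [StarModule ℂ H]

/-- The involution of `A^ψ #_χ H`. -/
def st (k : L.Bismash) : L.Bismash :=
  TensorProduct.lift ((LinearMap.mul ℂ L.Bismash).flip.compl₁₂ (i L).toLinearMap (jh L γ).ofConv)
    (star ((equiv L).symm k))

theorem st_mul (a : A) (x : H) : st L γ (i L a * j L x) = jh L γ (star x) * i L (star a) := by
  rw [i_mul_j]; rfl

theorem st_zero : st L γ 0 = 0 := by simp [st]

theorem st_add (k l : L.Bismash) : st L γ (k + l) = st L γ k + st L γ l := by simp [st]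

theorem st_smul (c : ℂ) (k : L.Bismash) : st L γ (c • k) = star c • st L γ k := by simp [st]

theorem st_sum {ι : Type*} (s : Finset ι) (f : ι → L.Bismash) :
    st L γ (∑ n ∈ s, f n) = ∑ n ∈ s, st L γ (f n) := by simp [st]

theorem st_i_mul (a : A) (k : L.Bismash) : st L γ (i L a * k) = st L γ k * i L (star a) := by
  induction k using induction_on with
  | zero => simp [st_zero]
  | add k l hk hl => rw [mul_add, st_add, st_add, hk, hl, add_mul]
  | mul b x => rw [← mul_assoc, ← map_mul, st_mul, st_mul, star_mul, map_mul, mul_assoc]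

theorem st_j (x : H) : st L γ (j L x) = jh L γ (star x) := by
  have := st_mul L γ 1 x
  rwa [map_one, one_mul, star_one, map_one, mul_one] at this

variable {γ} (hs : ∀ x : H, comul (R := ℂ) (star x) = star (comul (R := ℂ) x))
  (hγ : L.StarConditions (fun x => γ x))

include hs hγ in
theorem cond₁_conv (x : H) (a : A) : ∑ k ∈ rep (comul (R := ℂ) x),
    (γ * L.N (star (L.act k.1 a))) (star k.2) = star a * γ (star x) := by
  have h := hγ.cond₁ x a
  simp only [sw3, sw2, sw_eq_sum_rep] at h
  simp only [mul_apply_star (hs _)]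
  exact h

include hs hγ in
-- The second condition on `γ` says that the star of `∑ i(x₁ ▸ a) j(x₂)` is what
-- antimultiplicativity requires.
theorem st_j_mul_i (x : H) (a : A) :
    st L γ (j L x * i L a) = i L (star a) * jh L γ (star x) := by
  have h := congrArg (fun f : Cv H L.Bismash => st L γ (f x)) (j_mul_i L a)
  rw [mul_const_apply, mul_apply, st_sum] at h
  simp only [push_apply, N_apply, st_mul] at h
  simp only [jh_mul_i] at h
  rw [h, jh, mul_apply_star (hs _), Finset.mul_sum]
  simp only [ mul_apply_star (hs _) (push H (i L) _) (j L), push_apply]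
  rw [← sum_rep_coassoc_of_balanced
    (fun u v w => i L ((γ * L.N (star (L.act u a))) (star v)) * j L (star w))]
  · simp only [← Finset.sum_mul, ← map_sum (i L), cond₁_conv L hs hγ, map_mul, mul_assoc]
  all_goals intros; simp [mul_add, add_mul]

include hs hγ in
theorem cond₂_conv (x y : H) : ∑ k ∈ rep (comul (R := ℂ) x), ∑ l ∈ rep (comul (R := ℂ) y),
    (γ * L.N (star (L.χ (k.1 ⊗ₜ l.1)))) (star l.2 * star k.2) =
      (fx H A γ * push H L.N γ * L.X : Cv H (Cv H A)) (star x) (star y) := by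
  have h := hγ.cond₂ x y
  simp only [sw3, sw2, sw_eq_sum_rep] at h
  rw [mul_assoc, const_mul_apply, mul_apply_star (hs x), mul_apply_star (hs y)]
  simp only [Cv.sum_apply, push_apply, mul_apply_star (hs _), N_apply, X_apply, Finset.mul_sum,
    ← mul_assoc]
  have e (f : Cv H A) (g : Cv H A) (u v : H) : (f * g) (star v * star u) =
      ∑ m ∈ rep (comul (R := ℂ) u), ∑ n ∈ rep (comul (R := ℂ) v),
        f (star n.1 * star m.1) * g (star n.2 * star m.2) := by
    rw [← mm_apply, map_mul, mul_apply_star (hs u), Cv.sum_apply]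
    simp only [mul_apply_star (hs v), mm_apply]
  simp only [e, N_apply]
  refine Eq.trans ?_ (h.symm.trans ?_)
  · refine Finset.sum_congr rfl fun k _ => ?_
    rw [Finset.sum_comm]
  · rw [Finset.sum_comm]

theorem fx_jh_mul_fy_jh : fx H _ (jh L γ) * fy H _ (jh L γ) =
    push H (push H (i L)) (fx H A γ * push H L.N γ * L.X) * mm H _ (j L) := by
  have h := fx_j_mul_fy_push_i L γ
  have h' := j_mul_j L
  have e : push H (push H (i L)) (fx H A γ) = fx H _ (push H (i L) γ) := push_const _ _
  rw [jh, map_mul, map_mul, map_mul, map_mul, mul_assoc _ _ (mm H _ _), ← h', e]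
  simp only [mul_assoc]
  rw [← mul_assoc (fx H _ (j L)), h, mul_assoc]

include hs hγ in
-- The third condition on `γ` matches the star of `∑ i(χ(x₁, y₁)) j(x₂ y₂)` with `jh(y^*) jh(x^*)`.
-- The rest of the proof regroups the legs of `x` and then those of `y`.
theorem st_j_mul_j (x y : H) :
    st L γ (j L x * j L y) = jh L γ (star y) * jh L γ (star x) := by
  have e (f g : Cv H L.Bismash) (u v : H) : (f * g) (star v * star u) =
      ∑ m ∈ rep (comul (R := ℂ) u), ∑ n ∈ rep (comul (R := ℂ) v),
        f (star n.1 * star m.1) * g (star n.2 * star m.2) := by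
    rw [← mm_apply, map_mul, mul_apply_star (hs u), Cv.sum_apply]
    simp only [mul_apply_star (hs v), mm_apply]
  have h := congrArg (fun f : Cv H (Cv H L.Bismash) => st L γ (f y x)) (j_mul_j L)
  rw [const_mul_apply, push_apply, mul_const_apply, mul_apply, Cv.sum_apply, st_sum] at h
  simp only [mul_apply, st_sum, push_apply, mm_apply, X_apply, st_mul, star_mul] at h
  simp only [jh_mul_i, e, push_apply] at h
  rw [h]
  have h' := congrArg (fun f : Cv H (Cv H L.Bismash) => f (star x) (star y))
    (fx_jh_mul_fy_jh (γ := γ) L)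
  rw [const_mul_apply, push_apply, mul_const_apply, mul_apply_star (hs x), Cv.sum_apply] at h'
  simp only [mul_apply_star (hs y), push_apply, mm_apply, ← cond₂_conv L hs hγ, map_sum,
    Finset.sum_mul] at h'
  rw [h', Finset.sum_comm]
  simp only [Finset.sum_comm (t := rep (comul (R := ℂ) y))]
  have hx (l : H × H) (n : H × H) := sum_rep_coassoc_of_balanced
    (fun u v w => i L ((γ * L.N (star (L.χ (u ⊗ₜ l.1)))) (star n.1 * star v)) *
      j L (star n.2 * star w))
    (by intros; simp [mul_add, add_mul, add_tmul]) (by intros; simp [mul_add, add_mul])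
    (by intros; simp [mul_add]) (by intros; simp [← smul_tmul'])
    (by intros; simp) x
  have hy (k : H × H) (m : H × H) := sum_rep_coassoc_of_balanced
    (fun u v w => i L ((γ * L.N (star (L.χ (m.1 ⊗ₜ u)))) (star v * star m.2)) *
      j L (star w * star k.2))
    (by intros; simp [mul_add, add_mul, tmul_add]) (by intros; simp [add_mul])
    (by intros; simp [mul_add, add_mul]) (by intros; simp)
    (by intros; simp) y
  refine Eq.trans (b := ∑ l ∈ rep (comul (R := ℂ) y), ∑ n ∈ rep (comul (R := ℂ) l.2),
    ∑ k ∈ rep (comul (R := ℂ) x), ∑ m ∈ rep (comul (R := ℂ) k.2),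
    i L ((γ * L.N (star (L.χ (k.1 ⊗ₜ l.1)))) (star n.1 * star m.1)) *
      j L (star n.2 * star m.2)) ?_ ?_
  · refine Finset.sum_congr rfl fun l _ => ?_
    simp only [Finset.sum_comm (t := rep (comul (R := ℂ) l.2))]
  simp only [← hx]
  refine Eq.trans (b := ∑ k ∈ rep (comul (R := ℂ) x), ∑ m ∈ rep (comul (R := ℂ) k.1),
    ∑ l ∈ rep (comul (R := ℂ) y), ∑ n ∈ rep (comul (R := ℂ) l.2),
    i L ((γ * L.N (star (L.χ (m.1 ⊗ₜ l.1)))) (star n.1 * star m.2)) *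
      j L (star n.2 * star k.2)) ?_ ?_
  · simp only [Finset.sum_comm (t := rep (comul (R := ℂ) x))]
    refine Finset.sum_congr rfl fun k _ => ?_
    simp only [Finset.sum_comm (t := rep (comul (R := ℂ) k.1))]
  simp only [← hy]
  simp only [Finset.sum_comm (t := rep (comul (R := ℂ) x))]
  refine Finset.sum_congr rfl fun k _ => ?_
  simp only [Finset.sum_comm (t := rep (comul (R := ℂ) k.1))]

include hs hγ in
theorem st_mul_mul (k l : L.Bismash) : st L γ (k * l) = st L γ l * st L γ k := by
  induction k using induction_on with
  | zero => simp [st_zero]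
  | add k k' hk hk' => rw [add_mul, st_add, st_add, hk, hk', mul_add]
  | mul a x =>
    induction l using induction_on with
    | zero => simp [st_zero]
    | add l l' hl hl' => rw [mul_add, st_add, st_add, hl, hl', add_mul]
    | mul b y =>
      have h := congrArg (fun f : Cv H L.Bismash => f x) (j_mul_i L b)
      have h' := congrArg (st L γ) h
      rw [mul_const_apply, mul_apply] at h
      rw [mul_const_apply, st_j_mul_i L hs hγ, mul_apply, st_sum] at h'
      have e : i L a * j L x * (i L b * j L y) = i L a * (j L x * i L b * j L y) := by
        simp only [mul_assoc]
      rw [e, h, Finset.sum_mul, st_i_mul, st_sum, st_mul, st_mul, mul_assoc,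
        ← mul_assoc (i L (star b)), h']
      simp only [mul_assoc, push_apply, N_apply, st_i_mul, st_j_mul_j L hs hγ, st_j, ← Finset.mul_sum]

include hs hγ in
theorem cond₀_conv (x : H) : ∑ k ∈ rep (comul (R := ℂ) x),
    (γ * L.N (star (γ k.1))) (star k.2) = (1 : Cv H A) (star x) := by
  have h := hγ.cond₀ x
  simp only [sw3, sw2, sw_eq_sum_rep] at h
  simp only [mul_apply_star (hs _)]
  rw [one_apply, ← h]
  rfl

include hs hγ in
-- The first condition on `γ`; it makes the star involutive on `j`.
theorem st_jh (z : H) : st L γ (jh L γ z) = j L (star z) := by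
  have e : j L (star z) = (push H (i L) 1 * j L : Cv H L.Bismash) (star z) := by
    rw [map_one, one_mul]
  rw [e, jh, mul_apply, mul_apply_star (hs z), st_sum]
  simp only [push_apply, st_mul, jh_mul_i, mul_apply_star (hs _) (push H (i L) _)]
  rw [← sum_rep_coassoc_of_balanced
    (fun u v w => i L ((γ * L.N (star (γ u))) (star v)) * j L (star w))]
  · simp only [← Finset.sum_mul, ← map_sum (i L), cond₀_conv L hs hγ]
  all_goals intros; simp [mul_add, add_mul]

include hs hγ in
-- With `u = st 1` one has `st u = 1`, hence `1 = st (u · 1) = st 1 · st u = u`.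
theorem st_one : st L γ 1 = 1 := by
  have h : st L γ (st L γ 1) = 1 := by
    rw [← j_one L, st_j, st_jh L hs hγ, star_star]
  rw [← h]
  conv_rhs => rw [← mul_one (st L γ 1), st_mul_mul L hs hγ, h, mul_one]
  rw [h]

include hs hγ in
theorem st_i (a : A) : st L γ (i L a) = i L (star a) := by
  have := st_i_mul L γ a 1
  rwa [mul_one, st_one L hs hγ, one_mul] at this

include hs hγ in
theorem st_st (k : L.Bismash) : st L γ (st L γ k) = k := by
  induction k using induction_on with
  | zero => simp [st_zero]
  | add k l hk hl => rw [st_add, st_add, hk, hl]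
  | mul a x => rw [st_mul, st_mul_mul L hs hγ, st_i L hs hγ, st_jh L hs hγ, star_star, star_star]

/-- The `*`-structure of `A^ψ #_χ H`. -/
abbrev starRing : StarRing L.Bismash where
  star := st L γ
  star_involutive := st_st L hs hγ
  star_mul := st_mul_mul L hs hγ
  star_add := st_add L γ

include hs in
theorem st_eq_bismashStar (a : A) (x : H) :
    st L γ (equiv L (a ⊗ₜ x)) = equiv L (L.bismashStar (fun x => γ x) a x) := by
  rw [← i_mul_j, st_mul, jh_mul_i, map_mul, mul_assoc, mul_apply_star (hs x), bismashStar]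
  simp only [sw3, sw2, sw_eq_sum_rep, map_sum, mul_apply_star (hs _), push_apply, N_apply,
    Finset.mul_sum, ← i_mul_j, map_mul, mul_assoc]

end Star

end Bismash

end CocycleLinkedPair

/-! ### Additivity of sums over representatives -/

section Sw

variable {M N P : Type*} [AddCommGroup M] [Module ℂ M] [AddCommGroup N] [Module ℂ N]
  [AddCommGroup P]

/-- `sw` for a balanced biadditive function, as an additive map. -/
def swHom (f : M → N → P) (a₁ : ∀ m m' n, f (m + m') n = f m n + f m' n)
    (a₂ : ∀ m n n', f m (n + n') = f m n + f m n')
    (b : ∀ (c : ℂ) m n, f (c • m) n = f m (c • n)) : M ⊗[ℂ] N →+ P :=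
  TensorProduct.liftAddHom
    (AddMonoidHom.mk' (fun m => AddMonoidHom.mk' (f m) (a₂ m))
      (fun m m' => AddMonoidHom.ext fun n => a₁ m m' n)) b

theorem sum_rep_eq_swHom (f : M → N → P) (a₁ : ∀ m m' n, f (m + m') n = f m n + f m' n)
    (a₂ : ∀ m n n', f m (n + n') = f m n + f m n')
    (b : ∀ (c : ℂ) m n, f (c • m) n = f m (c • n)) (t : M ⊗[ℂ] N) :
    ∑ k ∈ rep t, f k.1 k.2 = swHom f a₁ a₂ b t := by
  rw [apply_eq_sum_rep']
  rfl

theorem sum_rep_add (f : M → N → P) (a₁ : ∀ m m' n, f (m + m') n = f m n + f m' n)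
    (a₂ : ∀ m n n', f m (n + n') = f m n + f m n')
    (b : ∀ (c : ℂ) m n, f (c • m) n = f m (c • n)) (s t : M ⊗[ℂ] N) :
    ∑ k ∈ rep (s + t), f k.1 k.2 = ∑ k ∈ rep s, f k.1 k.2 + ∑ k ∈ rep t, f k.1 k.2 := by
  simp only [sum_rep_eq_swHom f a₁ a₂ b, map_add]

theorem sum_rep_smul (f : M → N → P) (a₁ : ∀ m m' n, f (m + m') n = f m n + f m' n)
    (a₂ : ∀ m n n', f m (n + n') = f m n + f m n')
    (b : ∀ (c : ℂ) m n, f (c • m) n = f m (c • n)) (c : ℂ) (t : M ⊗[ℂ] N) :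
    ∑ k ∈ rep (c • t), f k.1 k.2 = ∑ k ∈ rep t, f (c • k.1) k.2 := by
  rw [sum_rep_eq_swHom f a₁ a₂ b]
  conv_lhs => rw [eq_sum_rep t, Finset.smul_sum, map_sum]
  rfl

end Sw

namespace CocycleLinkedPair

open Cv HopfAlgebra

set_option linter.unusedSectionVars false

/-! ### The last two conditions on `γ` as convolution identities -/

section StarConditions

variable {A H : Type*} [Ring A] [Ring H] [Bialgebra ℂ A] [Bialgebra ℂ H]
  (L : CocycleLinkedPair A H) {γ : Cv H A}
  [StarRing A] [StarModule ℂ A] [StarRing H] [StarModule ℂ H]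
  (hs : ∀ x : H, comul (R := ℂ) (star x) = star (comul (R := ℂ) x))
  (hγ : L.StarConditions (fun x => γ x))

include hs hγ in
theorem cond₃_conv {B : Type*} [Ring B] [Algebra ℂ B] (g : Cv H B) (x : H) :
    (push H (Bismash.r₂ B A) γ * L.R B g : Cv H (B ⊗[ℂ] A)) (star x) =
      ∑ k ∈ rep (comul (R := ℂ) x), ∑ o ∈ rep (L.ρ k.1),
        g (star o.1) ⊗ₜ[ℂ] (γ * L.N (star o.2)) (star k.2) := by
  have h := congrArg (map g.ofConv LinearMap.id) (hγ.cond₃ x)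
  simp only [sw3, sw2, sw_eq_sum_rep, map_sum, map_tmul, LinearMap.id_apply] at h
  rw [mul_apply_star (hs x)]
  simp only [push_apply, R_apply, mul_apply_star (hs _), Finset.mul_sum,
    Algebra.TensorProduct.includeRight_apply, Algebra.TensorProduct.tmul_mul_tmul, one_mul]
  rw [h]
  refine Finset.sum_congr rfl fun k _ => ?_
  rw [Finset.sum_comm]
  simp only [tmul_sum, N_apply]

include hs in
-- The axiom `comul_ρ` after applying the involution to all legs.
theorem sum_rep_ρ_conv_star (f g : Cv H A) (q : A →ₗ[ℂ] A) (x : H) :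
    ∑ o ∈ rep (L.ρ x), (f * g) (star o.1) ⊗ₜ[ℂ] q (star o.2) =
      ∑ k ∈ rep (comul (R := ℂ) x), ∑ o ∈ rep (L.ρ k.1), ∑ o' ∈ rep (L.ρ k.2),
        (f (star o.1) * g (star o'.1)) ⊗ₜ[ℂ] q (star (o.2 * o'.2)) := by
  have h := congrArg (fun t => (map (LinearMap.mul' ℂ A ∘ₗ map f.ofConv g.ofConv) q ∘ₗ
    (TensorProduct.assoc ℂ H H A).symm.toLinearMap) (star t)) (L.comul_ρ x)
  simp only [sw2, sw_eq_sum_rep, star_sum, map_sum, star_tmul, LinearMap.comp_apply,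
    LinearEquiv.coe_coe, assoc_symm_tmul, map_tmul, LinearMap.mul'_apply] at h
  rw [← h]
  simp only [mul_apply_star (hs _), sum_tmul]

theorem sum_rep_coassoc_ρ_ρ (f g : Cv H A) (q : H → A →ₗ[ℂ] A)
    (hq : ∀ w w', q (w + w') = q w + q w') (hq' : ∀ (c : ℂ) w, q (c • w) = star c • q w) (x : H) :
    ∑ k ∈ rep (comul (R := ℂ) x), ∑ l ∈ rep (comul (R := ℂ) k.1), ∑ o ∈ rep (L.ρ l.1),
        ∑ o' ∈ rep (L.ρ l.2), (f (star o.1) * g (star o'.1)) ⊗ₜ[ℂ] q k.2 (star (o.2 * o'.2)) =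
      ∑ k ∈ rep (comul (R := ℂ) x), ∑ l ∈ rep (comul (R := ℂ) k.2), ∑ o ∈ rep (L.ρ k.1),
        ∑ o' ∈ rep (L.ρ l.1), (f (star o.1) * g (star o'.1)) ⊗ₜ[ℂ] q l.2 (star (o.2 * o'.2)) := by
  refine sum_rep_coassoc_of_balanced (fun u v w => ∑ o ∈ rep (L.ρ u), ∑ o' ∈ rep (L.ρ v),
    (f (star o.1) * g (star o'.1)) ⊗ₜ[ℂ] q w (star (o.2 * o'.2))) ?_ ?_ ?_ ?_ ?_ x
  · intro u u' v w
    rw [map_add]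
    refine sum_rep_add (fun m n => ∑ o' ∈ rep (L.ρ v),
      (f (star m) * g (star o'.1)) ⊗ₜ[ℂ] q w (star (n * o'.2))) ?_ ?_ ?_ _ _
    all_goals intros; simp [add_mul, add_tmul, tmul_add, smul_tmul,
      Finset.sum_add_distrib]
  · intro u v v' w
    simp only [← Finset.sum_add_distrib]
    refine Finset.sum_congr rfl fun o _ => ?_
    rw [map_add]
    refine sum_rep_add (fun m n =>
      (f (star o.1) * g (star m)) ⊗ₜ[ℂ] q w (star (o.2 * n))) ?_ ?_ ?_ _ _
    all_goals intros; simp [mul_add, add_tmul, tmul_add, smul_tmul]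
  · intros; simp [hq, tmul_add, Finset.sum_add_distrib]
  · intro c u v w
    rw [map_smul, map_smul, sum_rep_smul (fun m n => ∑ o' ∈ rep (L.ρ v),
      (f (star m) * g (star o'.1)) ⊗ₜ[ℂ] q w (star (n * o'.2)))]
    · refine Finset.sum_congr rfl fun o _ => ?_
      rw [sum_rep_smul (fun m n =>
        (f (star o.1) * g (star m)) ⊗ₜ[ℂ] q w (star (o.2 * n)))]
      · simp [smul_tmul]
      all_goals intros; simp [mul_add, add_tmul, tmul_add, smul_tmul]
    all_goals intros; simp [add_mul, add_tmul, tmul_add, smul_tmul,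
      Finset.sum_add_distrib]
  · intro c u v w
    refine Finset.sum_congr rfl fun o _ => ?_
    rw [map_smul, sum_rep_smul (fun m n =>
      (f (star o.1) * g (star m)) ⊗ₜ[ℂ] q w (star (o.2 * n)))]
    · simp [hq', smul_tmul]
    all_goals intros; simp [mul_add, add_tmul, tmul_add, smul_tmul]

include hs hγ in
-- Multiplicativity of `R` merges `R(γ)` with the coacted action, so the fourth condition on `γ`
-- applies to the function `γ * N(s)`. The result has the shape of the right side of the fifth
-- condition.
theorem cond₃_conv_mul (s t : A) (y : H) :
    (push H (Bismash.r₂ A A) γ * L.R A γ * (L.R A (L.N s) * L.N₂ A t) : Cv H (A ⊗[ℂ] A)) (star y) =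
      ∑ k ∈ rep (comul (R := ℂ) y), ∑ k' ∈ rep (comul (R := ℂ) k.2), ∑ o ∈ rep (L.ρ k.1),
        ∑ o' ∈ rep (L.ρ k'.1), (γ (star o.1) * L.act (star o'.1) s) ⊗ₜ[ℂ]
          (γ * L.N (star (o.2 * o'.2) * t)) (star k'.2) := by
  have e : push H (Bismash.r₂ A A) γ * L.R A γ * (L.R A (L.N s) * L.N₂ A t) =
      push H (Bismash.r₂ A A) γ * L.R A (γ * L.N s) * L.N₂ A t := by
    rw [map_mul (L.R A)]
    simp only [mul_assoc]
  rw [e, mul_apply_star (hs y)]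
  simp only [cond₃_conv L hs hγ, Finset.sum_mul, AlgHom.comp_apply, push_apply, N_apply,
    Algebra.TensorProduct.includeRight_apply, Algebra.TensorProduct.tmul_mul_tmul, mul_one]
  rw [sum_rep_coassoc_of_balanced (fun u v w => ∑ o ∈ rep (L.ρ u), (γ * L.N s) (star o.1) ⊗ₜ[ℂ]
    ((γ * L.N (star o.2)) (star v) * L.act (star w) t))]
  · let q (z : H) : A →ₗ[ℂ] A :=
      { toFun := fun b => (γ * L.N (b * t)) (star z)
        map_add' := fun b c => by rw [add_mul, map_add, mul_add, Cv.add_apply]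
        map_smul' := fun c b => by
          rw [smul_mul_assoc, map_smul, mul_smul_comm, Cv.smul_apply, RingHom.id_apply] }
    have e₂ (k : H × H) := sum_rep_ρ_conv_star L hs γ (L.N s) (q k.2) k.1
    refine Eq.trans (Finset.sum_congr rfl fun k _ => Eq.trans ?_ (e₂ k)) ?_
    · rw [Finset.sum_comm]
      refine Finset.sum_congr rfl fun o _ => ?_
      rw [← tmul_sum]
      refine congrArg (_ ⊗ₜ ·) ?_
      change _ = (γ * L.N (star o.2 * t)) (star k.2)
      rw [map_mul L.N, ← mul_assoc, mul_apply_star (hs k.2)]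
      rfl
    · refine sum_rep_coassoc_ρ_ρ L γ (L.N s) q (fun w w' => LinearMap.ext fun b => ?_)
        (fun c w => LinearMap.ext fun b => ?_) y
      · exact (congrArg (γ * L.N (b * t)).ofConv (star_add w w')).trans (map_add _ _ _)
      · exact (congrArg (γ * L.N (b * t)).ofConv (star_smul c w)).trans (map_smul _ _ _)
  · intro u u' v w
    rw [map_add]
    refine sum_rep_add (fun m n => (γ * L.N s) (star m) ⊗ₜ[ℂ]
      ((γ * L.N (star n)) (star v) * L.act (star w) t)) ?_ ?_ ?_ _ _
    all_goals intros; simp [mul_add, add_mul, add_tmul, tmul_add, smul_tmul]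
  · intros; simp [add_mul, tmul_add, Finset.sum_add_distrib]
  · intros; simp [mul_add, tmul_add, Finset.sum_add_distrib]
  · intro c u v w
    rw [map_smul, sum_rep_smul (fun m n => (γ * L.N s) (star m) ⊗ₜ[ℂ]
      ((γ * L.N (star n)) (star v) * L.act (star w) t))]
    · simp [smul_tmul]
    all_goals intros; simp [mul_add, add_mul, add_tmul, tmul_add, smul_tmul]
  · intros; simp

include hs hγ in
theorem cond₄_conv (x : H) : ∑ k ∈ rep (comul (R := ℂ) x),
    (push H (Bismash.r₂ A A) γ * L.R A γ * L.Q (star (L.ψ k.1)) : Cv H (A ⊗[ℂ] A)) (star k.2) =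
      (push H (ΔA A) γ * L.Ψ : Cv H (A ⊗[ℂ] A)) (star x) := by
  have h := hγ.cond₄ x
  simp only [sw5, sw4, sw3, sw2, sw_eq_sum_rep] at h
  rw [mul_apply_star (hs x)]
  simp only [push_apply, Ψ_apply, tmul_mul_eq_sum_rep (comul _), Bialgebra.comulAlgHom_apply]
  rw [h]
  refine Finset.sum_congr rfl fun k _ => ?_
  have e : L.Q (star (L.ψ k.1)) = ∑ n ∈ rep (L.ψ k.1),
      L.R A (L.N (star n.1)) * L.N₂ A (star n.2) := by
    conv_lhs => rw [eq_sum_rep (L.ψ k.1), star_sum, map_sum]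
    simp only [star_tmul, Q_tmul]
  rw [e, Finset.mul_sum, Cv.sum_apply]
  simp only [cond₃_conv_mul L hs hγ]
  simp only [Finset.sum_comm (t := rep (L.ψ k.1))]
  refine Finset.sum_congr rfl fun n _ => Finset.sum_congr rfl fun k₂ _ =>
    Finset.sum_congr rfl fun k₃ _ => ?_
  simp only [mul_apply_star (hs _), tmul_sum]
  simp only [Finset.sum_comm (t := rep (L.ρ k₂.1))]
  refine Finset.sum_congr rfl fun o _ => ?_
  simp only [Finset.sum_comm (t := rep (L.ρ k₃.1))]
  refine Finset.sum_congr rfl fun o' _ => Finset.sum_congr rfl fun k₄ _ => ?_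
  simp only [N_apply, star_mul, mul_assoc]

end StarConditions

namespace Bismash

/-! ### The coproduct commutes with the involution -/

section ComulStar

variable {A H : Type*} [Ring A] [Ring H] [Bialgebra ℂ A] [Bialgebra ℂ H]
  (L : CocycleLinkedPair A H) {γ : Cv H A}
  [StarRing A] [StarModule ℂ A] [StarRing H] [StarModule ℂ H]
  (hs : ∀ x : H, comul (R := ℂ) (star x) = star (comul (R := ℂ) x))
  (hsA : ∀ a : A, comul (R := ℂ) (star a) = star (comul (R := ℂ) a))
  (hγ : L.StarConditions (fun x => γ x)) [StarRing L.Bismash] [StarModule ℂ L.Bismash]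
  (hi : ∀ a, star (i L a) = i L (star a)) (hj : ∀ x, star (j L x) = jh L γ (star x))

include hi in
theorem star_ii (t : A ⊗[ℂ] A) : star (ii L t) = ii L (star t) := by
  induction t with
  | zero => simp
  | add s t hs ht => rw [map_add, star_add, star_add, map_add, hs, ht]
  | tmul a b => simp [hi]

include hs hγ hi hj in
-- The fourth condition on `γ`, used for `g = jh`: it computes the star of the factor of `Δj` that
-- comes from the coaction.
theorem star_ρ'_mul_j₂ (y : H) : star ((ρ' L * j₂ L : Cv H (L.Bismash ⊗[ℂ] L.Bismash)) y) =
    (push H (ii L) (push H (r₂ A A) γ * L.R A γ) * (ρ' L * j₂ L) :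
      Cv H (L.Bismash ⊗[ℂ] L.Bismash)) (star y) := by
  have e : push H (ii L) (push H (r₂ A A) γ * L.R A γ) * ρ' L =
      push H (idi L) (push H (r₂ L.Bismash A) γ * L.R _ (jh L γ)) := by
    rw [jh, map_mul, map_mul, map_mul (L.R _), map_mul, ← ρ', ← mul_assoc, R_push]
    refine congrArg (· * ρ' L) (congrArg₂ (· * ·) (ext_fn fun x => by simp) ?_)
    rw [push_push]
    exact congrArg (fun q : A ⊗[ℂ] A →ₐ[ℂ] L.Bismash ⊗[ℂ] L.Bismash => push H q (L.R A γ))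
      (algHom_comp_tmul fun a b => rfl)
  rw [← mul_assoc, e, mul_apply, mul_apply_star (hs y), star_sum]
  simp only [push_apply (idi L), cond₃_conv L hs hγ, map_sum, Finset.sum_mul,
    Algebra.TensorProduct.map_tmul, j₂, push_apply (r₂ _ _),
    Algebra.TensorProduct.includeRight_apply, Algebra.TensorProduct.tmul_mul_tmul, mul_one,
    AlgHom.id_apply]
  rw [sum_rep_coassoc_of_balanced (fun u v w => ∑ o ∈ rep (L.ρ u), jh L γ (star o.1) ⊗ₜ[ℂ]
    (i L ((γ * L.N (star o.2)) (star v)) * j L (star w)))]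
  · refine Finset.sum_congr rfl fun k _ => ?_
    rw [star_mul, Finset.sum_comm, ρ', push_apply, R_apply, map_sum, star_sum, Finset.mul_sum]
    refine Finset.sum_congr rfl fun o _ => ?_
    rw [← tmul_sum]
    have e := jh_mul_i L γ (star k.2) (star o.2)
    rw [mul_apply_star (hs _)] at e
    simp only [push_apply] at e
    rw [← e]
    simp [hi, hj]
  · intro u u' v w
    rw [map_add]
    refine sum_rep_add (fun m n => jh L γ (star m) ⊗ₜ[ℂ]
      (i L ((γ * L.N (star n)) (star v)) * j L (star w))) ?_ ?_ ?_ _ _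
    all_goals intros; simp [mul_add, add_mul, add_tmul, tmul_add, smul_tmul]
  · intros; simp [add_mul, tmul_add, Finset.sum_add_distrib]
  · intros; simp [mul_add, tmul_add, Finset.sum_add_distrib]
  · intro c u v w
    rw [map_smul, sum_rep_smul (fun m n => jh L γ (star m) ⊗ₜ[ℂ]
      (i L ((γ * L.N (star n)) (star v)) * j L (star w)))]
    · simp [smul_tmul]
    all_goals intros; simp [mul_add, add_mul, add_tmul, tmul_add, smul_tmul]
  · intros; simp

include hs hγ hi hj in
-- The fifth condition on `γ` rewrites the part `Δ(γ) ψ` of the right side. The resulting `Q(ψ^*)`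
-- is then moved to the far right by `ρ'_mul_j₂_mul_const_ii`, which is where the star of `Δj` has
-- it.
theorem star_Δj (x : H) : star (Δj L x) = Δ L (jh L γ (star x)) := by
  have e : push H (Δ L) (jh L γ) = push H (ii L) (push H (ΔA A) γ * L.Ψ) * (ρ' L * j₂ L) := by
    rw [jh, map_mul, push_Δ_j, Δj, map_mul, ← mul_assoc, push_push, push_push, Δ_comp_i]
  rw [← push_apply, e, mul_apply_star (hs x)]
  simp only [push_apply, ← cond₄_conv L hs hγ, map_sum, Finset.sum_mul]
  rw [sum_rep_coassoc_of_balanced (fun u v w => ii L ((push H (r₂ A A) γ * L.R A γ *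
    L.Q (star (L.ψ u)) : Cv H (A ⊗[ℂ] A)) (star v)) * (ρ' L * j₂ L :
      Cv H (L.Bismash ⊗[ℂ] L.Bismash)) (star w))]
  · rw [Δj, mul_apply, star_sum]
    refine Finset.sum_congr rfl fun k _ => ?_
    have e₂ (t : A ⊗[ℂ] A) : push H (ii L) (push H (r₂ A A) γ * L.R A γ * L.Q t) *
        (ρ' L * j₂ L) = push H (ii L) (push H (r₂ A A) γ * L.R A γ) * (ρ' L * j₂ L) *
          const H _ (ii L t) := by
      rw [map_mul (push H (ii L)) _ (L.Q t), mul_assoc, ← ρ'_mul_j₂_mul_const_ii]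
      exact (mul_assoc _ _ _).symm
    have e₃ := congrArg (fun f : Cv H (L.Bismash ⊗[ℂ] L.Bismash) => f (star k.2))
      (e₂ (star (L.ψ k.1)))
    rw [mul_apply_star (hs k.2), mul_const_apply] at e₃
    simp only [push_apply] at e₃
    rw [e₃, star_mul, star_ρ'_mul_j₂ L hs hγ hi hj, push_apply, star_ii L hi, Ψ_apply]
  · intros; simp [mul_add, add_mul]
  · intros; simp [add_mul]
  · intros; simp [mul_add]
  · intros; simp
  · intros
    simp only [star_smul, map_smul]
    exact (smul_mul_assoc _ _ _).trans (mul_smul_comm _ _ _).symm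

include hs hsA hγ hi hj in
theorem comul_star (k : L.Bismash) : comul (R := ℂ) (star k) = star (comul (R := ℂ) k) := by
  rw [comul_def, comul_def]
  induction k using induction_on with
  | zero => simp
  | add k l hk hl => rw [star_add, map_add, map_add, star_add, hk, hl]
  | mul a x =>
    rw [star_mul, map_mul, map_mul, star_mul, hi, hj, Δ_i, Δ_i, Δ_j, star_Δj L hs hγ hi hj,
      star_ii L hi, hsA]

end ComulStar

end Bismash

end CocycleLinkedPair

/-! ### Hermitian forms -/

section Hermitian

variable {V : Type*} [AddCommGroup V] [Module ℂ V]

/-- The inner product space structure given by an inner product in the sense of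
`IsInnerProduct`, on a subspace. -/
abbrev IsInnerProduct.core {B : V →ₗ[ℂ] V →ₗ⋆[ℂ] ℂ} (hB : IsInnerProduct B)
    (W : Submodule ℂ V) : InnerProductSpace.Core ℂ W where
  inner x y := B y x
  conj_inner_symm x y := (hB.hermitian x y).symm
  re_inner_nonneg x := by
    by_cases hx : (x : V) = 0
    · simp [hx]
    · exact (hB.pos _ hx).le
  add_left x y z := by simp
  smul_left x y r := by simp
  definite x hx := by
    by_contra h
    have := hB.pos x (by simpa using h)
    change B x x = 0 at hx
    simp [hx] at this

/-- A hermitian form on a finite-dimensional subspace is diagonal in some orthonormal basis. -/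
theorem IsInnerProduct.exists_diagonalizing {B : V →ₗ[ℂ] V →ₗ⋆[ℂ] ℂ} (hB : IsInnerProduct B)
    (F : V →ₗ[ℂ] V →ₗ⋆[ℂ] ℂ) (hF : ∀ u v, F v u = star (F u v))
    (W : Submodule ℂ V) [FiniteDimensional ℂ W] :
    ∃ (n : ℕ) (w : Fin n → V) (l : Fin n → ℝ),
      (∀ i j, B (w i) (w j) = if i = j then 1 else 0) ∧
      (∀ i j, F (w i) (w j) = if i = j then (l i : ℂ) else 0) ∧
      Submodule.span ℂ (Set.range w) = W := by
  let _ : NormedAddCommGroup W := (hB.core W).toNormedAddCommGroup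
  let _ : InnerProductSpace ℂ W := InnerProductSpace.ofCore (hB.core W).toCore
  have hin : ∀ x y : W, inner ℂ x y = B y x := fun _ _ => rfl
  let b := stdOrthonormalBasis ℂ W
  -- The operator representing `F` with respect to `B`; `F` is hermitian exactly when this operator
  -- is symmetric, and the spectral theorem applies.
  let T : W →ₗ[ℂ] W :=
    { toFun := fun x => ∑ i, F x (b i) • b i
      map_add' := by intro x y; simp [add_smul, Finset.sum_add_distrib]
      map_smul' := by intro c x; simp [mul_smul, Finset.smul_sum] }
  have hT : ∀ x y : W, inner ℂ y (T x) = F x y := fun x y => by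
    have hy : (y : V) = ∑ i, inner ℂ (b i) y • ((b i : W) : V) := by
      conv_lhs => rw [← b.sum_repr' y]
      simp
    conv_rhs => rw [hy]
    rw [map_sum]
    change inner ℂ y (∑ i, F x (b i) • b i) = _
    rw [inner_sum]
    refine Finset.sum_congr rfl fun i _ => ?_
    rw [inner_smul_right, map_smulₛₗ, smul_eq_mul, inner_conj_symm, mul_comm]
  have hsymm : T.IsSymmetric := fun x y => by
    rw [hT, ← inner_conj_symm, hT]
    exact (hF _ _).symm
  have hn : Module.finrank ℂ W = Module.finrank ℂ W := rfl
  let c := hsymm.eigenvectorBasis hn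
  refine ⟨_, fun i => c i, hsymm.eigenvalues hn, fun i j => ?_, fun i j => ?_, ?_⟩
  · rw [← hin, c.inner_eq_ite]
    simp only [eq_comm]
  · rw [← hT, hsymm.apply_eigenvectorBasis, inner_smul_right, c.inner_eq_ite]
    rcases eq_or_ne i j with rfl | h
    · simp
    · simp [h, h.symm]
  · have : Submodule.span ℂ (Set.range c) = ⊤ := by
      have := c.toBasis.span_eq
      simpa using this
    have h2 := congrArg (Submodule.map W.subtype) this
    rw [Submodule.map_span, ← Set.range_comp] at h2
    simpa [Function.comp_def] using h2

/-- The tensor product of two inner products is positive. -/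
theorem IsInnerProduct.tensor_pos {N : Type*} [AddCommGroup N] [Module ℂ N]
    {B : V →ₗ[ℂ] V →ₗ⋆[ℂ] ℂ} (hB : IsInnerProduct B)
    {B' : N →ₗ[ℂ] N →ₗ⋆[ℂ] ℂ} (hB' : IsInnerProduct B') (t : V ⊗[ℂ] N) (ht : t ≠ 0) :
    0 < (∑ i ∈ rep t, ∑ j ∈ rep t, B i.1 j.1 * B' i.2 j.2).re := by
  let W : Submodule ℂ V := Submodule.span ℂ (Prod.fst '' (rep t : Set (V × N)))
  have : FiniteDimensional ℂ W :=
    FiniteDimensional.span_of_finite ℂ ((rep t).finite_toSet.image _)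
  obtain ⟨n, w, -, hw, -, hW⟩ := hB.exists_diagonalizing B hB.hermitian W
  have hmem : ∀ i ∈ rep t, ∃ c : Fin n → ℂ, ∑ k, c k • w k = i.1 := fun i hi => by
    rw [← Submodule.mem_span_range_iff_exists_fun, hW]
    exact Submodule.subset_span ⟨i, hi, rfl⟩
  choose! c hc using hmem
  -- With `w` orthonormal in the first factor, `t = ∑ w_k ⊗ m_k`, and the value of the form is the
  -- sum of the squared norms of the `m_k`.
  let m : Fin n → N := fun k => ∑ i ∈ rep t, c i k • i.2
  have hsum : ∑ i ∈ rep t, ∑ j ∈ rep t, B i.1 j.1 * B' i.2 j.2 = ∑ k, B' (m k) (m k) := by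
    have h1 : ∀ i ∈ rep t, ∀ j ∈ rep t, B i.1 j.1 * B' i.2 j.2 =
        ∑ k, B' (c i k • i.2) (c j k • j.2) := fun i hi j hj => by
      conv_lhs => rw [← hc i hi, ← hc j hj]
      simp only [map_sum, LinearMap.sum_apply, map_smul, map_smulₛₗ, LinearMap.smul_apply,
        smul_eq_mul, hw, mul_ite, mul_one, mul_zero, Finset.sum_ite_eq',
        Finset.mem_univ, if_true]
      rw [Finset.sum_mul]
      refine Finset.sum_congr rfl fun k _ => ?_
      ring
    rw [Finset.sum_congr rfl fun i hi => Finset.sum_congr rfl fun j hj => h1 i hi j hj]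
    simp only [m, map_sum, LinearMap.sum_apply]
    exact Finset.sum_comm.trans
      ((Finset.sum_congr rfl fun j _ => Finset.sum_comm).trans Finset.sum_comm)
  have ht' : t = ∑ k, w k ⊗ₜ[ℂ] m k := by
    conv_lhs => rw [eq_sum_rep t]
    rw [Finset.sum_congr rfl fun i hi => by rw [← hc i hi]]
    simp only [m, TensorProduct.sum_tmul, TensorProduct.tmul_sum, TensorProduct.tmul_smul,
      TensorProduct.smul_tmul']
    exact Finset.sum_comm
  rw [hsum, Complex.re_sum]
  have hnn : ∀ k, 0 ≤ (B' (m k) (m k)).re := fun k => by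
    by_cases h : m k = 0
    · simp [h]
    · exact (hB'.pos _ h).le
  refine lt_of_le_of_ne (Finset.sum_nonneg fun k _ => hnn k) fun h0 => ht ?_
  rw [eq_comm, Finset.sum_eq_zero_iff_of_nonneg fun k _ => hnn k] at h0
  rw [ht']
  refine Finset.sum_eq_zero fun k hk => ?_
  have : m k = 0 := by
    by_contra h
    exact (hB'.pos _ h).ne' (h0 k hk)
  rw [this, TensorProduct.tmul_zero]

/-- Every vector space carries an inner product. -/
theorem exists_isInnerProduct (V : Type*) [AddCommGroup V] [Module ℂ V] :
    ∃ B : V →ₗ[ℂ] V →ₗ⋆[ℂ] ℂ, IsInnerProduct B := by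
  let b := Module.Basis.ofVectorSpace ℂ V
  -- The sum of coordinates is finite but its support varies with `u`; this allows two such sums to
  -- be taken over a common index set.
  have hs : ∀ (u v : V) (s : Finset _), (b.repr u).support ⊆ s → 
      ((b.repr u).sum fun i c => c * star (b.repr v i)) =
        ∑ i ∈ s, b.repr u i * star (b.repr v i) := fun u v s h =>
    Finsupp.sum_of_support_subset _ h _ (by simp)
  classical
  refine ⟨LinearMap.mk₂'ₛₗ (RingHom.id ℂ) (starRingEnd ℂ)
    (fun u v => (b.repr u).sum fun i c => c * star (b.repr v i)) ?_ ?_ ?_ ?_, ?_, ?_⟩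
  · intro u u' v
    rw [hs u v _ Finset.subset_union_left, hs u' v _ Finset.subset_union_right, map_add,
      ← Finset.sum_add_distrib, Finsupp.sum_of_support_subset _ Finsupp.support_add _ (by simp)]
    simp [add_mul]
  · intro c u v
    rw [hs (c • u) v (b.repr u).support (by rw [map_smul]; exact Finsupp.support_smul), Finsupp.sum,
      smul_eq_mul, Finset.mul_sum]
    simp [mul_assoc]
  · intro u v v'
    simp [Finsupp.sum, mul_add, Finset.sum_add_distrib]
  · intro c u v
    simp only [Finsupp.sum, smul_eq_mul, Finset.mul_sum]
    refine Finset.sum_congr rfl fun i _ => ?_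
    simp
    ring
  · intro u v
    change ((b.repr v).sum fun i c => c * star (b.repr u i)) =
      star ((b.repr u).sum fun i c => c * star (b.repr v i))
    rw [hs u v _ Finset.subset_union_left, hs v u _ Finset.subset_union_right, star_sum]
    refine Finset.sum_congr rfl fun i _ => ?_
    simp
    ring
  · intro v hv
    change 0 < ((b.repr v).sum fun i c => c * star (b.repr v i)).re
    rw [Finsupp.sum, Complex.re_sum]
    refine Finset.sum_pos (fun i hi => ?_) ?_
    · have : b.repr v i ≠ 0 := Finsupp.mem_support_iff.1 hi
      have h2 : b.repr v i * star (b.repr v i) = (Complex.normSq (b.repr v i) : ℂ) :=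
        Complex.mul_conj _
      rw [h2, Complex.ofReal_re]
      exact Complex.normSq_pos.2 this
    · rw [Finsupp.support_nonempty_iff]
      simpa using hv

end Hermitian

/-! ### Normal integrals -/

section Integral

variable {H : Type*} [Ring H] [HopfAlgebra ℂ H]

/-- A right and a left integral coincide if both are normalized. -/
theorem eq_of_right_left_integral {φ φ' : H →ₗ[ℂ] ℂ}
    (hr : ∀ x, ∑ k ∈ rep (comul (R := ℂ) x), φ k.1 • k.2 = φ x • (1 : H))
    (hl : ∀ x, ∑ k ∈ rep (comul (R := ℂ) x), φ' k.2 • k.1 = φ' x • (1 : H))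
    (h : φ 1 = 1) (h' : φ' 1 = 1) : φ = φ' := by
  ext x
  have h1 := congrArg φ' (hr x)
  have h2 := congrArg φ (hl x)
  simp only [map_sum, map_smul, smul_eq_mul, h, h', mul_one] at h1 h2
  rw [← h1, ← h2]
  exact Finset.sum_congr rfl fun k _ => mul_comm _ _

/-- `x ⊗ y ↦ φ(x) y`. -/
def smulFst (φ : H →ₗ[ℂ] ℂ) : H ⊗[ℂ] H →ₗ[ℂ] H :=
  TensorProduct.lid ℂ H ∘ₗ φ.rTensor H

@[simp] theorem smulFst_tmul (φ : H →ₗ[ℂ] ℂ) (x y : H) : smulFst φ (x ⊗ₜ y) = φ x • y := by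
  simp [smulFst]

/-- `x ⊗ y ↦ φ(y) x`. -/
def smulSnd (φ : H →ₗ[ℂ] ℂ) : H ⊗[ℂ] H →ₗ[ℂ] H :=
  TensorProduct.rid ℂ H ∘ₗ φ.lTensor H

@[simp] theorem smulSnd_tmul (φ : H →ₗ[ℂ] ℂ) (x y : H) : smulSnd φ (x ⊗ₜ y) = φ y • x := by
  simp [smulSnd]

theorem IsNormalIntegral.smulFst_comul {φ : H →ₗ[ℂ] ℂ} (hφ : IsNormalIntegral φ) (x : H) :
    smulFst φ (comul (R := ℂ) x) = φ x • (1 : H) := by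
  rw [apply_eq_sum_rep]
  simp only [smulFst_tmul]
  exact hφ.right x

theorem IsNormalIntegral.smulSnd_comul {φ : H →ₗ[ℂ] ℂ} (hφ : IsNormalIntegral φ) (x : H) :
    smulSnd φ (comul (R := ℂ) x) = φ x • (1 : H) := by
  rw [apply_eq_sum_rep]
  simp only [smulSnd_tmul]
  exact hφ.left x

/-- Strong right invariance: `∑ φ(c a₁) S(a₂) = ∑ φ(c₁ a) c₂`. -/
theorem IsNormalIntegral.sum_rep_smul_antipode {φ : H →ₗ[ℂ] ℂ} (hφ : IsNormalIntegral φ)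
    (c a : H) : ∑ k ∈ rep (comul (R := ℂ) a), φ (c * k.1) • HopfAlgebra.antipode ℂ k.2 =
      ∑ k ∈ rep (comul (R := ℂ) c), φ (k.1 * a) • k.2 := by
  let f : Cv H H := ∑ k ∈ rep (comul (R := ℂ) c),
    toConv ((φ ∘ₗ LinearMap.mulLeft ℂ k.1).smulRight k.2)
  let g : Cv H H := toConv ((φ ∘ₗ LinearMap.mulLeft ℂ c).smulRight (1 : H))
  have hf : ∀ x, f x = ∑ k ∈ rep (comul (R := ℂ) c), φ (k.1 * x) • k.2 := fun x =>
    Cv.sum_apply _ _ _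
  have hg : ∀ x, g x = φ (c * x) • (1 : H) := fun x => rfl
  -- Right invariance of `φ` on the product `c x`. Convolving with the antipode on the right then
  -- solves for `f`.
  have h1 : f * Cv.idc H = g := Cv.ext_fn fun x => by
    rw [hg, ← hφ.smulFst_comul, Bialgebra.comul_mul, Cv.mul_apply]
    conv_rhs => rw [eq_sum_rep (comul (R := ℂ) c), eq_sum_rep (comul (R := ℂ) x)]
    simp only [hf, Finset.sum_mul, Finset.mul_sum, map_sum, Algebra.TensorProduct.tmul_mul_tmul,
      smulFst_tmul]
    refine Finset.sum_congr rfl fun k _ => Finset.sum_congr rfl fun l _ => ?_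
    exact smul_mul_assoc _ _ _
  have h2 : f = g * Cv.Sc H := by rw [← h1, mul_assoc, Cv.idc_mul_Sc, mul_one]
  rw [← hf, h2, Cv.mul_apply]
  refine Finset.sum_congr rfl fun k _ => ?_
  rw [hg, smul_one_mul]

/-- Strong left invariance: `∑ φ(y z₂) z₁ = ∑ φ(y₂ z) S(y₁)`. -/
theorem IsNormalIntegral.sum_rep_smul_antipode' {φ : H →ₗ[ℂ] ℂ} (hφ : IsNormalIntegral φ)
    (y z : H) : ∑ k ∈ rep (comul (R := ℂ) z), φ (y * k.2) • k.1 =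
      ∑ k ∈ rep (comul (R := ℂ) y), φ (k.2 * z) • HopfAlgebra.antipode ℂ k.1 := by
  let f : Cv H H := ∑ k ∈ rep (comul (R := ℂ) z),
    toConv ((φ ∘ₗ LinearMap.mulRight ℂ k.2).smulRight k.1)
  let g : Cv H H := toConv ((φ ∘ₗ LinearMap.mulRight ℂ z).smulRight (1 : H))
  have hf : ∀ x, f x = ∑ k ∈ rep (comul (R := ℂ) z), φ (x * k.2) • k.1 := fun x =>
    Cv.sum_apply _ _ _
  have hg : ∀ x, g x = φ (x * z) • (1 : H) := fun x => rfl
  have h1 : Cv.idc H * f = g := Cv.ext_fn fun x => by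
    rw [hg, ← hφ.smulSnd_comul, Bialgebra.comul_mul, Cv.mul_apply]
    conv_rhs => rw [eq_sum_rep (comul (R := ℂ) x), eq_sum_rep (comul (R := ℂ) z)]
    simp only [hf, Finset.sum_mul, Finset.mul_sum, map_sum, Algebra.TensorProduct.tmul_mul_tmul,
      smulSnd_tmul]
    rw [Finset.sum_comm]
    refine Finset.sum_congr rfl fun k _ => Finset.sum_congr rfl fun l _ => ?_
    exact mul_smul_comm _ _ _
  have h2 : f = Cv.Sc H * g := by rw [← h1, ← mul_assoc, Cv.Sc_mul_idc, one_mul]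
  rw [← hf, h2, Cv.mul_apply]
  refine Finset.sum_congr rfl fun k _ => ?_
  rw [hg, mul_smul_one]

variable [StarRing H] [StarModule ℂ H]

theorem comul_star_eq_sum (hs : ∀ x : H, comul (R := ℂ) (star x) = star (comul (R := ℂ) x))
    {ι : Type*} (s : Finset ι) (m n : ι → H) (x : H)
    (hx : comul (R := ℂ) x = ∑ i ∈ s, m i ⊗ₜ[ℂ] n i) :
    comul (R := ℂ) (star x) = ∑ i ∈ s, star (m i) ⊗ₜ[ℂ] star (n i) := by
  rw [hs, hx, star_sum]
  rfl

/-- The functional `x ↦ conj φ(x^*)` is again a normalized left integral, and such an integral is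
unique. -/
theorem IsNormalIntegral.map_star {φ : H →ₗ[ℂ] ℂ} (hφ : IsNormalIntegral φ)
    (hs : ∀ x : H, comul (R := ℂ) (star x) = star (comul (R := ℂ) x)) (x : H) :
    φ (star x) = star (φ x) := by
  let φ' : H →ₗ[ℂ] ℂ :=
    { toFun := fun x => star (φ (star x))
      map_add' := by intro x y; simp
      map_smul' := by intro c x; simp }
  have hφ' : ∀ x, φ' x = star (φ (star x)) := fun _ => rfl
  have h : φ = φ' := by
    refine eq_of_right_left_integral hφ.right (fun x => ?_) hφ.normal (by simp [hφ', hφ.normal])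
    have h1 := congrArg star (hφ.smulSnd_comul (star x))
    rw [comul_star_eq_sum hs _ _ _ x (eq_sum_rep _)] at h1
    simp only [map_sum, smulSnd_tmul, star_sum, star_smul, star_star, star_one] at h1
    exact h1
  exact (congrArg (fun f => f (star x)) h).trans (by rw [hφ', star_star])

/-- The sesquilinear form `(x, y) ↦ φ(y^* x)`. -/
def starForm (φ : H →ₗ[ℂ] ℂ) : H →ₗ[ℂ] H →ₗ⋆[ℂ] ℂ :=
  LinearMap.mk₂'ₛₗ (RingHom.id ℂ) (starRingEnd ℂ) (fun x y => φ (star y * x))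
    (by intros; simp [mul_add]) (by intros; simp) (by intros; simp [add_mul])
    (by intros; simp)

theorem starForm_apply (φ : H →ₗ[ℂ] ℂ) (x y : H) : starForm φ x y = φ (star y * x) := rfl

theorem IsNormalIntegral.starForm_hermitian {φ : H →ₗ[ℂ] ℂ} (hφ : IsNormalIntegral φ)
    (hs : ∀ x : H, comul (R := ℂ) (star x) = star (comul (R := ℂ) x)) (x y : H) :
    starForm φ y x = star (starForm φ x y) := by
  rw [starForm_apply, starForm_apply, ← hφ.map_star hs, star_mul, star_star]

end Integral

/-! ### Positivity of the normal integral of a compact quantum group -/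

section Subcomodule

variable {C : Type*} [AddCommGroup C] [Module ℂ C] [Coalgebra ℂ C]

/-- Every element of a coalgebra lies in a finite-dimensional right subcomodule. -/
theorem exists_finite_subcomodule (x : C) : ∃ (n : ℕ) (a : Fin n → C),
    x ∈ Submodule.span ℂ (Set.range a) ∧
    ∀ y ∈ Submodule.span ℂ (Set.range a), ∃ c : Fin n → C,
      comul (R := ℂ) y = ∑ i, a i ⊗ₜ[ℂ] c i := by
  let b := Module.Basis.ofVectorSpace ℂ C
  obtain ⟨f, hf⟩ := TensorProduct.eq_repr_basis_right b (comul (R := ℂ) x)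
  let n := f.support.card
  let e : Fin n ≃ f.support := f.support.equivFin.symm
  let a : Fin n → C := fun i => f (e i)
  let d : Fin n → C := fun i => b (e i)
  have hΔ : comul (R := ℂ) x = ∑ i, a i ⊗ₜ[ℂ] d i := by
    rw [← hf, Finsupp.sum, ← Finset.sum_coe_sort]
    exact (e.sum_comp fun k => f k ⊗ₜ[ℂ] b k).symm
  have hx : ∑ i, counit (R := ℂ) (d i) • a i = x := by
    have := Coalgebra.lTensor_counit_comul (R := ℂ) x
    rw [hΔ, map_sum] at this
    simpa using congrArg (TensorProduct.rid ℂ C) this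
  refine ⟨n, a, ?_, fun y hy => ?_⟩
  · rw [← hx]
    exact Submodule.sum_mem _ fun i _ => Submodule.smul_mem _ _ (Submodule.subset_span ⟨i, rfl⟩)
  · induction hy using Submodule.span_induction with
    | mem y hy =>
      obtain ⟨k, rfl⟩ := hy
      have h := Coalgebra.coassoc_apply (R := ℂ) x
      rw [hΔ] at h
      -- The `k`-th coordinate functional on the third leg of coassociativity expresses `Δ(a_k)`
      -- with all first legs in the span of `a`.
      have h2 := congrArg
        (((TensorProduct.rid ℂ C).toLinearMap ∘ₗ (b.coord (e k)).lTensor C).lTensor C) h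
      simp only [map_sum, LinearMap.rTensor_tmul, LinearMap.lTensor_tmul] at h2
      refine ⟨fun i => TensorProduct.rid ℂ C ((b.coord (e k)).lTensor C (comul (d i))), ?_⟩
      refine Eq.trans ?_ h2
      have h3 : ∀ (t : C ⊗[ℂ] C) (z : C), ((TensorProduct.rid ℂ C).toLinearMap ∘ₗ
          (b.coord (e k)).lTensor C).lTensor C (TensorProduct.assoc ℂ C C C (t ⊗ₜ z)) =
            b.coord (e k) z • t := fun t z => by
        induction t with
        | zero => simp
        | tmul u v => simp
        | add s t hs ht => simp only [TensorProduct.add_tmul, map_add, hs, ht, smul_add]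
      simp only [h3, d, b.coord_apply, b.repr_self]
      rw [Finset.sum_eq_single k]
      · simp
      · intro i _ hi
        rw [Finsupp.single_eq_of_ne, zero_smul]
        intro h'
        exact hi (e.injective (Subtype.ext h')).symm
      · simp
    | zero => exact ⟨0, by simp⟩
    | add y z _ _ hy hz =>
      obtain ⟨c, hc⟩ := hy
      obtain ⟨c', hc'⟩ := hz
      exact ⟨c + c', by simp [hc, hc', TensorProduct.tmul_add, Finset.sum_add_distrib]⟩
    | smul r y _ hy =>
      obtain ⟨c, hc⟩ := hy
      exact ⟨r • c, by simp [hc, Finset.smul_sum]⟩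

variable {ι : Type*} [Fintype ι] {V : Type*} [AddCommGroup V] [Module ℂ V]

/-- Pairing the first leg with `w_i` isolates the `i`-th coefficient. -/
theorem IsInnerProduct.tmul_ext [DecidableEq ι] {N : Type*} [AddCommGroup N] [Module ℂ N]
    {B : V →ₗ[ℂ] V →ₗ⋆[ℂ] ℂ} {w : ι → V}
    (hw : ∀ i j, B (w i) (w j) = if i = j then 1 else 0) {p q : ι → N}
    (h : ∑ j, w j ⊗ₜ[ℂ] p j = ∑ j, w j ⊗ₜ[ℂ] q j) : p = q := by
  funext i
  let f : V →ₗ[ℂ] ℂ :=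
    { toFun := fun x => B x (w i)
      map_add' := by simp
      map_smul' := by simp }
  have := congrArg ((TensorProduct.lid ℂ N).toLinearMap ∘ₗ f.rTensor N) h
  simpa [f, hw] using this

/-- The matrix of a finite-dimensional right subcomodule, with respect to an orthonormal basis in
which a given hermitian form is diagonal. -/
theorem IsInnerProduct.exists_matrix {B : C →ₗ[ℂ] C →ₗ⋆[ℂ] ℂ} (hB : IsInnerProduct B)
    (F : C →ₗ[ℂ] C →ₗ⋆[ℂ] ℂ) (hF : ∀ u v, F v u = star (F u v)) (x : C) :
    ∃ (n : ℕ) (w : Fin n → C) (l : Fin n → ℝ) (u : Fin n → Fin n → C),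
      (∀ i j, B (w i) (w j) = if i = j then 1 else 0) ∧
      (∀ i j, F (w i) (w j) = if i = j then (l i : ℂ) else 0) ∧
      x ∈ Submodule.span ℂ (Set.range w) ∧
      (∀ i, comul (R := ℂ) (w i) = ∑ j, w j ⊗ₜ[ℂ] u j i) ∧
      (∀ k i, comul (R := ℂ) (u k i) = ∑ j, u k j ⊗ₜ[ℂ] u j i) ∧
      (∀ i j, counit (R := ℂ) (u i j) = if i = j then 1 else 0) ∧
      ∀ i, w i = ∑ j, counit (R := ℂ) (w j) • u j i := by
  obtain ⟨m, a, hx, ha⟩ := exists_finite_subcomodule x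
  have hfin : FiniteDimensional ℂ (Submodule.span ℂ (Set.range a)) :=
    FiniteDimensional.span_of_finite ℂ (Set.finite_range a)
  obtain ⟨n, w, l, hw, hl, hW⟩ := hB.exists_diagonalizing F hF (Submodule.span ℂ (Set.range a))
  have hu : ∀ i, ∃ c : Fin n → C, comul (R := ℂ) (w i) = ∑ j, w j ⊗ₜ[ℂ] c j := fun i => by
    obtain ⟨c, hc⟩ := ha (w i) (hW ▸ Submodule.subset_span ⟨i, rfl⟩)
    have hmem : ∀ k, ∃ r : Fin n → ℂ, ∑ j, r j • w j = a k := fun k => by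
      rw [← Submodule.mem_span_range_iff_exists_fun, hW]
      exact Submodule.subset_span ⟨k, rfl⟩
    choose r hr using hmem
    refine ⟨fun j => ∑ k, r k j • c k, ?_⟩
    rw [hc, Finset.sum_congr rfl fun k _ => by rw [← hr k]]
    simp only [TensorProduct.sum_tmul, TensorProduct.tmul_sum, TensorProduct.tmul_smul,
      TensorProduct.smul_tmul']
    exact Finset.sum_comm
  choose v hv using hu
  have hΔ : ∀ i, comul (R := ℂ) (w i) = ∑ j, w j ⊗ₜ[ℂ] v i j := hv
  refine ⟨n, w, l, fun j i => v i j, hw, hl, hW ▸ hx, hΔ, fun k i => ?_, fun k i => ?_,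
    fun i => ?_⟩
  · have h := Coalgebra.coassoc_apply (R := ℂ) (w i)
    rw [hΔ] at h
    simp only [map_sum, LinearMap.rTensor_tmul, LinearMap.lTensor_tmul, hΔ,
      TensorProduct.sum_tmul, TensorProduct.assoc_tmul] at h
    rw [Finset.sum_comm] at h
    simp only [← TensorProduct.tmul_sum] at h
    exact (congrFun (IsInnerProduct.tmul_ext hw h) k).symm
  · have h := Coalgebra.lTensor_counit_comul (R := ℂ) (w i)
    rw [hΔ] at h
    simp only [map_sum, LinearMap.lTensor_tmul] at h
    have h2 : ∑ j, w j ⊗ₜ[ℂ] (if j = i then (1 : ℂ) else 0) = w i ⊗ₜ[ℂ] (1 : ℂ) := by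
      rw [Finset.sum_eq_single i] <;> simp +contextual
    exact congrFun (IsInnerProduct.tmul_ext hw (h.trans h2.symm)) k
  · have h := Coalgebra.rTensor_counit_comul (R := ℂ) (w i)
    rw [hΔ] at h
    simpa using (congrArg (TensorProduct.lid ℂ C) h).symm

end Subcomodule


section CQG

variable {H : Type u} [Ring H] [HopfAlgebra ℂ H] [StarRing H] [StarModule ℂ H]

open scoped ComplexOrder in
-- The invariant inner product on the comodule with matrix `u_{ji}^*` has a positive definite Gram
-- matrix `M`. With `D = M⁻¹` and `d_j = ε(v_j)`, invariance gives `∑ D_{jp} v_p^* v_j = (∑ d_q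
-- conj(d_k) D_{qk}) 1`. Applying `φ` yields `l · tr D` on the left and a positive number on the
-- right, so `l > 0`.
theorem IsCQG.eigenvalue_pos (hH : IsCQG H) (φ : H →ₗ[ℂ] ℂ) {ι : Type} [Fintype ι]
    [DecidableEq ι] (v : ι → H) (u : ι → ι → H) (l : ℝ)
    (hu : ∀ k i, comul (R := ℂ) (u k i) = ∑ j, u k j ⊗ₜ[ℂ] u j i)
    (hε : ∀ i j, counit (R := ℂ) (u i j) = if i = j then 1 else 0)
    (hv : ∀ i, v i = ∑ j, counit (R := ℂ) (v j) • u j i)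
    (hl : ∀ i j, φ (star (v i) * v j) = if i = j then (l : ℂ) else 0)
    (h1 : φ 1 = 1) (hne : ∃ i, v i ≠ 0) : 0 < l := by
  have hus : ∀ k i, comul (R := ℂ) (star (u k i)) = ∑ j, star (u k j) ⊗ₜ[ℂ] star (u j i) :=
    fun k i => comul_star_eq_sum hH.comul_star _ _ _ _ (hu k i)
  -- Lifted, because invariant inner products are provided for comodules in the universe of `H`.
  let V := ULift.{u} (ι → ℂ)
  let b : Module.Basis ι ℂ V := (Pi.basisFun ℂ ι).map ULift.moduleEquiv.symm
  let δ : V →ₗ[ℂ] V ⊗[ℂ] H := b.constr ℂ fun i => ∑ j, b j ⊗ₜ[ℂ] star (u j i)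
  have hδ : ∀ i, δ (b i) = ∑ j, b j ⊗ₜ[ℂ] star (u j i) := fun i => b.constr_basis ℂ _ i
  have hcom : IsRightComodule δ := by
    refine ⟨fun x => ?_, fun x => ?_⟩
    · refine LinearMap.congr_fun (f := (TensorProduct.assoc ℂ V H H).toLinearMap ∘ₗ
        δ.rTensor H ∘ₗ δ) (g := (comul (R := ℂ) (A := H)).lTensor V ∘ₗ δ) (b.ext fun i => ?_) x
      simp only [LinearMap.comp_apply, LinearEquiv.coe_coe, hδ, map_sum, LinearMap.rTensor_tmul,
        LinearMap.lTensor_tmul, TensorProduct.sum_tmul, TensorProduct.assoc_tmul, hus,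
        TensorProduct.tmul_sum]
      exact Finset.sum_comm
    · refine LinearMap.congr_fun (f := (TensorProduct.rid ℂ V).toLinearMap ∘ₗ
        (counit (R := ℂ) (A := H)).lTensor V ∘ₗ δ) (g := LinearMap.id) (b.ext fun i => ?_) x
      simp [hδ, counit_star_of_comul_star hH.comul_star, hε]
  obtain ⟨B, hB, hinv⟩ := hH.exists_inner V δ hcom
  let M : Matrix ι ι ℂ := Matrix.of fun i j => B (b i) (b j)
  have hM : M.PosDef := by
    refine Matrix.PosDef.of_dotProduct_mulVec_pos ?_ fun x hx => ?_
    · ext i j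
      exact (hB.hermitian _ _).symm
    -- The coefficients are conjugated because the form is linear in its first variable.
    · let y : V := ∑ i, star (x i) • b i
      have hy : y ≠ 0 := fun h => hx <| by
        funext i
        have := Fintype.linearIndependent_iff.1 b.linearIndependent _ h i
        simpa using this
      have h1 : star x ⬝ᵥ M.mulVec x = B y y := by
        simp only [y, map_sum, LinearMap.sum_apply, map_smul, map_smulₛₗ, LinearMap.smul_apply,
          dotProduct, Matrix.mulVec, M, Matrix.of_apply, Finset.mul_sum, smul_eq_mul]
        rw [Finset.sum_comm]
        refine Finset.sum_congr rfl fun i _ => Finset.sum_congr rfl fun j _ => ?_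
        simp
        ring
      rw [h1, Complex.pos_iff]
      refine ⟨hB.pos y hy, ?_⟩
      have := congrArg Complex.im (hB.hermitian y y)
      simp at this
      linarith
  let D := M⁻¹
  have hD : D.PosDef := hM.inv
  have hdet : IsUnit M.det := (Matrix.isUnit_iff_isUnit_det M).1 hM.isUnit
  have hDM : ∀ i j, ∑ k, D i k * M k j = if i = j then 1 else 0 := fun i j => by
    have := congrFun (congrFun (Matrix.nonsing_inv_mul M hdet) i) j
    rwa [Matrix.mul_apply, Matrix.one_apply] at this
  have hMD : ∀ i j, ∑ k, M i k * D k j = if i = j then 1 else 0 := fun i j => by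
    have := congrFun (congrFun (Matrix.mul_nonsing_inv M hdet) i) j
    rwa [Matrix.mul_apply, Matrix.one_apply] at this
  -- Invariance of the inner product, written for the basis vectors.
  have hMu : ∀ i j, ∑ k, M k j • HopfAlgebra.antipode ℂ (star (u k i)) =
      ∑ k, M i k • u k j := fun i j => by
    have h := hinv (b i) (b j)
    rw [hδ, hδ, sw_eq_sum, sw_eq_sum] at h
    · simpa [M] using h
    all_goals intros
    all_goals first
      | (simp [add_smul]; done)
      | (simp; rw [mul_comm, mul_smul])
  have hDu : ∀ q p, ∑ j, D j p • u q j =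
      ∑ i, D q i • HopfAlgebra.antipode ℂ (star (u p i)) := fun q p => by
    have e1 : ∀ i, HopfAlgebra.antipode ℂ (star (u p i)) =
        ∑ j, D j p • ∑ k, M k j • HopfAlgebra.antipode ℂ (star (u k i)) := fun i => by
      simp only [Finset.smul_sum, smul_smul]
      rw [Finset.sum_comm]
      simp only [mul_comm (D _ _), ← Finset.sum_smul, hMD, ite_smul, one_smul, zero_smul,
        Finset.sum_ite_eq', Finset.mem_univ, if_true]
    have e2 : ∀ j, u q j = ∑ i, D q i • ∑ k, M i k • u k j := fun j => by
      simp only [Finset.smul_sum, smul_smul]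
      rw [Finset.sum_comm]
      simp only [← Finset.sum_smul, hDM, ite_smul, one_smul, zero_smul,
        Finset.sum_ite_eq, Finset.mem_univ, if_true]
    rw [Finset.sum_congr rfl fun j _ => congrArg (D j p • ·) (e2 j),
      Finset.sum_congr rfl fun i _ => congrArg (D q i • ·) (e1 i)]
    simp only [← hMu]
    simp only [Finset.smul_sum]
    rw [Finset.sum_comm]
    refine Finset.sum_congr rfl fun i _ => Finset.sum_congr rfl fun j _ =>
      Finset.sum_congr rfl fun k _ => ?_
    rw [smul_comm (D j p)]
  have hanti : ∀ k i, ∑ p, star (u k p) * HopfAlgebra.antipode ℂ (star (u p i)) =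
      if k = i then 1 else 0 := fun k i => by
    have h := HopfAlgebra.mul_antipode_lTensor_comul_apply (R := ℂ) (star (u k i))
    rw [hus] at h
    simpa [counit_star_of_comul_star hH.comul_star, hε, apply_ite] using h
  -- The antipode axiom for `u_{kp}^*` removes the antipodes from the inverse form of the invariance
  -- relation.
  have hinvD : ∀ q k, ∑ p, ∑ j, D j p • (star (u k p) * u q j) = D q k • (1 : H) := fun q k => by
    simp only [← mul_smul_comm, ← Finset.mul_sum, hDu]
    simp only [Finset.mul_sum, mul_smul_comm]
    rw [Finset.sum_comm]
    simp only [← Finset.smul_sum, hanti]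
    simp
  let d : ι → ℂ := fun j => counit (R := ℂ) (v j)
  have hd : star d ≠ 0 := fun h => by
    obtain ⟨i, hi⟩ := hne
    refine hi ?_
    rw [hv i]
    refine Finset.sum_eq_zero fun j _ => ?_
    have : d j = 0 := by simpa using congrFun h j
    rw [show counit (R := ℂ) (v j) = 0 from this, zero_smul]
  have hne' : Nonempty ι := hne.nonempty
  have htr := hD.trace_pos
  have hpos := hD.dotProduct_mulVec_pos hd
  -- Contracting `hinvD` with `d` turns the entries of `u` into the vectors `v`; then `φ` is
  -- applied.
  have key : star (star d) ⬝ᵥ D.mulVec (star d) = l * D.trace := by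
    have hv' : ∀ i, v i = ∑ j, d j • u j i := hv
    have h2 : ∑ p, ∑ j, D j p • (star (v p) * v j) =
        ∑ q, ∑ k, (d q * star (d k)) • (D q k • (1 : H)) := by
      simp only [← hinvD, Finset.smul_sum]
      symm
      rw [Finset.sum_congr rfl fun q _ => Finset.sum_comm, Finset.sum_comm]
      refine Finset.sum_congr rfl fun p _ => ?_
      rw [Finset.sum_congr rfl fun q _ => Finset.sum_comm, Finset.sum_comm]
      refine Finset.sum_congr rfl fun j _ => ?_
      rw [hv' p, hv' j]
      simp only [star_sum, star_smul, Finset.sum_mul, Finset.mul_sum, Finset.smul_sum,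
        smul_mul_assoc, mul_smul_comm, smul_smul]
      refine Finset.sum_congr rfl fun q _ => Finset.sum_congr rfl fun k _ => ?_
      congr 1
      ring
    have h3 := congrArg φ h2
    simp only [map_sum, map_smul, smul_eq_mul, hl, h1, mul_one, mul_ite, mul_zero,
      Finset.sum_ite_eq, Finset.mem_univ, if_true] at h3
    rw [Matrix.trace, Finset.mul_sum]
    simp only [Matrix.diag_apply, dotProduct, Matrix.mulVec, Finset.mul_sum, star_star,
      Pi.star_apply]
    refine Eq.trans ?_ (h3.symm.trans ?_)
    · refine Finset.sum_congr rfl fun q _ => Finset.sum_congr rfl fun k _ => ?_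
      ring
    · exact Finset.sum_congr rfl fun q _ => mul_comm _ _
  rw [key, Complex.pos_iff] at hpos
  rw [Complex.pos_iff] at htr
  have := hpos.1
  simp only [Complex.mul_re, Complex.ofReal_re, Complex.ofReal_im, zero_mul, sub_zero] at this
  exact pos_of_mul_pos_left this htr.1.le


/-- The normal integral of a compact quantum group is faithful and positive. -/
theorem IsCQG.isInnerProduct_starForm (hH : IsCQG H) {φ : H →ₗ[ℂ] ℂ} (hφ : IsNormalIntegral φ) :
    IsInnerProduct (starForm φ) := by
  have hF := hφ.starForm_hermitian hH.comul_star
  refine ⟨hF, fun x hx => ?_⟩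
  -- The regular comodule. On a finite-dimensional subcomodule containing `x`, an orthonormal basis
  -- for `B` diagonalizes the form of `φ`.
  obtain ⟨B, hB, hinv⟩ := hH.exists_inner H comul isRightComodule_comul
  obtain ⟨n, w, l, u, hw, hl, hxw, hΔ, hu, hε, hv⟩ := hB.exists_matrix (starForm φ) hF x
  -- The matrix of the subcomodule is unitary in an orthonormal basis of an invariant inner product.
  have hS : ∀ i j, HopfAlgebra.antipode ℂ (u j i) = star (u i j) := fun i j => by
    have h := hinv (w i) (w j)
    rw [hΔ, hΔ, sw_eq_sum, sw_eq_sum] at h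
    · simpa [hw] using h
    all_goals intros
    all_goals first
      | (simp [add_smul]; done)
      | (simp; rw [mul_comm, mul_smul])
  -- Strong invariance of `φ`, compared with unitarity. Thus `u_{ij}` vanishes unless the
  -- eigenvalues agree.
  have hlS : ∀ i j, (l j : ℂ) • star (u i j) = (l i : ℂ) • star (u i j) := fun i j => by
    have h := hφ.sum_rep_smul_antipode (star (w j)) (w i)
    rw [hΔ, comul_star_eq_sum hH.comul_star _ _ _ _ (hΔ j),
      sum_rep_sum_tmul (fun a b => φ (star (w j) * a) • HopfAlgebra.antipode ℂ b),
      sum_rep_sum_tmul (fun a b => φ (a * w i) • b)] at h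
    · simpa [← starForm_apply, hl, hS] using h
    all_goals intros
    all_goals first
      | (simp [mul_add, add_mul, add_smul]; done)
      | (simp; rw [mul_comm, mul_smul])
  have h0 : ∀ i j, l i ≠ l j → u i j = 0 := fun i j hij => by
    have h := hlS i j
    rw [← sub_eq_zero, ← sub_smul, smul_eq_zero] at h
    rcases h with h | h
    · exact absurd (Complex.ofReal_injective (sub_eq_zero.1 h)).symm hij
    · exact star_eq_zero.1 h
  have hpos : ∀ i, 0 < l i := fun i => by
    -- The block of one eigenvalue is itself a subcomodule, so `eigenvalue_pos` applies to it.
    let ι := {j : Fin n // l j = l i}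
    have hsub : ∀ {N : Type u} [AddCommMonoid N] (f : Fin n → N),
        (∀ j, l j ≠ l i → f j = 0) → ∑ j, f j = ∑ j : ι, f j := fun f hf => by
      rw [← Finset.sum_filter_of_ne (p := fun j => l j = l i)
        fun j _ h => not_not.1 (mt (hf j) h), 
        Finset.sum_subtype (p := fun j => l j = l i) _ (by simp)]
    refine hH.eigenvalue_pos φ (ι := ι) (fun j => w j) (fun j k => u j k) (l i) (fun k j => ?_)
      (fun k j => ?_) (fun j => ?_) (fun k j => ?_) hφ.normal ⟨⟨i, rfl⟩, fun h => ?_⟩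
    · rw [hu, hsub]
      intro m hm
      rw [h0 m j (by rwa [j.2]), TensorProduct.tmul_zero]
    · rw [hε]
      exact if_congr Subtype.ext_iff.symm rfl rfl
    · conv_lhs => rw [hv, hsub _ fun m hm => by rw [h0 m j (by rwa [j.2]), smul_zero]]
    · have := hl j k
      rw [starForm_apply] at this
      rw [this, j.2]
      exact if_congr (eq_comm.trans Subtype.ext_iff.symm) rfl rfl
    · have := hw i i
      simp [show w i = 0 from h] at this
  obtain ⟨c, rfl⟩ := (Submodule.mem_span_range_iff_exists_fun ℂ).1 hxw
  have hsum : (starForm φ (∑ i, c i • w i) (∑ i, c i • w i)).re =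
      ∑ i, Complex.normSq (c i) * l i := by
    simp only [map_sum, LinearMap.sum_apply, map_smul, map_smulₛₗ, LinearMap.smul_apply,
      smul_eq_mul, hl, mul_ite, mul_zero, Finset.sum_ite_eq', Finset.mem_univ, if_true]
    rw [Complex.re_sum]
    refine Finset.sum_congr rfl fun i _ => ?_
    rw [← mul_assoc, mul_comm (starRingEnd ℂ _), Complex.mul_conj, ← Complex.ofReal_mul,
      Complex.ofReal_re]
  rw [hsum]
  refine lt_of_le_of_ne (Finset.sum_nonneg fun i _ =>
    mul_nonneg (Complex.normSq_nonneg _) (hpos i).le) fun h => hx ?_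
  rw [eq_comm, Finset.sum_eq_zero_iff_of_nonneg fun i _ =>
    mul_nonneg (Complex.normSq_nonneg _) (hpos i).le] at h
  refine Finset.sum_eq_zero fun i hi => ?_
  have := h i hi
  rw [mul_eq_zero, or_iff_left (hpos i).ne', Complex.normSq_eq_zero] at this
  rw [this, zero_smul]

/-- The tensor product of two sesquilinear forms. -/
def tensorForm {V N : Type*} [AddCommGroup V] [Module ℂ V] [AddCommGroup N] [Module ℂ N]
    (B : V →ₗ[ℂ] V →ₗ⋆[ℂ] ℂ) (B' : N →ₗ[ℂ] N →ₗ⋆[ℂ] ℂ) : V ⊗[ℂ] N →ₗ[ℂ] V ⊗[ℂ] N →ₗ⋆[ℂ] ℂ :=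
  LinearMap.mk₂'ₛₗ (RingHom.id ℂ) (starRingEnd ℂ)
    (fun s t => ∑ i ∈ rep s, ∑ j ∈ rep t, B i.1 j.1 * B' i.2 j.2)
    (fun s s' t => sum_rep_add (fun a b => ∑ j ∈ rep t, B a j.1 * B' b j.2)
      (by intros; simp [add_mul, Finset.sum_add_distrib])
      (by intros; simp [mul_add, Finset.sum_add_distrib])
      (by intros; simp [mul_left_comm, mul_assoc]) s s')
    (fun c s t => by
      rw [sum_rep_smul (fun a b => ∑ j ∈ rep t, B a j.1 * B' b j.2)
        (by intros; simp [add_mul, Finset.sum_add_distrib])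
        (by intros; simp [mul_add, Finset.sum_add_distrib])
        (by intros; simp [mul_left_comm, mul_assoc])]
      simp [Finset.mul_sum, mul_assoc])
    (fun s t t' => by
      rw [← Finset.sum_add_distrib]
      exact Finset.sum_congr rfl fun i _ => sum_rep_add (fun a b => B i.1 a * B' i.2 b)
        (by intros; simp [add_mul]) (by intros; simp [mul_add])
        (by intros; simp [mul_left_comm, mul_assoc]) t t')
    (fun c s t => by
      rw [Finset.smul_sum]
      refine Finset.sum_congr rfl fun i _ => ?_
      rw [sum_rep_smul (fun a b => B i.1 a * B' i.2 b)
        (by intros; simp [add_mul]) (by intros; simp [mul_add])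
        (by intros; simp [mul_left_comm, mul_assoc])]
      simp [Finset.mul_sum, mul_assoc])

theorem tensorForm_apply {V N : Type*} [AddCommGroup V] [Module ℂ V] [AddCommGroup N] [Module ℂ N]
    (B : V →ₗ[ℂ] V →ₗ⋆[ℂ] ℂ) (B' : N →ₗ[ℂ] N →ₗ⋆[ℂ] ℂ) (s t : V ⊗[ℂ] N) :
    tensorForm B B' s t = ∑ i ∈ rep s, ∑ j ∈ rep t, B i.1 j.1 * B' i.2 j.2 := rfl

theorem IsInnerProduct.tensorForm {V N : Type*} [AddCommGroup V] [Module ℂ V] [AddCommGroup N]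
    [Module ℂ N] {B : V →ₗ[ℂ] V →ₗ⋆[ℂ] ℂ} (hB : IsInnerProduct B) {B' : N →ₗ[ℂ] N →ₗ⋆[ℂ] ℂ}
    (hB' : IsInnerProduct B') : IsInnerProduct (tensorForm B B') := by
  refine ⟨fun s t => ?_, fun t ht => hB.tensor_pos hB' t ht⟩
  rw [tensorForm_apply, tensorForm_apply, star_sum, Finset.sum_comm]
  refine Finset.sum_congr rfl fun i _ => ?_
  rw [star_sum]
  refine Finset.sum_congr rfl fun j _ => ?_
  rw [hB.hermitian i.1 j.1, hB'.hermitian i.2 j.2, star_mul']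

/-- A `*`-Hopf algebra whose normal integral is faithful and positive is a compact quantum
group. -/
theorem isCQG_of_isInnerProduct (hs : ∀ x : H, comul (R := ℂ) (star x) = star (comul (R := ℂ) x))
    {φ : H →ₗ[ℂ] ℂ} (hφ : IsNormalIntegral φ) (hpos : IsInnerProduct (starForm φ)) : IsCQG H := by
  refine ⟨hs, fun V _ _ δ hδ => ?_⟩
  obtain ⟨B, hB⟩ := exists_isInnerProduct V
  have hT := hB.tensorForm hpos
  -- The averaged form `∑ ⟨u₀, v₀⟩ φ(v₁^* u₁)`.
  let T : V →ₗ[ℂ] V →ₗ⋆[ℂ] ℂ := LinearMap.mk₂'ₛₗ (RingHom.id ℂ) (starRingEnd ℂ)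
    (fun u v => tensorForm B (starForm φ) (δ u) (δ v)) (by intros; simp) (by intros; simp)
    (by intros; simp) (by intros; simp)
  have hTa : ∀ u v, T u v = ∑ i ∈ rep (δ u), ∑ j ∈ rep (δ v), B i.1 j.1 * starForm φ i.2 j.2 :=
    fun _ _ => rfl
  refine ⟨T, ⟨fun u v => hT.hermitian _ _, fun v hv => ?_⟩,
    fun u v => ?_⟩
  -- The coaction is injective by the counit axiom, so `T` inherits definiteness.
  · refine hT.pos _ fun h => hv ?_
    have := hδ.counit v
    rw [h] at this
    simpa using this.symm
  -- Coassociativity brings the antipode next to the leg inside `φ`, where strong invariance trades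
  -- it for a leg of `y^*`.
  · have h1 : ∀ (z : V) (y : H), 
        ∑ k ∈ rep (δ u), ∑ i ∈ rep (δ k.1), 
          (B i.1 z * starForm φ i.2 y) • HopfAlgebra.antipode ℂ k.2 =
        ∑ k ∈ rep (δ u), ∑ i ∈ rep (comul (R := ℂ) y),
          (B k.1 z * starForm φ k.2 i.1) • star i.2 := fun z y => by
      rw [hδ.sum_rep_coassoc (fun a b c => (B a z * starForm φ b y) • HopfAlgebra.antipode ℂ c)]
      · refine Finset.sum_congr rfl fun k _ => ?_
        have h := hφ.sum_rep_smul_antipode (star y) k.2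
        rw [comul_star_eq_sum hs _ _ _ _ (eq_sum_rep (comul (R := ℂ) y)),
          sum_rep_sum_tmul (fun a b => φ (a * k.2) • b)] at h
        · simpa only [mul_smul, ← Finset.smul_sum, starForm_apply] using congrArg (B k.1 z • ·) h
        all_goals intros
        all_goals first
          | (simp [add_mul, add_smul]; done)
          | (simp; rw [mul_comm, mul_smul])
      all_goals intros
      all_goals first
        | (simp [add_mul, mul_add, add_smul]; done)
        | (simp; ring_nf; done)
        | (simp; rw [← mul_smul]; ring_nf)
    have h2 : ∀ (z : V) (y : H), 
        ∑ k ∈ rep (δ v), ∑ i ∈ rep (δ k.1), 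
          (B z i.1 * starForm φ y i.2) • star k.2 =
        ∑ k ∈ rep (δ v), ∑ i ∈ rep (comul (R := ℂ) k.2),
          (B z k.1 * starForm φ y i.1) • star i.2 := fun z y => by
      rw [hδ.sum_rep_coassoc (fun a b c => (B z a * starForm φ y b) • star c)]
      all_goals intros
      all_goals first
        | (simp [add_mul, mul_add, add_smul]; done)
        | (simp; ring_nf; done)
        | (simp; rw [← mul_smul]; ring_nf)
    calc _ = ∑ k ∈ rep (δ u), ∑ i ∈ rep (δ k.1), ∑ j ∈ rep (δ v),
          (B i.1 j.1 * starForm φ i.2 j.2) • HopfAlgebra.antipode ℂ k.2 := by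
            simp only [sw_eq_sum_rep, hTa, Finset.sum_smul]
      _ = ∑ j ∈ rep (δ v), ∑ k ∈ rep (δ u), ∑ i ∈ rep (comul (R := ℂ) j.2),
          (B k.1 j.1 * starForm φ k.2 i.1) • star i.2 := by
            simp only [Finset.sum_comm (t := rep (δ v)), h1]
      _ = ∑ k ∈ rep (δ u), ∑ j ∈ rep (δ v), ∑ i ∈ rep (δ j.1),
          (B k.1 i.1 * starForm φ k.2 i.2) • star j.2 := by
            rw [Finset.sum_comm]
            simp only [h2]
      _ = _ := by
            simp only [sw_eq_sum_rep, hTa, Finset.sum_smul]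
            exact Finset.sum_comm

end CQG

/-! ### The integral of a cocycle bismash product -/

/-- A normalized left integral on a Hopf algebra with injective antipode is a normal integral. -/
theorem IsNormalIntegral.of_left {H : Type*} [Ring H] [HopfAlgebra ℂ H] {φ : H →ₗ[ℂ] ℂ}
    (hS : Function.Injective (HopfAlgebra.antipode ℂ (A := H)))
    (hl : ∀ x, smulSnd φ (comul (R := ℂ) x) = φ x • (1 : H)) (h1 : φ 1 = 1) :
    IsNormalIntegral φ := by
  have hl' : ∀ x, ∑ k ∈ rep (comul (R := ℂ) x), φ k.2 • k.1 = φ x • (1 : H) := fun x => by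
    rw [← hl x, apply_eq_sum_rep]
    simp only [smulSnd_tmul]
  -- Since the antipode reverses the coproduct, `φ ∘ S` is a right integral once `S` is cancelled by
  -- injectivity.
  have hr : ∀ x, ∑ k ∈ rep (comul (R := ℂ) x), (φ ∘ₗ HopfAlgebra.antipode ℂ) k.1 • k.2 =
      (φ ∘ₗ HopfAlgebra.antipode ℂ) x • (1 : H) := fun x => hS <| by
    have h := hl (HopfAlgebra.antipode ℂ x)
    rw [Cv.comul_antipode, map_sum] at h
    simp only [smulSnd_tmul] at h
    simpa using h
  have h := eq_of_right_left_integral hr hl' (by simp [h1]) h1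
  rw [h] at hr
  exact ⟨hr, hl', h1⟩

namespace CocycleLinkedPair

open Cv HopfAlgebra

namespace Bismash

section Functional

variable {A H : Type*} [Ring A] [Ring H] [Bialgebra ℂ A] [Bialgebra ℂ H]
  (L : CocycleLinkedPair A H)

theorem i_injective : Function.Injective (i L) := fun a b h => by
  have := congrArg (toA L) (congrArg (· * j L 1) h)
  simpa [toA_apply] using this

theorem fx_j_mul_fy_jh (γ : Cv H A) : fx H _ (j L) * fy H _ (jh L γ) =
    push H (push H (i L)) (push H L.N γ * L.X) * mm H _ (j L) := by
  rw [jh, map_mul, ← mul_assoc, fx_j_mul_fy_push_i, mul_assoc, j_mul_j, map_mul, mul_assoc]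

/-- The linear functional on `A^ψ #_χ H` that corresponds to a functional on `A ⊗ H`. -/
def functional (Φ : A ⊗[ℂ] H →ₗ[ℂ] ℂ) : L.Bismash →ₗ[ℂ] ℂ := Φ ∘ₗ (equiv L).symm.toLinearMap

theorem functional_equiv (Φ : A ⊗[ℂ] H →ₗ[ℂ] ℂ) (t : A ⊗[ℂ] H) :
    functional L Φ (equiv L t) = Φ t := by
  simp [functional]

theorem functional_comm {Φ : A ⊗[ℂ] H →ₗ[ℂ] ℂ}
    (hcentral : ∀ a x b y, Φ (L.bismashMul a x b y) = Φ (L.bismashMul b y a x))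
    (k l : L.Bismash) : functional L Φ (k * l) = functional L Φ (l * k) := by
  induction k using induction_on with
  | zero => simp
  | add k k' hk hk' => simp only [add_mul, mul_add, map_add, hk, hk']
  | mul a x =>
    induction l using induction_on with
    | zero => simp
    | add l l' hl hl' => simp only [add_mul, mul_add, map_add, hl, hl']
    | mul b y =>
      rw [i_mul_j, i_mul_j, (isBismashProduct L).mul, (isBismashProduct L).mul, functional_equiv,
        functional_equiv, hcentral]

end Functional

section Integral

variable {A H : Type*} [Ring A] [Ring H] [HopfAlgebra ℂ A] [HopfAlgebra ℂ H]
  (L : CocycleLinkedPair A H) {φA : A →ₗ[ℂ] ℂ} {φH : H →ₗ[ℂ] ℂ}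
  (hφA : IsNormalIntegral φA) (hφH : IsNormalIntegral φH)
  {Φ : A ⊗[ℂ] H →ₗ[ℂ] ℂ} (hΦ : ∀ a x, Φ (a ⊗ₜ x) = φA a * φH x)

include hΦ in
theorem functional_i_mul_j (a : A) (x : H) : functional L Φ (i L a * j L x) = φA a * φH x := by
  rw [i_mul_j, functional_equiv, hΦ]

include hφA hφH hΦ in
theorem functional_one : functional L Φ 1 = 1 := by
  have h := functional_i_mul_j L hΦ 1 1
  rwa [map_one, j_one, mul_one, hφA.normal, hφH.normal, mul_one] at h

include hφA hφH hΦ in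
-- The last legs are integrated one after another: `φ_H` collapses the legs of `x` to `1`, first
-- inside `ρ` and then inside `ψ`, where the values at `1` are trivial; `φ_A` then acts on the legs
-- of `a`.
theorem functional_left_integral (k : L.Bismash) :
    ∑ m ∈ rep (comul (R := ℂ) k), functional L Φ m.2 • m.1 = functional L Φ k • 1 := by
  let F : L.Bismash ⊗[ℂ] L.Bismash →ₗ[ℂ] L.Bismash :=
    (TensorProduct.rid ℂ L.Bismash).toLinearMap ∘ₗ (functional L Φ).lTensor _
  have hF : ∀ k l, F (k ⊗ₜ l) = functional L Φ l • k := fun k l => by simp [F]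
  have h : ∑ m ∈ rep (comul (R := ℂ) k), functional L Φ m.2 • m.1 = F (comul (R := ℂ) k) := by
    rw [apply_eq_sum_rep]
    simp only [hF]
  rw [h]
  clear h
  induction k using induction_on with
  | zero => simp
  | add k l hk hl => simp only [map_add, hk, hl, add_smul]
  | mul a x =>
    rw [sum_rep_comul_i_mul_j]
    simp only [hF, functional_i_mul_j L hΦ]
    -- `G` and `E` are the dependence on the leg inside `ρ` and inside `ψ`, as linear maps to which
    -- the left integral property of `φ_H` can be pushed forward.
    let G (b c : A) : H →ₗ[ℂ] L.Bismash := TensorProduct.lift (LinearMap.mk₂ ℂ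
      (fun h d => φA (c * d) • (i L b * j L h)) (by intros; simp [mul_add])
      (by intros; rw [map_smul, mul_smul_comm, smul_comm]) (by intros; simp [mul_add, add_smul])
      (by intros; simp [mul_smul])) ∘ₗ L.ρ
    have hG : ∀ b c y, G b c y = ∑ o ∈ rep (L.ρ y), φA (c * o.2) • (i L b * j L o.1) :=
      fun b c y => by
        rw [LinearMap.comp_apply, apply_eq_sum_rep]
        rfl
    have hG1 : ∀ b c, G b c 1 = φA c • i L b := fun b c => by
      simp [G, L.ρ_one, j_one]
    let E (b c : A) : H →ₗ[ℂ] L.Bismash := TensorProduct.lift (LinearMap.mk₂ ℂ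
      (fun d e => φA (c * e) • (i L (b * d))) (by intros; simp [mul_add])
      (by intros; rw [mul_smul_comm, map_smul, smul_comm]) (by intros; simp [mul_add, add_smul])
      (by intros; simp [mul_smul])) ∘ₗ L.ψ
    have hE : ∀ b c y, E b c y = ∑ n ∈ rep (L.ψ y), φA (c * n.2) • i L (b * n.1) :=
      fun b c y => by
        rw [LinearMap.comp_apply, apply_eq_sum_rep]
        rfl
    have hE1 : ∀ b c, E b c 1 = φA c • i L b := fun b c => by
      simp [E, L.ψ_one]
    have e₁ : ∀ (m n : A × A) (y : H), ∑ l ∈ rep (comul (R := ℂ) y), ∑ o ∈ rep (L.ρ l.1),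
        (φA (m.2 * n.2 * o.2) * φH l.2) • (i L (m.1 * n.1) * j L o.1) =
          (φA (m.2 * n.2) * φH y) • i L (m.1 * n.1) := fun m n y => by
      have h := congrArg (G (m.1 * n.1) (m.2 * n.2)) (hφH.left y)
      rw [sw2, sw_eq_sum_rep, map_sum, map_smul, hG1, smul_smul, mul_comm] at h
      rw [← h]
      refine Finset.sum_congr rfl fun l _ => ?_
      rw [map_smul, hG, Finset.smul_sum]
      exact Finset.sum_congr rfl fun o _ => by rw [smul_smul, mul_comm]
    have e₂ : ∀ m : A × A, ∑ k ∈ rep (comul (R := ℂ) x), ∑ n ∈ rep (L.ψ k.1),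
        (φA (m.2 * n.2) * φH k.2) • i L (m.1 * n.1) = (φA m.2 * φH x) • i L m.1 := fun m => by
      have h := congrArg (E m.1 m.2) (hφH.left x)
      rw [sw2, sw_eq_sum_rep, map_sum, map_smul, hE1, smul_smul, mul_comm] at h
      rw [← h]
      refine Finset.sum_congr rfl fun l _ => ?_
      rw [map_smul, hE, Finset.smul_sum]
      exact Finset.sum_congr rfl fun o _ => by rw [smul_smul, mul_comm]
    rw [Finset.sum_congr rfl fun m _ => (Finset.sum_congr rfl fun k _ =>
      Finset.sum_comm.trans (Finset.sum_congr rfl fun n _ => e₁ m n k.2)).trans (e₂ m)]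
    have h := congrArg (fun b => φH x • i L b) (hφA.left a)
    simp only [sw2, sw_eq_sum_rep, map_sum, map_smul, Finset.smul_sum, map_one, smul_smul] at h
    simpa only [mul_comm] using h

end Integral

/-! ### The map `γ` and the convolution inverse of `j` -/

section Gamma

variable {A H : Type*} [Ring A] [Ring H] [Bialgebra ℂ A] [HopfAlgebra ℂ H]
  (L : CocycleLinkedPair A H) (χinv : H ⊗[ℂ] H →ₗ[ℂ] A)
  (hS : Function.Bijective (antipode ℂ (A := H)))

/-- `gammaOf`, as an element of the convolution algebra. -/
def gamma : Cv H A := toConv (χinv ∘ₗ (TensorProduct.comm ℂ H H).toLinearMap ∘ₗ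
  (LinearEquiv.ofBijective (antipode ℂ (A := H)) hS).symm.toLinearMap.rTensor H ∘ₗ comul)

theorem gamma_apply (x : H) : gamma χinv hS x = gammaOf χinv x := by
  have h : ∀ y, (LinearEquiv.ofBijective (antipode ℂ (A := H)) hS).symm y = antipodeInv H y :=
    fun y => by
      rw [LinearEquiv.symm_apply_eq]
      exact (Function.invFun_eq (hS.2 y)).symm
  rw [gamma, toConv_apply, ← LinearMap.comp_assoc, ← LinearMap.comp_assoc, LinearMap.comp_apply,
    apply_eq_sum_rep]
  simp only [LinearMap.comp_apply, LinearMap.rTensor_tmul, LinearEquiv.coe_coe, comm_tmul, h]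
  rfl

/-- The antipode cancels its inverse in the definition of `γ`, leaving `∑ χ⁻¹(S x₁, x₂)`. -/
theorem gamma_antipode (x : H) : gamma χinv hS (antipode ℂ x) = evS (Xinv χinv) x := by
  rw [gamma, toConv_apply, LinearMap.comp_apply, LinearMap.comp_apply, LinearMap.comp_apply,
    comul_antipode, evS_apply]
  simp [LinearEquiv.ofBijective_symm_apply_apply, Xinv_apply]

/-- The reason for the choice of `γ`: both sides are `∑ χ⁻¹(S x₂, x₃) # S x₁`. -/
theorem jh_gamma_antipode (x : H) : jh L (gamma χinv hS) (antipode ℂ x) = jinv L χinv x := by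
  have e (f g : Cv H L.Bismash) (y : H) : (f * g) (antipode ℂ y) =
      ∑ c ∈ rep (comul (R := ℂ) y), f (antipode ℂ c.2) * g (antipode ℂ c.1) := by
    rw [LinearMap.convMul_apply, comul_antipode]
    simp only [map_sum]
    rfl
  have e' (y z : H) : XinvJ L χinv z (antipode ℂ y) =
      ∑ c ∈ rep (comul (R := ℂ) y), i L (χinv (antipode ℂ c.2 ⊗ₜ z)) * j L (antipode ℂ c.1) := by
    rw [XinvJ, mul_const_apply, e]
    rfl
  rw [jinv, evS_apply, jh, e]
  simp only [push_apply, gamma_antipode, evS_apply, e', Xinv_apply, map_sum, Finset.sum_mul]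
  exact (sum_rep_coassoc (fun u v w => i L (χinv (antipode ℂ v ⊗ₜ w)) * j L (antipode ℂ u))
    (fun v w => ⟨fun _ _ => by simp [mul_add], fun _ _ => by simp⟩)
    (fun v w => ⟨fun _ _ => by simp [add_mul, add_tmul], fun _ _ => by simp [← smul_tmul']⟩)
    (fun v w => ⟨fun _ _ => by simp [add_mul, tmul_add], fun _ _ => by simp⟩) x).symm

end Gamma

/-! ### Positivity of the functional `Φ` -/

section Positivity

variable {A H : Type*} [Ring A] [Ring H] [HopfAlgebra ℂ A] [HopfAlgebra ℂ H]
  (L : CocycleLinkedPair A H) {χinv : H ⊗[ℂ] H →ₗ[ℂ] A}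
  (hS : Function.Bijective (antipode ℂ (A := H)))
  (hχ : toConv L.χ * toConv χinv = 1) (hχ' : toConv χinv * toConv L.χ = 1)

include hχ hχ' in
-- The coefficient in `A` of the identity `∑ j(x₁) jh(S x₂) = ∑ j(x₁) jinv(x₂) = ε(x) 1`.
theorem evS'_push_N_gamma_mul_X : evS' (push H L.N (gamma χinv hS) * L.X) = 1 :=
  ext_fn fun x => i_injective L <| by
    have h := congrArg (fun F => evS' F x) (fx_j_mul_fy_jh L (gamma χinv hS))
    simp only [evS'_mul_mm, j_one, mul_one] at h
    rw [evS'_apply, evS'_apply] at h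
    simp only [const_mul_apply, push_apply, mul_const_apply, jh_gamma_antipode] at h
    rw [evS'_apply, map_sum, ← h, one_apply, map_smul, map_one, ← one_apply, 
      ← j_mul_jinv L hχ hχ', mul_apply]

variable {φA : A →ₗ[ℂ] ℂ} {φH : H →ₗ[ℂ] ℂ} (hφH : IsNormalIntegral φH)
  {Φ : A ⊗[ℂ] H →ₗ[ℂ] ℂ} (hΦ : ∀ a x, Φ (a ⊗ₜ x) = φA a * φH x)

include hφH hΦ hχ hχ' in
-- Write `j(y) jh(z) = ∑ i(h(y₁, z₁)) j(y₂ z₂)`. Strong invariance of `φ_H` replaces `z₁` by an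
-- antipode of a leg of `y`, giving `∑ φ_A(c h(y₁, S y₂)) φ_H(y₃ z)`; the inner sum is trivial by
-- `evS'_push_N_gamma_mul_X`.
theorem functional_i_mul_j_mul_jh (c : A) (y z : H) :
    functional L Φ (i L c * (j L y * jh L (gamma χinv hS) z)) = φA c * φH (y * z) := by
  have e := congrArg (fun F : Cv H (Cv H L.Bismash) => F z y) (fx_j_mul_fy_jh L (gamma χinv hS))
  simp only [const_mul_apply, push_apply, mul_const_apply] at e
  rw [e, mul_apply, Cv.sum_apply]
  simp only [mul_apply _ _ y]
  have hev (x : H) := congrArg (fun F : Cv H A => F x) (evS'_push_N_gamma_mul_X L hS hχ hχ')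
  simp only [evS'_apply, one_apply] at hev
  generalize push H L.N (gamma χinv hS) * L.X = h at hev ⊢
  simp only [push_apply, mm_apply, Finset.mul_sum, map_sum, ← mul_assoc, ← map_mul,
    functional_i_mul_j L hΦ]
  have h₁ (k : H × H) : ∑ l ∈ rep (comul (R := ℂ) z), φA (c * h l.1 k.1) * φH (k.2 * l.2) =
      ∑ m ∈ rep (comul (R := ℂ) k.2), φA (c * h (antipode ℂ m.1) k.1) * φH (m.2 * z) := by
    have := congrArg (fun u => φA (c * h u k.1)) (hφH.sum_rep_smul_antipode' k.2 z)
    simp only [map_sum, map_smul, Cv.sum_apply, Cv.smul_apply, Finset.mul_sum, mul_smul_comm,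
      smul_eq_mul] at this
    simpa only [mul_comm (φH _)] using this
  rw [Finset.sum_comm, Finset.sum_congr rfl fun k _ => h₁ k]
  have h₂ := sum_rep_coassoc (fun u v w => φA (c * h (antipode ℂ v) u) * φH (w * z))
    (fun v w => ⟨fun _ _ => by simp [mul_add, add_mul], fun _ _ => by simp [mul_assoc]⟩)
    (fun v w => ⟨fun _ _ => by simp [mul_add, add_mul],
      fun _ _ => by simp [mul_assoc]⟩)
    (fun v w => ⟨fun _ _ => by simp [mul_add, add_mul], fun _ _ => by simp [mul_left_comm]⟩) y
  rw [← h₂]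
  simp only [← Finset.sum_mul, ← map_sum, ← Finset.mul_sum, hev]
  have h₃ := congrArg (fun u => φA c * φH (u * z)) (sum_rep_counit_smul y)
  simp only [Finset.sum_mul, map_sum, smul_mul_assoc, map_smul, Finset.mul_sum] at h₃
  rw [← h₃]
  refine Finset.sum_congr rfl fun k _ => ?_
  simp
  ring

variable [StarRing A] [StarRing H] [StarModule ℂ A] [StarModule ℂ H]

/-- The sesquilinear form `(x, y) ↦ φ(x y^*)`. -/
def mulStarForm (φ : H →ₗ[ℂ] ℂ) : H →ₗ[ℂ] H →ₗ⋆[ℂ] ℂ :=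
  LinearMap.mk₂'ₛₗ (RingHom.id ℂ) (starRingEnd ℂ) (fun x y => φ (x * star y))
    (by intros; simp [add_mul]) (by intros; simp) (by intros; simp [mul_add])
    (by intros; simp)

theorem mulStarForm_apply (φ : H →ₗ[ℂ] ℂ) (x y : H) : mulStarForm φ x y = φ (x * star y) := rfl

/-- The involution exchanges this form with `starForm`, up to swapping the arguments. -/
theorem isInnerProduct_mulStarForm {φ : H →ₗ[ℂ] ℂ} (h : IsInnerProduct (starForm φ)) :
    IsInnerProduct (mulStarForm φ) := by
  have e (x y : H) : mulStarForm φ x y = starForm φ (star y) (star x) := by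
    rw [mulStarForm_apply, starForm_apply, star_star]
  refine ⟨fun x y => ?_, fun x hx => ?_⟩
  · rw [e, e, h.hermitian]
  · rw [e]
    exact h.pos _ (star_ne_zero.2 hx)

include hφH hΦ hχ hχ' in
-- Here centrality enters: it moves `jh(y^*)` from the far left of `jh(y^*) i(b^* a) j(x)` to the
-- far right, so that `functional_i_mul_j_mul_jh` gives `φ_A(b^* a) φ_H(x y^*)`.
theorem functional_star_mul [StarRing L.Bismash] [StarModule ℂ L.Bismash]
    (hst : ∀ k : L.Bismash, star k = st L (gamma χinv hS) k)
    (hcentral : ∀ a x b y, Φ (L.bismashMul a x b y) = Φ (L.bismashMul b y a x))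
    (k l : L.Bismash) : functional L Φ (star l * k) =
      tensorForm (starForm φA) (mulStarForm φH) ((equiv L).symm k) ((equiv L).symm l) := by
  obtain ⟨s, rfl⟩ := (equiv L).surjective k
  obtain ⟨t, rfl⟩ := (equiv L).surjective l
  rw [LinearEquiv.symm_apply_apply, LinearEquiv.symm_apply_apply, tensorForm_apply]
  rw [apply_eq_sum_rep' (equiv L) s, apply_eq_sum_rep' (equiv L) t, star_sum, Finset.mul_sum,
    map_sum]
  refine Finset.sum_congr rfl fun p _ => ?_
  rw [Finset.sum_mul, map_sum]
  refine Finset.sum_congr rfl fun q _ => ?_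
  rw [← i_mul_j, ← i_mul_j, hst, st_mul, starForm_apply, mulStarForm_apply, mul_assoc,
    functional_comm L hcentral, ← functional_i_mul_j_mul_jh L hS hχ hχ' hφH hΦ, map_mul (i L)]
  simp only [mul_assoc]

end Positivity

end Bismash

end CocycleLinkedPair

theorem mainTheorem5 {A H : Type u}
    [Ring A] [HopfAlgebra ℂ A] [StarRing A] [StarModule ℂ A]
    [Ring H] [HopfAlgebra ℂ H] [StarRing H] [StarModule ℂ H]
    (hA : IsCQG A) (hH : IsCQG H)
    (L : CocycleLinkedPair A H)
    (χinv : H ⊗[ℂ] H →ₗ[ℂ] A)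
    (hχ : toConv L.χ * toConv χinv = 1) (hχ' : toConv χinv * toConv L.χ = 1)
    (hψ : IsUnit (toConv L.ψ))
    (φA : A →ₗ[ℂ] ℂ) (φH : H →ₗ[ℂ] ℂ)
    (hφA : IsNormalIntegral φA) (hφH : IsNormalIntegral φH)
    (Φ : A ⊗[ℂ] H →ₗ[ℂ] ℂ) (hΦ : ∀ a x, Φ (a ⊗ₜ x) = φA a * φH x)
    (hcentral : ∀ a x b y, Φ (L.bismashMul a x b y) = Φ (L.bismashMul b y a x))
    (hγ : L.StarConditions (gammaOf χinv)) :
    ∃ (M : Type u) (_ : Ring M) (_ : HopfAlgebra ℂ M) (_ : StarRing M) (_ : StarModule ℂ M)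
      (e : A ⊗[ℂ] H ≃ₗ[ℂ] M),
      L.IsBismashProduct e ∧
      (∀ a x, star (e (a ⊗ₜ x)) = e (L.bismashStar (gammaOf χinv) a x)) ∧
      IsCQG M := by
  have hS := antipode_bijective hH.comul_star
  obtain ⟨⟨Ψ', Ψinv, hΨ, hΨ'⟩, hΨe⟩ := hψ
  obtain rfl : Ψ' = L.Ψ := hΨe
  let γ : Cv H A := CocycleLinkedPair.Bismash.gamma χinv hS
  have hγe : (fun x => γ x) = gammaOf χinv :=
    funext (CocycleLinkedPair.Bismash.gamma_apply χinv hS)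
  have hγ' : L.StarConditions (fun x => γ x) := hγe ▸ hγ
  let _ : HopfAlgebra ℂ L.Bismash := CocycleLinkedPair.Bismash.hopfAlgebra L hχ hχ' hΨ hΨ'
  let _ : StarRing L.Bismash := CocycleLinkedPair.Bismash.starRing L hH.comul_star hγ'
  have hst : ∀ k : L.Bismash, star k = CocycleLinkedPair.Bismash.st L γ k := fun _ => rfl
  have : StarModule ℂ L.Bismash := ⟨CocycleLinkedPair.Bismash.st_smul L γ⟩
  have hs : ∀ k : L.Bismash, comul (R := ℂ) (star k) = star (comul (R := ℂ) k) :=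
    CocycleLinkedPair.Bismash.comul_star L hH.comul_star hA.comul_star hγ'
      (CocycleLinkedPair.Bismash.st_i L hH.comul_star hγ')
      (CocycleLinkedPair.Bismash.st_j L γ)
  -- Only the left integral property is computed; the right one follows because the antipode of a
  -- `*`-Hopf algebra is bijective.
  have hint : IsNormalIntegral (CocycleLinkedPair.Bismash.functional L Φ) :=
    .of_left (antipode_bijective hs).1 (fun k => by
      rw [apply_eq_sum_rep]
      simp only [smulSnd_tmul]
      exact CocycleLinkedPair.Bismash.functional_left_integral L hφA hφH hΦ k)
      (CocycleLinkedPair.Bismash.functional_one L hφA hφH hΦ)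
  refine ⟨L.Bismash, inferInstance, inferInstance, inferInstance, inferInstance,
    CocycleLinkedPair.Bismash.equiv L, CocycleLinkedPair.Bismash.isBismashProduct L,
    fun a x => ?_, isCQG_of_isInnerProduct hs hint ⟨hint.starForm_hermitian hs, fun k hk => ?_⟩⟩
  · rw [hst, CocycleLinkedPair.Bismash.st_eq_bismashStar L hH.comul_star, hγe]
  -- The form of `Φ` is the tensor product of the inner products `φ_A(b^* a)` and `φ_H(x y^*)`.
  · rw [starForm_apply, CocycleLinkedPair.Bismash.functional_star_mul L hS hχ hχ' hφH hΦ hst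
      hcentral]
    refine ((hA.isInnerProduct_starForm hφA).tensorForm
      (CocycleLinkedPair.Bismash.isInnerProduct_mulStarForm
        (hH.isInnerProduct_starForm hφH))).pos _ ?_
    simpa using hk

end
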